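/- \textbf{Model.} A circuit of the model acts on qubits placed at the sites of an $a\times b$ grid and consists of $r$ successive rounds. In each round: (i) a classical Boolean circuit with NOT gates and AND/OR gates of fan-in two receives the outcomes of all measurements made in earlier rounds; (ii) a quantum circuit of arbitrary single-qubit unitaries and CNOT gates between neighbouring grid sites is applied, each of its gates being either unconditional or applied if and only if a designated output bit of the classical circuit equals $1$; the depth is the number of time steps, the gates in one time step acting on disjoint sets of qubits; (iii) a subset of the qubits is measured in the computational basis. The circuit (deterministically) prepares an $n$-qubit state $|\phi\rangle$ if there are $n$ designated system qubits such that, started with all qubits in $|0\rangle$, for every sequence of measurement outcomes of non-zero probability the final state is, up to a global phase, $|\phi\rangle$ on the system qubits and $|0\rangle$ on all other qubits. A family of such circuits, with size parameter $n$, is an LAQCC-LOG family if there are $O(\log n)$ rounds, every quantum circuit has depth $O(1)$, and every classical circuit has depth $O(\log n)$ and size $\mathrm{poly}(n)$ (non-uniform families are allowed). \textbf{Theorem.} For natural numbers $k\le n$ let $$|D^n_k\rangle=\binom{n}{k}^{-1/2}\sum_{x\in\{0,1\}^n,\ |x|=k}|x\rangle$$ be the Dicke-$(n,k)$ state, where $|x|$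 is the Hamming weight. The states $|D^n_k\rangle$ can be prepared by LAQCC-LOG circuits on $\mathrm{poly}(n)$ qubits, with bounds uniform in $k$. That is, there is a constant $C\in\mathbb{N}$ such that for all natural numbers $n$ and $k\le n$ there is a circuit of the above model that prepares $|D^n_k\rangle$ exactly, uses at most $Cn^C+C$ qubits and at most $C(\lfloor\log_2 n\rfloor+1)$ rounds (with $\lfloor\log_2 0\rfloor$ read as $0$), and in which every quantum circuit has depth at most $C$ and every classical circuit has depth at most $C(\lfloor\log_2 n\rfloor+1)$ and size at most $Cn^C+C$. -/

import Mathlib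

namespace LAQCC

/-! ### Boolean circuits with gates of bounded fan-in -/

/-- A gate of a Boolean circuit with input variables `ι` that may read any of `w` earlier wires. -/
inductive BoolGate (ι : Type) (w : ℕ) : Type
  | input (i : ι)
  | const (b : Bool)
  | not (u : Fin w)
  | and (u v : Fin w)
  | or (u v : Fin w)

/-- The value of a gate, from the values of the input variables and of the earlier wires. -/
def BoolGate.eval {ι : Type} {w : ℕ} (x : ι → Bool) (val : Fin w → Bool) : BoolGate ι w → Bool
  | .input i => x i
  | .const b => b
  | .not u => !(val u)
  | .and u v => val u && val v
  | .or u v => val u || val v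

/-- The depth at which a gate sits, from the depths of the earlier wires. -/
def BoolGate.depth {ι : Type} {w : ℕ} (dep : Fin w → ℕ) : BoolGate ι w → ℕ
  | .input _ => 0
  | .const _ => 0
  | .not u => dep u + 1
  | .and u v => max (dep u) (dep v) + 1
  | .or u v => max (dep u) (dep v) + 1

/-- A Boolean circuit (a directed acyclic graph, listed in topological order) of size `w`
with input variables `ι`. Every gate drives one wire, which later gates may read any number of
times; the wires are numbered `0, …, w - 1`, and each of them may serve as an output. -/
inductive BoolCircuit (ι : Type) : ℕ → Type
  | nil : BoolCircuit ι 0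
  | snoc {w : ℕ} (c : BoolCircuit ι w) (g : BoolGate ι w) : BoolCircuit ι (w + 1)

/-- The values of all wires on the input `x`. -/
def BoolCircuit.eval {ι : Type} (x : ι → Bool) : {w : ℕ} → BoolCircuit ι w → Fin w → Bool
  | _, .nil => Fin.elim0
  | _, .snoc c g => Fin.snoc (α := fun _ => Bool) (c.eval x) (g.eval x (c.eval x))

/-- The depths of all wires. -/
def BoolCircuit.depth {ι : Type} : {w : ℕ} → BoolCircuit ι w → Fin w → ℕ
  | _, .nil => Fin.elim0
  | _, .snoc c g => Fin.snoc (α := fun _ => ℕ) c.depth (g.depth c.depth)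

/-! ### Quantum circuits on a grid of qubits -/

/-- The qubits: the sites of an `a × b` grid. -/
abbrev Grid (a b : ℕ) : Type := Fin a × Fin b

/-- Two sites are direct neighbours on the grid. -/
def Adjacent {a b : ℕ} (p q : Grid a b) : Prop :=
  (p.1 = q.1 ∧ ((p.2 : ℕ) + 1 = q.2 ∨ (q.2 : ℕ) + 1 = p.2)) ∨
    (p.2 = q.2 ∧ ((p.1 : ℕ) + 1 = q.1 ∨ (q.1 : ℕ) + 1 = p.1))

/-- A (not necessarily normalized) vector of the Hilbert space of qubits labelled by `Q`, given by
its amplitudes in the computational basis. -/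
abbrev QVec (Q : Type) : Type := (Q → Bool) → ℂ

/-- The gate set: all single-qubit unitaries, and CNOT (control `c`, target `t`) between
neighbouring sites. -/
inductive QGate (a b : ℕ) : Type
  | single (q : Grid a b) (U : Matrix.unitaryGroup Bool ℂ)
  | cnot (c t : Grid a b) (h : Adjacent c t)

/-- The qubits on which a gate acts. -/
def QGate.support {a b : ℕ} : QGate a b → Finset (Grid a b)
  | .single q _ => {q}
  | .cnot c t _ => {c, t}

/-- The action of a gate on vectors. -/
def QGate.apply {a b : ℕ} : QGate a b → QVec (Grid a b) → QVec (Grid a b)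
  | .single q U, ψ => fun x =>
      ∑ s : Bool, (U : Matrix Bool Bool ℂ) (x q) s * ψ (Function.update x q s)
  | .cnot c t _, ψ => fun x => ψ (Function.update x t (xor (x t) (x c)))

/-- One time step of a quantum circuit that can be controlled by `w` classical bits: gates on
pairwise disjoint sets of qubits. A gate labelled `some i` is carried out exactly when the
classical bit `i` is one; a gate labelled `none` is always carried out. -/
structure QLayer (a b w : ℕ) : Type where
  gates : List (QGate a b × Option (Fin w))
  disjoint : gates.Pairwise fun g g' => Disjoint g.1.support g'.1.support

/-- The action of a possibly controlled gate, given the classical bits. -/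
def applyControlled {a b w : ℕ} (bits : Fin w → Bool) (g : QGate a b × Option (Fin w))
    (ψ : QVec (Grid a b)) : QVec (Grid a b) :=
  match g.2 with
  | none => g.1.apply ψ
  | some i => if bits i = true then g.1.apply ψ else ψ

/-- The action of a layer (its gates commute, as their supports are disjoint). -/
def QLayer.apply {a b w : ℕ} (bits : Fin w → Bool) (L : QLayer a b w) (ψ : QVec (Grid a b)) :
    QVec (Grid a b) :=
  L.gates.foldl (fun φ g => applyControlled bits g φ) ψ

/-- The action of a quantum circuit, a list of layers carried out from left to right. The depth of
the circuit is the length of the list. -/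
def applyLayers {a b w : ℕ} (bits : Fin w → Bool) (Q : List (QLayer a b w))
    (ψ : QVec (Grid a b)) : QVec (Grid a b) :=
  Q.foldl (fun φ L => L.apply bits φ) ψ

/-- The projection that belongs to the outcome `o` of a computational-basis measurement of the
qubits in `S`. -/
def project {a b : ℕ} (S : Finset (Grid a b)) (o : Grid a b → Bool) (ψ : QVec (Grid a b)) :
    QVec (Grid a b) :=
  fun x => if ∀ q ∈ S, x q = o q then ψ x else 0

/-! ### Local alternating quantum-classical computations -/

/-- The outcomes of all measurements so far, the most recent round first. Qubits that were not
measured in a round are recorded as `false`. -/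
abbrev History (a b : ℕ) : Type := List (Grid a b → Bool)

/-- The outcome recorded for the qubit `p.2` in the round `p.1 + 1` rounds ago (`false` if there
was no such round). -/
def History.read {a b : ℕ} (h : History a b) (p : ℕ × Grid a b) : Bool :=
  h.getD p.1 (fun _ => false) p.2

/-- One alternation: a classical circuit computes bits from the outcomes of all earlier
measurements, these bits control a quantum circuit, and then a subset of the qubits is measured. -/
structure Round (a b : ℕ) : Type where
  size : ℕ
  classical : BoolCircuit (ℕ × Grid a b) size
  quantum : List (QLayer a b size)
  measured : Finset (Grid a b)

/-- The unnormalized state after the quantum circuit of a round was run on `ψ` and the measurement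
gave the outcome `o`; its squared norm is the probability of that outcome. -/
def Round.branch {a b : ℕ} (R : Round a b) (h : History a b) (o : Grid a b → Bool)
    (ψ : QVec (Grid a b)) : QVec (Grid a b) :=
  project R.measured o (applyLayers (R.classical.eval h.read) R.quantum ψ)

/-- The record of the outcome `o` of the measurement of a round. -/
def Round.record {a b : ℕ} (R : Round a b) (o : Grid a b → Bool) : Grid a b → Bool :=
  fun q => decide (q ∈ R.measured) && o q

/-- The unnormalized final states of a sequence of rounds, started in `ψ` after the measurement
outcomes `h`, over all possible outcomes of its measurements. -/
def finalStates {a b : ℕ} : List (Round a b) → History a b → QVec (Grid a b) →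
    Set (QVec (Grid a b))
  | [], _, ψ => {ψ}
  | R :: rest, h, ψ => ⋃ o : Grid a b → Bool, finalStates rest (R.record o :: h) (R.branch h o ψ)

/-- `P` is a circuit of the model with at most `r` alternations, whose quantum circuits have depth
at most `q` and whose classical circuits have depth at most `d` and size at most `s`. -/
structure WithinBounds {a b : ℕ} (P : List (Round a b)) (r q d s : ℕ) : Prop where
  rounds_le : P.length ≤ r
  quantum_depth_le : ∀ R ∈ P, R.quantum.length ≤ q
  classical_depth_le : ∀ R ∈ P, ∀ i, R.classical.depth i ≤ d
  classical_size_le : ∀ R ∈ P, R.size ≤ s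

/-- The all-zeroes state. -/
def zeroState (Q : Type) [Fintype Q] : QVec Q :=
  fun x => if ∀ q, x q = false then 1 else 0

/-- The state `φ` on the `n` system qubits `sys 0, …, sys (n - 1)`, and zero on all others. -/
noncomputable def withAncillas {a b n : ℕ} (sys : Fin n ↪ Grid a b) (φ : QVec (Fin n)) :
    QVec (Grid a b) :=
  open Classical in
  fun x => if ∀ q, q ∉ Set.range sys → x q = false then φ (fun i => x (sys i)) else 0

/-- `P` deterministically prepares the pure state `φ` on the system qubits from the all-zeroes
state and returns all other qubits to zero: whatever the measurement outcomes, the final state is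
a multiple of the wanted one. (The gates are unitary and the projections of a measurement are
complete, so the squared norms of the final states, over all outcomes, sum to one. The
multiple is zero exactly for outcomes of probability zero.) -/
def Prepares {a b n : ℕ} (P : List (Round a b)) (sys : Fin n ↪ Grid a b) (φ : QVec (Fin n)) :
    Prop :=
  ∀ ψ ∈ finalStates P [] (zeroState (Grid a b)), ∃ z : ℂ, ψ = z • withAncillas sys φ

/-- The Dicke-`(n,k)` state: the uniform superposition of the `n`-bit strings of Hamming
weight `k`. -/
noncomputable def dicke (n k : ℕ) : QVec (Fin n) :=
  fun x => if (Finset.univ.filter fun i => x i = true).card = k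
    then ((Real.sqrt (n.choose k) : ℝ) : ℂ)⁻¹ else 0

end LAQCC

namespace LAQCC

/-! The Dicke amplitudes are those of a random walk. Draw the bits of a uniformly random string of
weight `k` one after another: if `w` ones are still to come at time `t`, the next bit is one with
probability `w / (n - t)`. The square roots of these conditional probabilities multiply to
`(n.choose k)^(-1/2)` on strings of weight `k` and to zero on all others (`prod_coinAmplitude`,
`walkAmplitude_eq_dicke`).

To run the walk in few rounds, a coin is tossed in superposition for every pair `(t, w)` at once, by
single-qubit rotations. The coins determine 0/1 transition matrices with exactly one 1 in each row,
so their products can be formed modulo 2, and repeated doubling gives the positions at all times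
after about `log n` multiplications (`computed_doubleMap`). The positions are copied out, the
matrices uncomputed, and the step at time `t` is read off as the coin at the visited position.

It remains to disentangle everything but the steps. A used coin equals the step it caused and is
erased by a controlled flip (`erase_amplitude`). The unused coins are rotated back by half rotations
interleaved with flips, which cancel on the used coins (`half_rotations`). The positions are then a
function of the steps alone: copying the steps into all coins and running the walk circuit again
clears them (`applyVLayers_positionLayers`).

All reversible steps here flip target bits by quadratic functions of bits that are not targets.
Conjugation by Hadamard gates turns them into products of doubly controlled signs, and each of these
is a product of seven phases controlled by parities (`ccz_prod`, `applyVLayers_xorLayers`).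

Polynomially many parity-controlled phases take four rounds of constant depth on the grid
(`exists_phase_rounds`). The data sit at the left ends of rows. Parity measurements next to fresh
`|+⟩` qubits copy every data bit along its row and accumulate along each column the parity of a
chosen set of data bits, up to shifts that are parities of outcomes. Classical circuits find these
shifts in logarithmic depth; after correcting flips, the phases are single-qubit gates at the
bottoms of the columns. Measuring all ancillas in the Hadamard basis leaves on the data only a sign
that is a character of the data, up to a constant factor, and `Z` gates remove it
(`exists_readout`). All outcomes thus lead to multiples of the same state. -/

/-- The parity of a list of bits. -/
def listParity (l : List Bool) : Bool := l.foldr xor false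

@[simp] lemma listParity_nil : listParity [] = false := rfl

@[simp] lemma listParity_cons (a : Bool) (l : List Bool) :
    listParity (a :: l) = xor a (listParity l) := rfl

@[simp] lemma listParity_append (l l' : List Bool) :
    listParity (l ++ l') = xor (listParity l) (listParity l') := by
  induction l with
  | nil => simp
  | cons a l ih => simp [ih]

/-! ### Parities by Boolean circuits of logarithmic depth -/

namespace BoolCircuit

variable {ι : Type}

/-- `c'` continues `c`: it has all wires of `c`, with the same values and depths. -/
def Extends {w w' : ℕ} (c : BoolCircuit ι w) (c' : BoolCircuit ι w') : Prop :=
  ∃ h : w ≤ w', (∀ x i, c'.eval x (Fin.castLE h i) = c.eval x i) ∧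
    ∀ i, c'.depth (Fin.castLE h i) = c.depth i

lemma Extends.trans {w w' w'' : ℕ} {c : BoolCircuit ι w} {c' : BoolCircuit ι w'}
    {c'' : BoolCircuit ι w''} (h : c.Extends c') (h' : c'.Extends c'') : c.Extends c'' := by
  obtain ⟨h1, h2, h3⟩ := h
  obtain ⟨h1', h2', h3'⟩ := h'
  refine ⟨h1.trans h1', fun x i => ?_, fun i => ?_⟩
  · rw [← h2, ← h2']; rfl
  · rw [← h3, ← h3']; rfl

lemma extends_snoc {w : ℕ} (c : BoolCircuit ι w) (g : BoolGate ι w) : c.Extends (c.snoc g) := by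
  refine ⟨Nat.le_succ w, fun x i => ?_, fun i => ?_⟩
  · exact Fin.snoc_castSucc (α := fun _ => Bool) _ _ i
  · exact Fin.snoc_castSucc (α := fun _ => ℕ) _ _ i

@[simp] lemma eval_snoc_last {w : ℕ} (c : BoolCircuit ι w) (g : BoolGate ι w) (x : ι → Bool) :
    (c.snoc g).eval x (Fin.last w) = g.eval x (c.eval x) :=
  Fin.snoc_last (α := fun _ => Bool) _ _

@[simp] lemma depth_snoc_last {w : ℕ} (c : BoolCircuit ι w) (g : BoolGate ι w) :
    (c.snoc g).depth (Fin.last w) = g.depth c.depth :=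
  Fin.snoc_last (α := fun _ => ℕ) _ _

@[simp] lemma eval_snoc_castSucc {w : ℕ} (c : BoolCircuit ι w) (g : BoolGate ι w) (x : ι → Bool)
    (i : Fin w) : (c.snoc g).eval x i.castSucc = c.eval x i :=
  Fin.snoc_castSucc (α := fun _ => Bool) _ _ i

@[simp] lemma depth_snoc_castSucc {w : ℕ} (c : BoolCircuit ι w) (g : BoolGate ι w)
    (i : Fin w) : (c.snoc g).depth i.castSucc = c.depth i :=
  Fin.snoc_castSucc (α := fun _ => ℕ) _ _ i

lemma depth_snoc_le {w : ℕ} (c : BoolCircuit ι w) (g : BoolGate ι w) {D : ℕ}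
    (hc : ∀ i, c.depth i ≤ D) (hg : g.depth c.depth ≤ D) (i : Fin (w + 1)) :
    (c.snoc g).depth i ≤ D := by
  induction i using Fin.lastCases with
  | last => simpa using hg
  | cast i => simpa using hc i

/-- Any circuit can be continued by the exclusive or of two of its wires. -/
lemma exists_xor {w : ℕ} (c : BoolCircuit ι w) (u v : Fin w) {d D : ℕ} (hu : c.depth u ≤ d)
    (hv : c.depth v ≤ d) (hd : d + 3 ≤ D) (hc : ∀ i, c.depth i ≤ D) :
    ∃ (c' : BoolCircuit ι (w + 4)) (out : Fin (w + 4)), c.Extends c' ∧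
      (∀ x, c'.eval x out = xor (c.eval x u) (c.eval x v)) ∧ c'.depth out ≤ d + 3 ∧
      ∀ i, c'.depth i ≤ D := by
  -- Exclusive or as `(u ∨ v) ∧ ¬(u ∧ v)`: four gates, and the longest path and–not–and has three.
  let c1 := c.snoc (.or u v)
  let c2 := c1.snoc (.and u.castSucc v.castSucc)
  let c3 := c2.snoc (.not (Fin.last _))
  let c4 := c3.snoc (.and (Fin.last w).castSucc.castSucc (Fin.last _))
  have h12 : max (c.depth u) (c.depth v) ≤ d := max_le hu hv
  have hd1 : ∀ i, c1.depth i ≤ D := depth_snoc_le _ _ hc (by simp only [BoolGate.depth]; omega)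
  have hd2 : ∀ i, c2.depth i ≤ D :=
    depth_snoc_le _ _ hd1 (by simp [BoolGate.depth, c1, -sup_le_iff]; omega)
  have hd3 : ∀ i, c3.depth i ≤ D :=
    depth_snoc_le _ _ hd2 (by simp [BoolGate.depth, c1, c2]; omega)
  have h4 : c4.depth (Fin.last _) ≤ d + 3 := by
    simp [BoolGate.depth, c1, c2, c3, c4]; omega
  refine ⟨c4, Fin.last _, ?_, fun x => ?_, h4, ?_⟩
  · exact (((extends_snoc _ _).trans (extends_snoc _ _)).trans (extends_snoc _ _)).trans
      (extends_snoc _ _)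
  · simp [BoolGate.eval, c1, c2, c3, c4]
    cases c.eval x u <;> cases c.eval x v <;> rfl
  · refine depth_snoc_le _ _ hd3 ?_
    simp [BoolGate.depth, c1, c2, c3]; omega

/-- Any circuit can be continued by a balanced tree that computes the parity of a list. -/
lemma exists_parity (E : ℕ) : ∀ (l : List ι), l.length ≤ 2 ^ E → ∀ {w : ℕ} (c : BoolCircuit ι w)
    {D : ℕ}, 3 * E ≤ D → (∀ i, c.depth i ≤ D) →
    ∃ (w' : ℕ) (c' : BoolCircuit ι w') (out : Fin w'), c.Extends c' ∧
      (∀ x, c'.eval x out = listParity (l.map x)) ∧ c'.depth out ≤ 3 * E ∧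
      (∀ i, c'.depth i ≤ D) ∧ w' + 4 ≤ w + 5 * 2 ^ E := by
  -- A tree costs at most `5 * 2 ^ E - 4` wires, since `2 * (5 * 2 ^ E - 4) + 4 = 5 * 2 ^ (E + 1) -
  -- 4`. The output depth is bounded by `3 * E` independently of the circuit being continued,
  -- because the tree starts from input gates; `D` only carries along the depth of the old wires.
  induction E with
  | zero =>
    intro l hl w c D hD hc
    rcases l with _ | ⟨a, _ | ⟨b, l⟩⟩
    · exact ⟨w + 1, c.snoc (.const false), Fin.last _, extends_snoc _ _, by simp [BoolGate.eval],
        by simp [BoolGate.depth], depth_snoc_le _ _ hc (by simp [BoolGate.depth]), by omega⟩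
    · exact ⟨w + 1, c.snoc (.input a), Fin.last _, extends_snoc _ _, by simp [BoolGate.eval],
        by simp [BoolGate.depth], depth_snoc_le _ _ hc (by simp [BoolGate.depth]), by omega⟩
    · simp at hl
  | succ E ih =>
    intro l hl w c D hD hc
    obtain ⟨w1, c1, o1, e1, v1, d1, D1, s1⟩ := ih (l.take (2 ^ E)) (by simp) c
      (by omega : 3 * E ≤ D) hc
    obtain ⟨w2, c2, o2, e2, v2, d2, D2, s2⟩ := ih (l.drop (2 ^ E))
      (by rw [List.length_drop]; rw [pow_succ] at hl; omega) c1 (by omega : 3 * E ≤ D) D1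
    have e2' := e2
    obtain ⟨h, h1, h2⟩ := e2'
    obtain ⟨c3, o3, e3, v3, d3, D3⟩ := exists_xor c2 (Fin.castLE h o1) o2 (d := 3 * E) (D := D)
      (by rw [h2]; exact d1) d2 (by omega) D2
    refine ⟨w2 + 4, c3, o3, (e1.trans e2).trans e3, fun x => ?_, by omega, D3, ?_⟩
    · rw [v3, h1, v1, v2, ← listParity_append, ← List.map_append, List.take_append_drop]
    · rw [pow_succ]; omega

/-- Parities of a family of short lists are computed by a shallow circuit. -/
lemma exists_parities {κ : Type} [Fintype κ] (l : κ → List ι) (E : ℕ)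
    (hl : ∀ k, (l k).length ≤ 2 ^ E) :
    ∃ (w : ℕ) (c : BoolCircuit ι w) (out : κ → Fin w),
      (∀ x k, c.eval x (out k) = listParity ((l k).map x)) ∧ (∀ i, c.depth i ≤ 3 * E) ∧
      w ≤ Fintype.card κ * (5 * 2 ^ E) := by
  classical
  -- The trees are appended one after another to a single circuit. Sizes add up, but depths do not,
  -- as no tree reads wires of another.
  have key : ∀ s : Finset κ, ∃ (w : ℕ) (c : BoolCircuit ι w),
      (∀ k ∈ s, ∃ out, ∀ x, c.eval x out = listParity ((l k).map x)) ∧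
      (∀ i, c.depth i ≤ 3 * E) ∧ w ≤ s.card * (5 * 2 ^ E) := by
    intro s
    induction s using Finset.induction_on with
    | empty => exact ⟨0, .nil, by simp, fun i => i.elim0, by simp⟩
    | insert a s ha ih =>
      obtain ⟨w, c, h1, h2, h3⟩ := ih
      obtain ⟨w', c', o, ⟨h, e, -⟩, v, -, D', s'⟩ := exists_parity E (l a) (hl a) c le_rfl h2
      refine ⟨w', c', fun k hk => ?_, D', ?_⟩
      · rcases Finset.mem_insert.1 hk with rfl | hk
        · exact ⟨o, v⟩
        · obtain ⟨o', ho'⟩ := h1 k hk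
          exact ⟨Fin.castLE h o', fun x => by rw [e, ho']⟩
      · rw [Finset.card_insert_of_notMem ha, add_mul]; omega
  obtain ⟨w, c, h1, h2, h3⟩ := key Finset.univ
  choose out hout using fun k => h1 k (Finset.mem_univ k)
  exact ⟨w, c, out, fun x k => hout k x, h2, h3⟩

end BoolCircuit


/-! ### Products of single-qubit gates -/

/-- A single-qubit gate acting on a vector of the Hilbert space of qubits labelled by `Q`. -/
noncomputable def act {Q : Type} [DecidableEq Q] (q : Q) (U : Matrix.unitaryGroup Bool ℂ)
    (ψ : QVec Q) : QVec Q :=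
  fun x => ∑ s : Bool, (U : Matrix Bool Bool ℂ) (x q) s * ψ (Function.update x q s)

/-- Single-qubit gates `U i` on the qubits `s i` for `i` in a list. -/
noncomputable def localOpList {ι Q : Type} [DecidableEq Q] (l : List ι) (s : ι → Q)
    (U : ι → Matrix.unitaryGroup Bool ℂ) (ψ : QVec Q) : QVec Q :=
  l.foldl (fun φ i => act (s i) (U i) φ) ψ

/-- Single-qubit gates `U i` on the qubits `s i` for `i ∈ A`. -/
noncomputable def localOp {ι Q : Type} [DecidableEq Q] (A : Finset ι) (s : ι → Q)
    (U : ι → Matrix.unitaryGroup Bool ℂ) (ψ : QVec Q) : QVec Q :=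
  localOpList A.toList s U ψ

section

variable {ι Q : Type} [DecidableEq Q]

lemma act_one (q : Q) (ψ : QVec Q) : act q 1 ψ = ψ := by
  funext x
  simp only [act, Submonoid.coe_one, Matrix.one_apply]
  rw [Fintype.sum_eq_single (x q) (fun s hs => by simp [hs.symm])]
  simp

/-- Each gate sums over its own qubit only, and the other factors and coefficients do not see that
qubit. In the induction the factor just transformed is absorbed into `Ψ`, which is allowed because
the later gates act on different qubits. -/
lemma localOpList_prod (l : List ι) (s : ι → Q) (hs : s.Injective)
    (U : ι → Matrix.unitaryGroup Bool ℂ) (hl : l.Nodup) (Ψ : QVec Q)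
    (v : ι → (Q → Bool) → Bool → ℂ)
    (hΨ : ∀ i ∈ l, ∀ x b, Ψ (Function.update x (s i) b) = Ψ x)
    (hv : ∀ i ∈ l, ∀ j ∈ l, ∀ x b, v j (Function.update x (s i) b) = v j x) :
    localOpList l s U (fun x => Ψ x * (l.map fun i => v i x (x (s i))).prod) =
      fun x => Ψ x * (l.map fun i =>
        ∑ b, (U i : Matrix Bool Bool ℂ) (x (s i)) b * v i x b).prod := by
  induction l generalizing Ψ with
  | nil => rfl
  | cons a l ih =>
    have hal : a ∉ l := (List.nodup_cons.1 hl).1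
    have h1 : localOpList (a :: l) s U
        (fun x => Ψ x * ((a :: l).map fun i => v i x (x (s i))).prod) =
        localOpList l s U (fun x => (Ψ x * ∑ b, (U a : Matrix Bool Bool ℂ) (x (s a)) b * v a x b) *
          (l.map fun i => v i x (x (s i))).prod) := by
      rw [localOpList, List.foldl_cons]
      change localOpList l s U _ = _
      congr 1
      funext x
      have h2 : ∀ b, (l.map fun i => v i (Function.update x (s a) b)
          (Function.update x (s a) b (s i))).prod = (l.map fun i => v i x (x (s i))).prod := by
        intro b
        congr 1
        refine List.map_congr_left fun i hi => ?_
        rw [hv a (by simp) i (by simp [hi]), Function.update_of_ne]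
        exact fun h => hal (hs h ▸ hi)
      simp only [act, List.map_cons, List.prod_cons, h2, hΨ a (by simp), hv a (by simp) a (by simp),
        Function.update_self, Finset.mul_sum, Finset.sum_mul]
      exact Finset.sum_congr rfl fun b _ => by ring
    rw [h1, ih (List.nodup_cons.1 hl).2]
    · funext x
      simp only [List.map_cons, List.prod_cons]
      ring
    · intro i hi x b
      have : s a ≠ s i := fun h => hal (hs h ▸ hi)
      simp only [hΨ i (by simp [hi]), hv i (by simp [hi]) a (by simp), Function.update_of_ne this]
    · exact fun i hi j hj => hv i (by simp [hi]) j (by simp [hj])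

/-- Single-qubit gates act on the factors of a vector that is a product over the qubits acted on,
with coefficients depending on the other qubits. -/
lemma localOp_prod (A : Finset ι) (s : ι → Q) (hs : s.Injective)
    (U : ι → Matrix.unitaryGroup Bool ℂ) (Ψ : QVec Q)
    (v : ι → (Q → Bool) → Bool → ℂ)
    (hΨ : ∀ i ∈ A, ∀ x b, Ψ (Function.update x (s i) b) = Ψ x)
    (hv : ∀ i ∈ A, ∀ j ∈ A, ∀ x b, v j (Function.update x (s i) b) = v j x) :
    localOp A s U (fun x => Ψ x * ∏ i ∈ A, v i x (x (s i))) =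
      fun x => Ψ x * ∏ i ∈ A, ∑ b, (U i : Matrix Bool Bool ℂ) (x (s i)) b * v i x b := by
  have := localOpList_prod A.toList s hs U A.nodup_toList Ψ v (by simpa using hΨ)
    (by simpa using hv)
  simpa only [localOp, Finset.prod_map_toList] using this

/-- A sequence of controlled bit flips whose targets are never controls. -/
lemma exists_foldl_flip (l : List ι) (hl : l.Nodup) (s : ι → Q) (hs : s.Injective)
    (f : ι → (Q → Bool) → Bool)
    (hf : ∀ i ∈ l, ∀ j ∈ l, ∀ x b, f j (Function.update x (s i) b) = f j x) :
    ∃ π : (Q → Bool) → Q → Bool,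
      (∀ ψ : QVec Q, l.foldl (fun φ i x => φ (Function.update x (s i) (xor (x (s i)) (f i x)))) ψ =
        fun x => ψ (π x)) ∧
      (∀ x, ∀ i ∈ l, π x (s i) = xor (x (s i)) (f i x)) ∧
      (∀ x q, (∀ i ∈ l, s i ≠ q) → π x q = x q) ∧ ∀ i ∈ l, ∀ x, f i (π x) = f i x := by
  induction l with
  | nil => exact ⟨id, fun ψ => rfl, by simp, by simp, by simp⟩
  | cons a l ih =>
    have hal : a ∉ l := (List.nodup_cons.1 hl).1
    obtain ⟨π, h1, h2, h3, h4⟩ := ih (List.nodup_cons.1 hl).2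
      fun i hi j hj => hf i (by simp [hi]) j (by simp [hj])
    have hne : ∀ i ∈ l, s i ≠ s a := fun i hi h => hal (hs h ▸ hi)
    have hfa : ∀ x, f a (π x) = f a x := by
      intro x
      -- A function that ignores each target bit separately also ignores simultaneous changes of any
      -- number of them: the bits are restored one at a time.
      have : ∀ (m : List ι), (∀ i ∈ m, i ∈ l) → ∀ x y : Q → Bool,
          (∀ q, (∀ i ∈ m, s i ≠ q) → y q = x q) → f a y = f a x := by
        intro m
        induction m with
        | nil => intro _ x y h; congr 1; funext q; exact h q (by simp)
        | cons i m ihm =>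
          intro hm x y h
          rw [← hf i (by simp [hm i (by simp)]) a (by simp) y (x (s i))]
          refine ihm (fun j hj => hm j (by simp [hj])) _ _ fun q hq => ?_
          by_cases hqi : q = s i
          · subst hqi; simp
          · rw [Function.update_of_ne hqi]
            refine h q fun j hj => ?_
            rcases List.mem_cons.1 hj with rfl | hj
            · exact fun h => hqi h.symm
            · exact hq j hj
      exact this l (fun _ h => h) x (π x) (h3 x)
    -- On vectors the head of the list acts first, so in the substitution on bit strings its flip
    -- comes after `π`.
    refine ⟨fun x => Function.update (π x) (s a) (xor (π x (s a)) (f a (π x))), fun ψ => ?_,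
      fun x i hi => ?_, fun x q hq => ?_, fun i hi x => ?_⟩
    · rw [List.foldl_cons, h1]
    · beta_reduce
      rcases List.mem_cons.1 hi with rfl | hi
      · simp only [Function.update_self]
        rw [h3 x _ hne, hfa]
      · rw [Function.update_of_ne (hne i hi), h2 x i hi]
    · beta_reduce
      rw [Function.update_of_ne (hq a (by simp)).symm]
      exact h3 x q fun i hi => hq i (by simp [hi])
    · rw [hf a (by simp) i hi]
      rcases List.mem_cons.1 hi with rfl | hi
      · exact hfa x
      · exact h4 i hi x

end

/-! ### Some gates -/

/-- The sign that belongs to a bit. -/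
noncomputable def sgn (b : Bool) : ℂ := if b then -1 else 1

@[simp] lemma sgn_false : sgn false = 1 := rfl

@[simp] lemma sgn_true : sgn true = -1 := rfl

lemma sgn_xor (a b : Bool) : sgn (xor a b) = sgn a * sgn b := by
  cases a <;> cases b <;> simp

/-- The Hadamard gate. -/
noncomputable def hadamard : Matrix.unitaryGroup Bool ℂ :=
  ⟨Matrix.of fun a b => ((Real.sqrt 2 : ℝ) : ℂ)⁻¹ * sgn (a && b), by
    have h : ((Real.sqrt 2 : ℝ) : ℂ)⁻¹ * ((Real.sqrt 2 : ℝ) : ℂ)⁻¹ = 2⁻¹ := by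
      rw [← mul_inv, ← Complex.ofReal_mul, Real.mul_self_sqrt (by norm_num)]; norm_num
    rw [Matrix.mem_unitaryGroup_iff]
    ext i j
    cases i <;> cases j <;>
      (simp [Matrix.mul_apply, Matrix.star_apply, h]; try norm_num)⟩

/-- The bit flip. -/
noncomputable def pauliX : Matrix.unitaryGroup Bool ℂ :=
  ⟨Matrix.of fun a b => if a = b then 0 else 1, by
    rw [Matrix.mem_unitaryGroup_iff]
    ext i j
    cases i <;> cases j <;> simp [Matrix.mul_apply, Matrix.star_apply]⟩

/-- The gate that multiplies `|1⟩` by `exp (i θ)`. -/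
noncomputable def phaseGate (θ : ℝ) : Matrix.unitaryGroup Bool ℂ :=
  ⟨Matrix.of fun a b => if a = b then (if a then Complex.exp (θ * Complex.I) else 1) else 0, by
    have h : Complex.exp (θ * Complex.I) * (starRingEnd ℂ) (Complex.exp (θ * Complex.I)) = 1 := by
      rw [← Complex.exp_conj, ← Complex.exp_add]; simp
    rw [Matrix.mem_unitaryGroup_iff]
    ext i j
    cases i <;> cases j <;> simp [Matrix.mul_apply, Matrix.star_apply, h]⟩

/-- The real rotation by the angle `θ`. -/
noncomputable def rotation (θ : ℝ) : Matrix.unitaryGroup Bool ℂ :=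
  ⟨Matrix.of fun a b => ((if a = b then Real.cos θ else if a then Real.sin θ else -Real.sin θ : ℝ) :
      ℂ), by
    have h : (Real.cos θ : ℂ) * Real.cos θ + (Real.sin θ : ℂ) * Real.sin θ = 1 := by
      rw [← Complex.ofReal_mul, ← Complex.ofReal_mul, ← Complex.ofReal_add, ← sq, ← sq,
        Real.cos_sq_add_sin_sq, Complex.ofReal_one]
    rw [Matrix.mem_unitaryGroup_iff]
    ext i j
    cases i <;> cases j <;>
      simp [Matrix.mul_apply, Matrix.star_apply, -Complex.ofReal_cos, -Complex.ofReal_sin] <;>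
      first | linear_combination h | ring⟩

lemma hadamard_apply (a b : Bool) :
    (hadamard : Matrix Bool Bool ℂ) a b = ((Real.sqrt 2 : ℝ) : ℂ)⁻¹ * sgn (a && b) := rfl

lemma pauliX_apply (a b : Bool) :
    (pauliX : Matrix Bool Bool ℂ) a b = if a = b then 0 else 1 := rfl

lemma phaseGate_apply (θ : ℝ) (a b : Bool) : (phaseGate θ : Matrix Bool Bool ℂ) a b =
    if a = b then (if a then Complex.exp (θ * Complex.I) else 1) else 0 := rfl

lemma rotation_apply (θ : ℝ) (a b : Bool) : (rotation θ : Matrix Bool Bool ℂ) a b =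
    ((if a = b then Real.cos θ else if a then Real.sin θ else -Real.sin θ : ℝ) : ℂ) := rfl

section

variable {ι Q : Type} [DecidableEq Q]

lemma act_pauliX (q : Q) (ψ : QVec Q) :
    act q pauliX ψ = fun x => ψ (Function.update x q (xor (x q) true)) := by
  funext x
  simp only [act, pauliX_apply, Fintype.sum_bool]
  cases x q <;> simp

lemma act_phaseGate (q : Q) (θ : ℝ) (ψ : QVec Q) :
    act q (phaseGate θ) ψ = fun x => (if x q then Complex.exp (θ * Complex.I) else 1) * ψ x := by
  funext x
  simp only [act, phaseGate_apply]
  rw [Fintype.sum_eq_single (x q) (fun s hs => by simp [hs.symm])]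
  simp

lemma localOpList_phase (l : List ι) (s : ι → Q) (θ : ι → ℝ) (ψ : QVec Q) :
    localOpList l s (fun i => phaseGate (θ i)) ψ =
      fun x => (l.map fun i => if x (s i) then Complex.exp (θ i * Complex.I) else 1).prod * ψ x := by
  induction l generalizing ψ with
  | nil => simp [localOpList]
  | cons a l ih =>
    rw [localOpList, List.foldl_cons]
    change localOpList l s _ _ = _
    rw [ih, act_phaseGate]
    funext x
    simp only [List.map_cons, List.prod_cons]
    ring

lemma localOp_phase (A : Finset ι) (s : ι → Q) (θ : ι → ℝ) (ψ : QVec Q) :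
    localOp A s (fun i => phaseGate (θ i)) ψ =
      fun x => (∏ i ∈ A, if x (s i) then Complex.exp (θ i * Complex.I) else 1) * ψ x := by
  rw [localOp, localOpList_phase]
  simp only [Finset.prod_map_toList]

lemma exists_localOp_flip (A : Finset ι) (s : ι → Q) (hs : s.Injective) (b : ι → Bool) :
    ∃ π : (Q → Bool) → Q → Bool,
      (∀ ψ, localOp A s (fun i => if b i then pauliX else 1) ψ = fun x => ψ (π x)) ∧
      (∀ x, ∀ i ∈ A, π x (s i) = xor (x (s i)) (b i)) ∧
      ∀ x q, (∀ i ∈ A, s i ≠ q) → π x q = x q := by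
  obtain ⟨π, h1, h2, h3, -⟩ := exists_foldl_flip A.toList A.nodup_toList s hs (fun i _ => b i)
    (fun _ _ _ _ _ _ => rfl)
  refine ⟨π, fun ψ => ?_, by simpa using h2, by simpa using h3⟩
  rw [← h1, localOp, localOpList]
  congr 1
  funext φ i
  by_cases hb : b i
  · simp only [hb, if_true, act_pauliX]
  · simp [hb, act_one]

end

/-! ### Layers of gates on the grid -/

section

variable {a b w : ℕ} {ι : Type}

/-- One time step of single-qubit gates, each of them unconditional or classically controlled. -/
noncomputable def singleLayer (A : Finset ι) (s : ι → Grid a b) (hs : s.Injective)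
    (U : ι → Matrix.unitaryGroup Bool ℂ) (ctrl : ι → Option (Fin w)) : QLayer a b w where
  gates := A.toList.map fun i => (QGate.single (s i) (U i), ctrl i)
  disjoint := by
    rw [List.pairwise_map]
    exact A.nodup_toList.imp fun h => by simpa [QGate.support] using fun h' => h (hs h')

lemma singleLayer_apply (A : Finset ι) (s : ι → Grid a b) (hs : s.Injective)
    (U : ι → Matrix.unitaryGroup Bool ℂ) (ctrl : ι → Option (Fin w)) (bits : Fin w → Bool)
    (ψ : QVec (Grid a b)) :
    (singleLayer A s hs U ctrl).apply bits ψ =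
      localOp A s (fun i => if (ctrl i).elim true bits then U i else 1) ψ := by
  rw [QLayer.apply, singleLayer, List.foldl_map, localOp, localOpList]
  congr 1
  funext φ i
  rcases h : ctrl i with _ | j
  · simp [applyControlled]; rfl
  · by_cases hb : bits j
    · simp [applyControlled, hb]; rfl
    · simp [applyControlled, hb, act_one]

/-- One time step of CNOT gates. -/
noncomputable def cnotLayer (A : Finset ι) (c t : ι → Grid a b) (hc : c.Injective)
    (ht : t.Injective) (hct : ∀ i j, c i ≠ t j) (hadj : ∀ i, Adjacent (c i) (t i)) :
    QLayer a b w where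
  gates := A.toList.map fun i => (QGate.cnot (c i) (t i) (hadj i), none)
  disjoint := by
    rw [List.pairwise_map]
    refine A.nodup_toList.imp fun {i j} h => ?_
    simp only [QGate.support, Finset.disjoint_insert_left, Finset.disjoint_singleton_left,
      Finset.mem_insert, Finset.mem_singleton, not_or]
    exact ⟨⟨fun h' => h (hc h'), hct _ _⟩, fun h' => hct _ _ h'.symm, fun h' => h (ht h')⟩

lemma exists_cnotLayer_apply (A : Finset ι) (c t : ι → Grid a b) (hc : c.Injective)
    (ht : t.Injective) (hct : ∀ i j, c i ≠ t j) (hadj : ∀ i, Adjacent (c i) (t i)) :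
    ∃ π : (Grid a b → Bool) → Grid a b → Bool,
      (∀ (bits : Fin w → Bool) (ψ : QVec (Grid a b)),
        (cnotLayer A c t hc ht hct hadj : QLayer a b w).apply bits ψ = fun x => ψ (π x)) ∧
      (∀ x, ∀ i ∈ A, π x (t i) = xor (x (t i)) (x (c i))) ∧
      ∀ x q, (∀ i ∈ A, t i ≠ q) → π x q = x q := by
  obtain ⟨π, h1, h2, h3, -⟩ := exists_foldl_flip A.toList A.nodup_toList t ht (fun i x => x (c i))
    (fun i _ j _ x b => Function.update_of_ne (hct _ _) _ _)
  refine ⟨π, fun bits ψ => ?_, by simpa using h2, by simpa using h3⟩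
  rw [QLayer.apply, cnotLayer, List.foldl_map, ← h1]
  rfl

end


/-! ### Parities -/

/-- A bit as an element of the field with two elements. -/
def bitZ (b : Bool) : ZMod 2 := if b then 1 else 0

@[simp] lemma bitZ_false : bitZ false = 0 := rfl

@[simp] lemma bitZ_true : bitZ true = 1 := rfl

lemma bitZ_xor (a b : Bool) : bitZ (xor a b) = bitZ a + bitZ b := by
  cases a <;> cases b <;> decide

lemma bitZ_and (a b : Bool) : bitZ (a && b) = bitZ a * bitZ b := by
  cases a <;> cases b <;> decide

lemma bitZ_injective : Function.Injective bitZ := by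
  intro a b
  cases a <;> cases b <;> simp [bitZ]

lemma bitZ_decide (z : ZMod 2) : bitZ (decide (z = 1)) = z := by
  revert z; decide

lemma bitZ_listParity (l : List Bool) : bitZ (listParity l) = (l.map bitZ).sum := by
  induction l with
  | nil => rfl
  | cons a l ih => simp [bitZ_xor, ih]

/-- The sign that belongs to an element of the field with two elements. -/
noncomputable def sgnZ (z : ZMod 2) : ℂ := sgn (decide (z = 1))

lemma sgnZ_bitZ (b : Bool) : sgnZ (bitZ b) = sgn b := by
  cases b <;> simp [sgnZ, bitZ]

lemma sgnZ_add (y z : ZMod 2) : sgnZ (y + z) = sgnZ y * sgnZ z := by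
  rw [sgnZ, sgnZ, sgnZ, ← sgn_xor]
  congr 1
  revert y z; decide

lemma prod_sgn {ι : Type} (A : Finset ι) (f : ι → Bool) :
    ∏ i ∈ A, sgn (f i) = sgnZ (∑ i ∈ A, bitZ (f i)) := by
  classical
  induction A using Finset.induction_on with
  | empty => simp [sgnZ]
  | insert a A ha ih => rw [Finset.prod_insert ha, Finset.sum_insert ha, sgnZ_add, ih, sgnZ_bitZ]

section

variable {V : Type} [Fintype V]

/-- The parity of the bits of `x` selected by `S`. -/
def par (S x : V → Bool) : Bool := decide (∑ v, bitZ (S v) * bitZ (x v) = 1)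

lemma bitZ_par (S x : V → Bool) : bitZ (par S x) = ∑ v, bitZ (S v) * bitZ (x v) := bitZ_decide _

lemma par_xor (S T x : V → Bool) : par (fun v => xor (S v) (T v)) x = xor (par S x) (par T x) := by
  apply bitZ_injective
  simp only [bitZ_xor, bitZ_par, add_mul, Finset.sum_add_distrib]

lemma par_false (x : V → Bool) : par (fun _ => false) x = false := by
  simp [par]

lemma par_single [DecidableEq V] (v : V) (x : V → Bool) :
    par (fun w => decide (w = v)) x = x v := by
  apply bitZ_injective
  rw [bitZ_par, Fintype.sum_eq_single v (fun w hw => by simp [hw])]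
  simp

lemma par_and_single [DecidableEq V] (b : Bool) (v : V) (x : V → Bool) :
    par (fun w => b && decide (w = v)) x = (b && x v) := by
  cases b
  · simp [par_false]
  · simp [par_single]

end

/-! ### Vectors supported on a set of bit strings -/

open Classical in
/-- The part of a vector that is supported on the bit strings with property `P`. -/
noncomputable def restrictTo {Q : Type} (P : (Q → Bool) → Prop) (f : QVec Q) : QVec Q :=
  fun x => if P x then f x else 0

lemma restrictTo_congr {Q : Type} {P P' : (Q → Bool) → Prop} {f f' : QVec Q} (h : ∀ x, P x ↔ P' x)
    (hf : ∀ x, P x → f x = f' x) : restrictTo P f = restrictTo P' f' := by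
  funext x
  by_cases hx : P x
  · simp [restrictTo, hx, (h x).1 hx, hf]
  · simp [restrictTo, hx, mt (h x).2 hx]

section

variable {ι Q : Type} [DecidableEq Q]

/-- On a qubit known to be zero a Hadamard gate lifts the constraint, at the cost of a factor `1 /
√2`. This is how fresh `|+⟩` qubits enter the chains. -/
lemma localOp_hadamard (A : Finset ι) (s : ι → Q) (hs : s.Injective) (P : (Q → Bool) → Prop)
    (f : QVec Q) (hP : ∀ i ∈ A, ∀ x b, P (Function.update x (s i) b) ↔ P x)
    (hf : ∀ i ∈ A, ∀ x b, f (Function.update x (s i) b) = f x) :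
    localOp A s (fun _ => hadamard) (restrictTo (fun x => P x ∧ ∀ i ∈ A, x (s i) = false) f) =
      restrictTo P fun x => ((Real.sqrt 2 : ℝ) : ℂ)⁻¹ ^ A.card * f x := by
  classical
  have h := localOp_prod A s hs (fun _ => hadamard) (restrictTo P f)
    (fun _ _ b => if b = false then 1 else 0)
    (fun i hi x b => by simp only [restrictTo, hP i hi, hf i hi]) (fun _ _ _ _ _ _ => rfl)
  have e1 : restrictTo (fun x => P x ∧ ∀ i ∈ A, x (s i) = false) f =
      fun x => restrictTo P f x * ∏ i ∈ A, if x (s i) = false then (1 : ℂ) else 0 := by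
    funext x
    rw [Finset.prod_ite_zero]
    by_cases h1 : P x <;> by_cases h2 : ∀ i ∈ A, x (s i) = false <;> simp [restrictTo, h1, h2]
  rw [e1, h]
  funext x
  have e2 : ∀ i, ∑ b, (hadamard : Matrix Bool Bool ℂ) (x (s i)) b *
      (if b = false then (1 : ℂ) else 0) = ((Real.sqrt 2 : ℝ) : ℂ)⁻¹ := by
    intro i
    simp [hadamard_apply]
  simp only [e2, Finset.prod_const]
  by_cases h1 : P x <;> simp [restrictTo, h1, mul_comm]

lemma project_restrictTo {a b : ℕ} (S : Finset (Grid a b)) (o : Grid a b → Bool)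
    (P : (Grid a b → Bool) → Prop) (f : QVec (Grid a b)) :
    project S o (restrictTo P f) = restrictTo (fun x => P x ∧ ∀ q ∈ S, x q = o q) f := by
  funext x
  by_cases h1 : P x <;> simp [project, restrictTo, h1]

/-- The vector `φ` on the qubits `emb v`, and zero on all others. -/
noncomputable def embed {V : Type} (emb : V → Q) (φ : QVec V) : QVec Q :=
  restrictTo (fun x => ∀ q, q ∉ Set.range emb → x q = false) fun x => φ fun v => x (emb v)

end

/-! ### Reading out a state whose ancillas are affine functions of the data -/

open Classical in
/-- The sites that carry no data. -/
noncomputable def ancillas {V : Type} {a b : ℕ} (emb : V → Grid a b) : Finset (Grid a b) := Finset.univ.filter fun q => q ∉ Set.range emb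

lemma mem_ancillas {V : Type} {a b : ℕ} (emb : V → Grid a b) (q : Grid a b) :
    q ∈ ancillas emb ↔ q ∉ Set.range emb := by
  simp [ancillas]

section

variable {V : Type} [Fintype V] {a b : ℕ} (emb : V → Grid a b)

/-- The state in which the ancilla `q` holds the parity `Λ q` of the data, shifted by `s q`. -/
noncomputable def affineState (Λ : Grid a b → V → Bool) (s : Grid a b → Bool) (φ : QVec V) :
    QVec (Grid a b) :=
  restrictTo (fun x => ∀ q ∈ ancillas emb, x q = xor (s q) (par (Λ q) fun v => x (emb v)))
    fun x => φ fun v => x (emb v)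

/-- The factor by which a list of parity-controlled phases multiplies the amplitude of `x`. -/
noncomputable def phaseFactor {κ : Type} [Fintype κ] (S : κ → V → Bool) (θ : κ → ℝ)
    (x : V → Bool) : ℂ :=
  ∏ j, if par (S j) x then Complex.exp (θ j * Complex.I) else 1

/-- The classically controlled correction: flipping `Y j` exactly when its shift is one leaves the
bare parity there, and the form of the state is preserved. -/
lemma affineState_flip {κ : Type} [Fintype κ] (Y : κ → Grid a b) (hY : Y.Injective)
    (hYa : ∀ j, Y j ∈ ancillas emb) (Λ : Grid a b → V → Bool) (s : Grid a b → Bool) (φ : QVec V) :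
    ∃ s' : Grid a b → Bool, (∀ j, s' (Y j) = false) ∧
      localOp Finset.univ Y (fun j => if s (Y j) then pauliX else 1) (affineState emb Λ s φ) =
        affineState emb Λ s' φ := by
  classical
  obtain ⟨π, h1, h2, h3⟩ := exists_localOp_flip Finset.univ Y hY fun j => s (Y j)
  refine ⟨fun q => if q ∈ Set.range Y then false else s q, by simp, ?_⟩
  have hd : ∀ x v, π x (emb v) = x (emb v) := fun x v => h3 x _ fun j _ h =>
    (mem_ancillas emb _).1 (hYa j) ⟨v, h.symm⟩
  rw [h1]
  funext x
  simp only [affineState, restrictTo, hd]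
  refine if_congr (forall₂_congr fun q hq => ?_) rfl rfl
  by_cases h : q ∈ Set.range Y
  · obtain ⟨j, rfl⟩ := h
    rw [h2 x j (Finset.mem_univ _)]
    simp only [Set.mem_range, exists_apply_eq_apply, if_true, Bool.false_xor]
    cases x (Y j) <;> cases s (Y j) <;> simp
  · rw [h3 x q fun j _ h' => h ⟨j, h'⟩, if_neg h]

/-- Where the shift vanishes, the ancilla equals a parity of the data, so a single-qubit phase on it
is a parity-controlled phase on the data. -/
lemma affineState_phase {κ : Type} [Fintype κ] (Y : κ → Grid a b)
    (hYa : ∀ j, Y j ∈ ancillas emb) (Λ : Grid a b → V → Bool) (s : Grid a b → Bool)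
    (hs : ∀ j, s (Y j) = false) (θ : κ → ℝ) (φ : QVec V) :
    localOp Finset.univ Y (fun j => phaseGate (θ j)) (affineState emb Λ s φ) =
      affineState emb Λ s fun d => phaseFactor (fun j => Λ (Y j)) θ d * φ d := by
  classical
  rw [localOp_phase]
  funext x
  simp only [affineState, restrictTo]
  split_ifs with h
  · congr 1
    refine Finset.prod_congr rfl fun j _ => ?_
    rw [h _ (hYa j), hs, Bool.false_xor]
  · simp

/-- Given the data, each ancilla is in a basis state, and a Hadamard gate turns its value into a
sign. The modulus no longer depends on the ancilla bits, so measuring them next reveals nothing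
about the data. -/
lemma affineState_hadamard (Λ : Grid a b → V → Bool) (s : Grid a b → Bool) (φ : QVec V) :
    localOp (ancillas emb) id (fun _ => hadamard) (affineState emb Λ s φ) =
      fun x => φ (fun v => x (emb v)) * (((Real.sqrt 2 : ℝ) : ℂ)⁻¹ ^ (ancillas emb).card *
        ∏ q ∈ ancillas emb, sgn (x q && xor (s q) (par (Λ q) fun v => x (emb v)))) := by
  classical
  have hd : ∀ q ∈ ancillas emb, ∀ (x : Grid a b → Bool) c,
      (fun v => Function.update x q c (emb v)) = fun v => x (emb v) := by
    intro q hq x c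
    funext v
    exact Function.update_of_ne (fun h => (mem_ancillas emb q).1 hq ⟨v, h⟩) _ _
  have h := localOp_prod (ancillas emb) (id : Grid a b → Grid a b) Function.injective_id
    (fun _ => hadamard) (fun x => φ fun v => x (emb v))
    (fun q x c => if c = xor (s q) (par (Λ q) fun v => x (emb v)) then 1 else 0)
    (fun q hq x c => by simp only [id, hd q hq])
    (fun q hq q' _ x c => by simp only [id, hd q hq])
  have e1 : affineState emb Λ s φ = fun x => φ (fun v => x (emb v)) * ∏ q ∈ ancillas emb,
      if x (id q) = xor (s q) (par (Λ q) fun v => x (emb v)) then (1 : ℂ) else 0 := by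
    funext x
    rw [Finset.prod_ite_zero]
    simp only [affineState, restrictTo, id]
    split_ifs <;> simp
  rw [e1, h]
  funext x
  simp only [mul_ite, mul_one, mul_zero, Finset.sum_ite_eq', Finset.mem_univ, if_true,
    hadamard_apply, Finset.prod_mul_distrib, Finset.prod_const, id]

/-- Undoing the phases caused by the measurement of ancillas that hold parities of the data. -/
lemma prod_sgn_parities (Λ : Grid a b → V → Bool) (s o : Grid a b → Bool) (z d : V → Bool)
    (hz : ∀ v, bitZ (z v) = ∑ q ∈ ancillas emb, bitZ (o q) * bitZ (Λ q v)) :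
    (∏ q ∈ ancillas emb, sgn (o q && xor (s q) (par (Λ q) d))) * ∏ v, sgn (z v && d v) =
      ∏ q ∈ ancillas emb, sgn (o q && s q) := by
  simp only [prod_sgn, ← sgnZ_add]
  congr 1
  -- In the exponent, the data-dependent term occurs twice, once from the measurement and once from
  -- the correction. It cancels modulo 2 after exchanging the sums over ancillas and data.
  simp only [bitZ_and, bitZ_xor, bitZ_par, hz, mul_add, Finset.sum_add_distrib, Finset.mul_sum,
    Finset.sum_mul]
  rw [Finset.sum_comm (s := Finset.univ), add_assoc, ← Finset.sum_add_distrib]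
  simp only [mul_assoc, CharTwo.add_self_eq_zero, Finset.sum_const_zero,
    add_zero]

lemma phaseGate_zero : phaseGate 0 = 1 := by
  ext i j
  rw [phaseGate_apply]
  cases i <;> cases j <;> simp

/-- The sign caused by the outcome `o` is, up to a constant, a character of the data, hence a
product of `Z` gates (`phaseGate Real.pi`) on the data qubits selected by `z`. Flipping the ancillas
by `o` returns them to zero. -/
lemma localOp_reset (Λ : Grid a b → V → Bool) (s o : Grid a b → Bool)
    (z : V → Bool) (hz : ∀ v, bitZ (z v) = ∑ q ∈ ancillas emb, bitZ (o q) * bitZ (Λ q v))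
    (c : ℂ) (φ : QVec V) :
    localOp Finset.univ emb (fun v => if z v then phaseGate Real.pi else 1)
      (localOp (ancillas emb) id (fun q => if o q then pauliX else 1)
        (project (ancillas emb) o fun x => φ (fun v => x (emb v)) * (c *
          ∏ q ∈ ancillas emb, sgn (x q && xor (s q) (par (Λ q) fun v => x (emb v)))))) =
      (c * ∏ q ∈ ancillas emb, sgn (o q && s q)) • embed emb φ := by
  classical
  obtain ⟨π, h1, h2, h3⟩ := exists_localOp_flip (ancillas emb) (id : Grid a b → Grid a b)
    Function.injective_id o
  have hd : ∀ x v, π x (emb v) = x (emb v) := fun x v => h3 x _ fun q hq h =>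
    (mem_ancillas emb _).1 hq ⟨v, h.symm⟩
  have hU : (fun v => if z v then phaseGate Real.pi else 1) =
      fun v => phaseGate (if z v then Real.pi else 0) := by
    funext v
    split_ifs <;> simp [phaseGate_zero]
  rw [h1, hU, localOp_phase]
  funext x
  have hZ : ∏ v, (if x (emb v) then
      Complex.exp (((if z v then Real.pi else 0 : ℝ) : ℂ) * Complex.I) else 1) =
      ∏ v, sgn (z v && x (emb v)) := by
    refine Finset.prod_congr rfl fun v _ => ?_
    cases x (emb v) <;> cases z v <;> simp [Complex.exp_pi_mul_I]
  have hP : (∀ q ∈ ancillas emb, π x q = o q) ↔ ∀ q, q ∉ Set.range emb → x q = false := by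
    simp only [← mem_ancillas]
    refine forall₂_congr fun q hq => ?_
    have := h2 x q hq
    change π x q = xor (x q) (o q) at this
    rw [this]
    cases x q <;> cases o q <;> simp
  rw [hZ]
  simp only [project, hP, hd, embed, restrictTo, Pi.smul_apply, smul_eq_mul]
  split_ifs with h
  · rw [← prod_sgn_parities emb Λ s o z (fun v => x (emb v)) hz]
    have : ∏ q ∈ ancillas emb, sgn (π x q && xor (s q) (par (Λ q) fun v => x (emb v))) =
        ∏ q ∈ ancillas emb, sgn (o q && xor (s q) (par (Λ q) fun v => x (emb v))) :=
      Finset.prod_congr rfl fun q hq => by rw [hP.2 h q hq]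
    rw [this]
    ring
  · simp

end


/-! ### The sites of the grid -/

section

variable {N M : ℕ}

/-- The site in row `p` and column `q`. -/
def site (N M p q : ℕ) : Grid (2 * N + 1) (2 * M + 1) := (Fin.ofNat _ p, Fin.ofNat _ q)

lemma site_eta (q : Grid (2 * N + 1) (2 * M + 1)) : site N M q.1 q.2 = q := by
  ext <;> simp [site]

lemma site_fst {p q : ℕ} (hp : p < 2 * N + 1) : ((site N M p q).1 : ℕ) = p := by
  simp [site, Nat.mod_eq_of_lt hp]

lemma site_snd {p q : ℕ} (hq : q < 2 * M + 1) : ((site N M p q).2 : ℕ) = q := by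
  simp [site, Nat.mod_eq_of_lt hq]

lemma site_eq {p q p' q' : ℕ} (hp : p < 2 * N + 1) (hq : q < 2 * M + 1) (hp' : p' < 2 * N + 1)
    (hq' : q' < 2 * M + 1) (h : site N M p q = site N M p' q') : p = p' ∧ q = q' := by
  have h1 := congrArg (fun x => (x.1 : ℕ)) h
  have h2 := congrArg (fun x => (x.2 : ℕ)) h
  simp only [site_fst hp, site_fst hp', site_snd hq, site_snd hq'] at h1 h2
  exact ⟨h1, h2⟩

lemma site_adjacent {p q p' q' : ℕ} (hp : p < 2 * N + 1) (hq : q < 2 * M + 1)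
    (hp' : p' < 2 * N + 1) (hq' : q' < 2 * M + 1)
    (h : (p = p' ∧ (q + 1 = q' ∨ q' + 1 = q)) ∨ (q = q' ∧ (p + 1 = p' ∨ p' + 1 = p))) :
    Adjacent (site N M p q) (site N M p' q') := by
  simp only [Adjacent, Fin.ext_iff, site_fst hp, site_fst hp', site_snd hq, site_snd hq']
  exact h

/-- The link between the row chain `p.1` and the column chain `p.2`. -/
def link (p : Fin N × Fin M) : Grid (2 * N + 1) (2 * M + 1) := site N M (2 * p.1 + 1) (2 * p.2 + 1)

/-- The neighbour to the left of a link. -/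
def leftOf (p : Fin N × Fin M) : Grid (2 * N + 1) (2 * M + 1) := site N M (2 * p.1 + 1) (2 * p.2)

/-- The neighbour to the right of a link. -/
def rightOf (p : Fin N × Fin M) : Grid (2 * N + 1) (2 * M + 1) :=
  site N M (2 * p.1 + 1) (2 * p.2 + 2)

/-- The neighbour above a link. -/
def above (p : Fin N × Fin M) : Grid (2 * N + 1) (2 * M + 1) := site N M (2 * p.1) (2 * p.2 + 1)

/-- The neighbour below a link. -/
def below (p : Fin N × Fin M) : Grid (2 * N + 1) (2 * M + 1) := site N M (2 * p.1 + 2) (2 * p.2 + 1)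

lemma site_injective {f g : ℕ → ℕ} (hf : f.Injective) (hg : g.Injective)
    (hf' : ∀ i < N, f i < 2 * N + 1) (hg' : ∀ j < M, g j < 2 * M + 1) :
    Function.Injective fun p : Fin N × Fin M => site N M (f p.1) (g p.2) := by
  intro p p' h
  have := site_eq (hf' _ p.1.2) (hg' _ p.2.2) (hf' _ p'.1.2) (hg' _ p'.2.2) h
  exact Prod.ext (Fin.ext (hf this.1)) (Fin.ext (hg this.2))

lemma link_injective : (link : Fin N × Fin M → _).Injective :=
  site_injective (f := fun i => 2 * i + 1) (g := fun j => 2 * j + 1) (fun _ _ => by simp)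
    (fun _ _ => by simp) (fun _ _ => by omega) (fun _ _ => by omega)

lemma leftOf_injective : (leftOf : Fin N × Fin M → _).Injective :=
  site_injective (f := fun i => 2 * i + 1) (g := fun j => 2 * j) (fun _ _ => by simp)
    (fun _ _ => by simp) (fun _ _ => by omega) (fun _ _ => by omega)

lemma rightOf_injective : (rightOf : Fin N × Fin M → _).Injective :=
  site_injective (f := fun i => 2 * i + 1) (g := fun j => 2 * j + 2) (fun _ _ => by simp)
    (fun _ _ => by simp) (fun _ _ => by omega) (fun _ _ => by omega)

lemma above_injective : (above : Fin N × Fin M → _).Injective :=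
  site_injective (f := fun i => 2 * i) (g := fun j => 2 * j + 1) (fun _ _ => by simp)
    (fun _ _ => by simp) (fun _ _ => by omega) (fun _ _ => by omega)

lemma below_injective : (below : Fin N × Fin M → _).Injective :=
  site_injective (f := fun i => 2 * i + 2) (g := fun j => 2 * j + 1) (fun _ _ => by simp)
    (fun _ _ => by simp) (fun _ _ => by omega) (fun _ _ => by omega)

lemma leftOf_ne_link (p p' : Fin N × Fin M) : leftOf p ≠ link p' := fun h => by
  have := site_eq (by omega) (by omega) (by omega) (by omega) h; omega

lemma rightOf_ne_link (p p' : Fin N × Fin M) : rightOf p ≠ link p' := fun h => by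
  have := site_eq (by omega) (by omega) (by omega) (by omega) h; omega

lemma above_ne_link (p p' : Fin N × Fin M) : above p ≠ link p' := fun h => by
  have := site_eq (by omega) (by omega) (by omega) (by omega) h; omega

lemma below_ne_link (p p' : Fin N × Fin M) : below p ≠ link p' := fun h => by
  have := site_eq (by omega) (by omega) (by omega) (by omega) h; omega

lemma below_ne_leftOf (p p' : Fin N × Fin M) : below p ≠ leftOf p' := fun h => by
  have := site_eq (by omega) (by omega) (by omega) (by omega) h; omega

lemma below_ne_rightOf (p p' : Fin N × Fin M) : below p ≠ rightOf p' := fun h => by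
  have := site_eq (by omega) (by omega) (by omega) (by omega) h; omega

lemma leftOf_adjacent (p : Fin N × Fin M) : Adjacent (leftOf p) (link p) :=
  site_adjacent (by omega) (by omega) (by omega) (by omega) (by omega)

lemma rightOf_adjacent (p : Fin N × Fin M) : Adjacent (rightOf p) (link p) :=
  site_adjacent (by omega) (by omega) (by omega) (by omega) (by omega)

lemma above_adjacent (p : Fin N × Fin M) : Adjacent (above p) (link p) :=
  site_adjacent (by omega) (by omega) (by omega) (by omega) (by omega)

lemma below_adjacent (p : Fin N × Fin M) : Adjacent (below p) (link p) :=
  site_adjacent (by omega) (by omega) (by omega) (by omega) (by omega)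

end

section

variable {V : Type} {N : ℕ} (e : V ≃ Fin N) (M : ℕ)

/-- The site of the data qubit `v`. -/
def dataSite (v : V) : Grid (2 * N + 1) (2 * M + 1) := site N M (2 * e v + 1) 0

lemma dataSite_injective : (dataSite e M).Injective := by
  intro v v' h
  have := site_eq (by omega) (by omega) (by omega) (by omega) h
  exact e.injective (Fin.ext (by omega))

lemma dataSite_ne_link (v : V) (p : Fin N × Fin M) : dataSite e M v ≠ link p := fun h => by
  have := site_eq (by omega) (by omega) (by omega) (by omega) h; omega

lemma dataSite_ne_rightOf (v : V) (p : Fin N × Fin M) : dataSite e M v ≠ rightOf p := fun h => by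
  have := site_eq (by omega) (by omega) (by omega) (by omega) h; omega

lemma dataSite_ne_below (v : V) (p : Fin N × Fin M) : dataSite e M v ≠ below p := fun h => by
  have := site_eq (by omega) (by omega) (by omega) (by omega) h; omega

/-! ### Growing the row and column chains -/

/-- The round that copies every data qubit along its row. -/
noncomputable def rowRound (N M : ℕ) : Round (2 * N + 1) (2 * M + 1) where
  size := 0
  classical := .nil
  quantum := [singleLayer Finset.univ rightOf rightOf_injective (fun _ => hadamard) (fun _ => none),
    cnotLayer Finset.univ leftOf link leftOf_injective link_injective leftOf_ne_link
      leftOf_adjacent,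
    cnotLayer Finset.univ rightOf link rightOf_injective link_injective rightOf_ne_link
      rightOf_adjacent]
  measured := Finset.univ.image link

/-- The round that accumulates the parity of the data qubits selected by `S` along every column. -/
noncomputable def columnRound (N M : ℕ) (S : Finset (Fin N × Fin M)) :
    Round (2 * N + 1) (2 * M + 1) where
  size := 0
  classical := .nil
  quantum := [singleLayer Finset.univ below below_injective (fun _ => hadamard) (fun _ => none),
    cnotLayer Finset.univ above link above_injective link_injective above_ne_link above_adjacent,
    cnotLayer Finset.univ below link below_injective link_injective below_ne_link below_adjacent,
    cnotLayer S leftOf link leftOf_injective link_injective leftOf_ne_link leftOf_adjacent]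
  measured := Finset.univ.image link

/-- The bit strings compatible with the outcome `m` of the row measurement. -/
structure RowChain (m x : Grid (2 * N + 1) (2 * M + 1) → Bool) : Prop where
  link_eq : ∀ p, x (link p) = m (link p)
  right_eq : ∀ p, x (rightOf p) = xor (x (leftOf p)) (m (link p))
  zero : ∀ q, q ∉ Set.range (dataSite e M) → (∀ p, rightOf p ≠ q) → (∀ p, link p ≠ q) →
    x q = false

/-- The bit strings compatible with the outcomes `m` and `m'` of the row and column
measurements. -/
structure ColumnChain (S : Finset (Fin N × Fin M))
    (m m' x : Grid (2 * N + 1) (2 * M + 1) → Bool) : Prop where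
  link_eq : ∀ p, x (link p) = m' (link p)
  right_eq : ∀ p, x (rightOf p) = xor (x (leftOf p)) (m (link p))
  below_eq : ∀ p, x (below p) =
    xor (xor (x (above p)) (decide (p ∈ S) && x (leftOf p))) (xor (m (link p)) (m' (link p)))
  zero : ∀ q, q ∉ Set.range (dataSite e M) → (∀ p, rightOf p ≠ q) → (∀ p, link p ≠ q) →
    (∀ p, below p ≠ q) → x q = false

lemma restrictTo_comp {Q : Type} (P : (Q → Bool) → Prop) (f : QVec Q) (π : (Q → Bool) → Q → Bool)
    (hf : ∀ x, f (π x) = f x) :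
    (fun x => restrictTo P f (π x)) = restrictTo (fun x => P (π x)) f := by
  funext x
  simp [restrictTo, hf]

/-- A link measures the parity of its two horizontal neighbours. The right one is a fresh `|+⟩`, so
the outcome only fixes it to be the left one shifted by the outcome. All links work in parallel, and
the scalar is the same for all outcomes. -/
lemma rowRound_branch (h : History (2 * N + 1) (2 * M + 1)) (m : Grid (2 * N + 1) (2 * M + 1) → Bool)
    (φ : QVec V) :
    ∃ c : ℂ, (rowRound N M).branch h m (embed (dataSite e M) φ) =
      restrictTo (RowChain e M m) fun x => (c • φ) fun v => x (dataSite e M v) := by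
  obtain ⟨π₁, a1, b1, c1⟩ := exists_cnotLayer_apply (w := 0) (Finset.univ : Finset (Fin N × Fin M))
    leftOf link leftOf_injective link_injective leftOf_ne_link leftOf_adjacent
  obtain ⟨π₂, a2, b2, c2⟩ := exists_cnotLayer_apply (w := 0) (Finset.univ : Finset (Fin N × Fin M))
    rightOf link rightOf_injective link_injective rightOf_ne_link rightOf_adjacent
  have d1 : ∀ x q, (∀ p, link p ≠ q) → π₁ x q = x q := fun x q h => c1 x q fun p _ => h p
  have d2 : ∀ x q, (∀ p, link p ≠ q) → π₂ x q = x q := fun x q h => c2 x q fun p _ => h p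
  have hD1 : ∀ x, (fun v => π₁ x (dataSite e M v)) = fun v => x (dataSite e M v) := fun x =>
    funext fun v => d1 x _ fun p => (dataSite_ne_link e M v p).symm
  have hD2 : ∀ x, (fun v => π₂ x (dataSite e M v)) = fun v => x (dataSite e M v) := fun x =>
    funext fun v => d2 x _ fun p => (dataSite_ne_link e M v p).symm
  -- The zero constraints on the right neighbours are separated from the others, so that the
  -- Hadamard gates can lift them.
  have e1 : embed (dataSite e M) φ = restrictTo (fun x => (∀ q, q ∉ Set.range (dataSite e M) →
      (∀ p, rightOf p ≠ q) → x q = false) ∧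
      ∀ p ∈ (Finset.univ : Finset (Fin N × Fin M)), x (rightOf p) = false)
      (fun x => φ fun v => x (dataSite e M v)) := by
    refine restrictTo_congr (fun x => ⟨fun h => ⟨fun q hq _ => h q hq, fun p _ => h _ ?_⟩,
      fun h q hq => ?_⟩) fun _ _ => rfl
    · rintro ⟨v, hv⟩
      exact dataSite_ne_rightOf e M v p hv
    · by_cases h' : ∃ p, rightOf p = q
      · obtain ⟨p, rfl⟩ := h'
        exact h.2 p (Finset.mem_univ p)
      · exact h.1 q hq (not_exists.1 h')
  refine ⟨((Real.sqrt 2 : ℝ) : ℂ)⁻¹ ^ (Finset.univ : Finset (Fin N × Fin M)).card, ?_⟩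
  simp only [Round.branch, rowRound, applyLayers, List.foldl_cons, List.foldl_nil, a1, a2,
    singleLayer_apply, Option.elim_none, if_true]
  rw [e1, localOp_hadamard]
  · rw [restrictTo_comp _ _ (fun x => π₁ (π₂ x)) fun x => by rw [hD1, hD2], project_restrictTo]
    refine restrictTo_congr (fun x => ?_) fun x _ => rfl
    have hl : ∀ p, π₁ (π₂ x) (link p) = xor (xor (x (link p)) (x (rightOf p))) (x (leftOf p)) := by
      intro p
      rw [b1 _ p (Finset.mem_univ p), b2 _ p (Finset.mem_univ p),
        d2 _ _ fun p' => (leftOf_ne_link p p').symm]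
    constructor
    · rintro ⟨h1, h2⟩
      have h2' : ∀ p, x (link p) = m (link p) := fun p => h2 _ (by simp)
      refine ⟨h2', fun p => ?_, fun q hq hr hk => ?_⟩
      · have := h1 (link p) (fun ⟨v, hv⟩ => dataSite_ne_link e M v p hv)
          fun p' => rightOf_ne_link p' p
        rw [hl, h2'] at this
        revert this
        cases x (rightOf p) <;> cases x (leftOf p) <;> simp
      · have := h1 q hq hr
        rwa [d1 _ _ hk, d2 _ _ hk] at this
    · rintro ⟨h1, h2, h3⟩
      refine ⟨fun q hq hr => ?_, Finset.forall_mem_image.2 fun p _ => h1 p⟩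
      by_cases hk : ∃ p, link p = q
      · obtain ⟨p, rfl⟩ := hk
        rw [hl, h1, h2]
        cases x (leftOf p) <;> cases m (link p) <;> rfl
      · have hk' := not_exists.1 hk
        rw [d1 _ _ hk', d2 _ _ hk']
        exact h3 q hq hr hk'
  · exact rightOf_injective
  · intro p _ x b
    refine forall_congr' fun q => forall_congr' fun _ => forall_congr' fun hr => ?_
    rw [Function.update_of_ne (hr p).symm]
  · intro p _ x b
    congr 1
    funext v
    exact Function.update_of_ne (dataSite_ne_rightOf e M v p) _ _

/-- The same mechanism runs downwards, with the left neighbour added to the measured parity for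
links in `S`. The links have not been reset, so they still hold the row outcome `m` when the new
parities are added to them; hence both `m` and `m'` enter the relation for `below`. -/
lemma columnRound_branch (S : Finset (Fin N × Fin M)) (h : History (2 * N + 1) (2 * M + 1))
    (m m' : Grid (2 * N + 1) (2 * M + 1) → Bool) (φ : QVec V) :
    ∃ c : ℂ, (columnRound N M S).branch h m'
        (restrictTo (RowChain e M m) fun x => φ fun v => x (dataSite e M v)) =
      restrictTo (ColumnChain e M S m m') fun x => (c • φ) fun v => x (dataSite e M v) := by
  obtain ⟨π₁, a1, b1, c1⟩ := exists_cnotLayer_apply (w := 0) (Finset.univ : Finset (Fin N × Fin M))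
    above link above_injective link_injective above_ne_link above_adjacent
  obtain ⟨π₂, a2, b2, c2⟩ := exists_cnotLayer_apply (w := 0) (Finset.univ : Finset (Fin N × Fin M))
    below link below_injective link_injective below_ne_link below_adjacent
  obtain ⟨π₃, a3, b3, c3⟩ := exists_cnotLayer_apply (w := 0) S
    leftOf link leftOf_injective link_injective leftOf_ne_link leftOf_adjacent
  have d1 : ∀ x q, (∀ p, link p ≠ q) → π₁ x q = x q := fun x q h => c1 x q fun p _ => h p
  have d2 : ∀ x q, (∀ p, link p ≠ q) → π₂ x q = x q := fun x q h => c2 x q fun p _ => h p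
  have d3 : ∀ x q, (∀ p, link p ≠ q) → π₃ x q = x q := fun x q h => c3 x q fun p _ => h p
  have hD1 : ∀ x, (fun v => π₁ x (dataSite e M v)) = fun v => x (dataSite e M v) := fun x =>
    funext fun v => d1 x _ fun p => (dataSite_ne_link e M v p).symm
  have hD2 : ∀ x, (fun v => π₂ x (dataSite e M v)) = fun v => x (dataSite e M v) := fun x =>
    funext fun v => d2 x _ fun p => (dataSite_ne_link e M v p).symm
  have hD3 : ∀ x, (fun v => π₃ x (dataSite e M v)) = fun v => x (dataSite e M v) := fun x =>
    funext fun v => d3 x _ fun p => (dataSite_ne_link e M v p).symm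
  -- Before this round the sites below links are untouched ancillas; their zero constraints are the
  -- ones to be lifted.
  have e1 : (restrictTo (RowChain e M m) fun x => φ fun v => x (dataSite e M v)) =
      restrictTo (fun x => ((∀ p, x (link p) = m (link p)) ∧
        (∀ p, x (rightOf p) = xor (x (leftOf p)) (m (link p))) ∧
        ∀ q, q ∉ Set.range (dataSite e M) → (∀ p, rightOf p ≠ q) → (∀ p, link p ≠ q) →
          (∀ p, below p ≠ q) → x q = false) ∧
        ∀ p ∈ (Finset.univ : Finset (Fin N × Fin M)), x (below p) = false)
      (fun x => φ fun v => x (dataSite e M v)) := by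
    refine restrictTo_congr (fun x => ⟨fun h => ⟨⟨h.1, h.2, fun q hq h1 h2 _ => h.3 q hq h1 h2⟩,
      fun p _ => h.3 _ ?_ ?_ ?_⟩, fun h => ⟨h.1.1, h.1.2.1, fun q hq h1 h2 => ?_⟩⟩) fun _ _ => rfl
    · rintro ⟨v, hv⟩
      exact dataSite_ne_below e M v p hv
    · exact fun p' => (below_ne_rightOf p p').symm
    · exact fun p' => (below_ne_link p p').symm
    · by_cases h' : ∃ p, below p = q
      · obtain ⟨p, rfl⟩ := h'
        exact h.2 p (Finset.mem_univ p)
      · exact h.1.2.2 q hq h1 h2 (not_exists.1 h')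
  refine ⟨((Real.sqrt 2 : ℝ) : ℂ)⁻¹ ^ (Finset.univ : Finset (Fin N × Fin M)).card, ?_⟩
  simp only [Round.branch, columnRound, applyLayers, List.foldl_cons, List.foldl_nil, a1, a2, a3,
    singleLayer_apply, Option.elim_none, if_true]
  rw [e1, localOp_hadamard]
  · rw [restrictTo_comp _ _ (fun x => π₁ (π₂ (π₃ x))) fun x => by rw [hD1, hD2, hD3], project_restrictTo]
    refine restrictTo_congr (fun x => ?_) fun x _ => rfl
    have hl : ∀ p, π₁ (π₂ (π₃ x)) (link p) = xor (xor (xor (x (link p))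
        (decide (p ∈ S) && x (leftOf p))) (x (below p))) (x (above p)) := by
      intro p
      rw [b1 _ p (Finset.mem_univ p), b2 _ p (Finset.mem_univ p),
        d2 _ _ fun p' => (above_ne_link p p').symm, d3 _ _ fun p' => (above_ne_link p p').symm,
        d3 _ _ fun p' => (below_ne_link p p').symm]
      by_cases hp : p ∈ S
      · rw [b3 _ p hp]; simp [hp]
      · rw [c3 _ _ fun p' hp' h' => hp (by rwa [← link_injective h'])]; simp [hp]
    have hd : ∀ q, (∀ p, link p ≠ q) → π₁ (π₂ (π₃ x)) q = x q := fun q hq => by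
      rw [d1 _ _ hq, d2 _ _ hq, d3 _ _ hq]
    have hr : ∀ p, π₁ (π₂ (π₃ x)) (rightOf p) = x (rightOf p) := fun p =>
      hd _ fun p' => (rightOf_ne_link p p').symm
    have hf : ∀ p, π₁ (π₂ (π₃ x)) (leftOf p) = x (leftOf p) := fun p =>
      hd _ fun p' => (leftOf_ne_link p p').symm
    simp only [hl, hr, hf]
    constructor
    · rintro ⟨⟨h1, h2, h3⟩, h4⟩
      have h4' : ∀ p, x (link p) = m' (link p) := fun p => h4 _ (by simp)
      refine ⟨h4', h2, fun p => ?_, fun q hq h5 h6 h7 => ?_⟩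
      · rw [← h1 p, h4']
        cases x (below p) <;> cases x (above p) <;> cases decide (p ∈ S) <;>
          cases x (leftOf p) <;> cases m' (link p) <;> rfl
      · rw [← h3 q hq h5 h6 h7, hd q h6]
    · rintro ⟨h1, h2, h3, h4⟩
      refine ⟨⟨fun p => ?_, h2, fun q hq h5 h6 h7 => ?_⟩, Finset.forall_mem_image.2 fun p _ => h1 p⟩
      · rw [h1, h3]
        cases x (above p) <;> cases decide (p ∈ S) <;>
          cases x (leftOf p) <;> cases m' (link p) <;> cases m (link p) <;> rfl
      · rw [hd q h6, h4 q hq h5 h6 h7]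
  · exact below_injective
  · intro p _ x b
    have u1 : ∀ p', Function.update x (below p) b (link p') = x (link p') := fun p' =>
      Function.update_of_ne (below_ne_link p p').symm _ _
    have u2 : ∀ p', Function.update x (below p) b (rightOf p') = x (rightOf p') := fun p' =>
      Function.update_of_ne (below_ne_rightOf p p').symm _ _
    have u3 : ∀ p', Function.update x (below p) b (leftOf p') = x (leftOf p') := fun p' =>
      Function.update_of_ne (below_ne_leftOf p p').symm _ _
    simp only [u1, u2, u3]
    refine and_congr Iff.rfl (and_congr Iff.rfl ?_)
    refine forall_congr' fun q => forall_congr' fun _ => forall_congr' fun _ =>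
      forall_congr' fun _ => forall_congr' fun hr => ?_
    rw [Function.update_of_ne (hr p).symm]
  · intro p _ x b
    congr 1
    funext v
    exact Function.update_of_ne (dataSite_ne_below e M v p) _ _

end


/-! ### The read-out rounds -/

lemma project_congr {a b : ℕ} {S : Finset (Grid a b)} {o o' : Grid a b → Bool}
    (h : ∀ q ∈ S, o q = o' q) (ψ : QVec (Grid a b)) : project S o ψ = project S o' ψ := by
  funext x
  simp only [project]
  exact if_congr (forall₂_congr fun q hq => by rw [h q hq]) rfl rfl

lemma project_empty {a b : ℕ} (o : Grid a b → Bool) (ψ : QVec (Grid a b)) :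
    project ∅ o ψ = ψ := by
  funext x
  simp [project]

@[simp] lemma History.read_cons_zero {a b : ℕ} (h : History a b) (o : Grid a b → Bool)
    (q : Grid a b) : History.read (o :: h) (0, q) = o q := rfl

@[simp] lemma History.read_cons_succ {a b : ℕ} (h : History a b) (o : Grid a b → Bool) (t : ℕ)
    (q : Grid a b) : History.read (o :: h) (t + 1, q) = h.read (t, q) := by
  simp [History.read]

/-- The bounds on one round of a circuit. -/
structure RoundBound {a b : ℕ} (R : Round a b) (q d s : ℕ) : Prop where
  quantum_le : R.quantum.length ≤ q
  depth_le : ∀ i, R.classical.depth i ≤ d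
  size_le : R.size ≤ s

/-- The first round corrects the shifts at the sites `Y j`, applies the phases there, and measures
all ancillas in the Hadamard basis. The second round flips the ancillas back to zero and removes the
resulting sign from the data. -/
lemma exists_readout {V κ : Type} [Fintype V] [Fintype κ] {a b : ℕ} (emb : V → Grid a b)
    (hemb : emb.Injective) (Y : κ → Grid a b) (hY : Y.Injective) (hYa : ∀ j, Y j ∈ ancillas emb)
    (Λ : Grid a b → V → Bool) (l : Grid a b → List (ℕ × Grid a b)) (θ : κ → ℝ) (E : ℕ)
    (hl : ∀ j, (l (Y j)).length ≤ 2 ^ E) (hg : a * b ≤ 2 ^ E) :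
    ∃ R R' : Round a b,
      RoundBound R 3 (3 * E) (10 * 4 ^ E) ∧ RoundBound R' 2 (3 * E) (10 * 4 ^ E) ∧
      ∀ (h : History a b) (o o' : Grid a b → Bool) (φ : QVec V), ∃ c : ℂ,
        R'.branch (R.record o :: h) o' (R.branch h o
          (affineState emb Λ (fun q => listParity ((l q).map h.read)) φ)) =
        embed emb (c • fun d => phaseFactor (fun j => Λ (Y j)) θ d * φ d) := by
  classical
  have hgrid : Fintype.card (Grid a b) ≤ 2 ^ E := by simpa using hg
  have hV : Fintype.card V ≤ 2 ^ E := (Fintype.card_le_of_injective emb hemb).trans hgrid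
  have hκ : Fintype.card κ ≤ 2 ^ E := (Fintype.card_le_of_injective Y hY).trans hgrid
  have h4 : (4 : ℕ) ^ E = 2 ^ E * 2 ^ E := by rw [← mul_pow]; norm_num
  obtain ⟨w, C, out, hC, hd, hw⟩ := BoolCircuit.exists_parities (fun j => l (Y j)) E hl
  -- The second round needs each outcome itself, to reset the ancilla, and for each data qubit `v`
  -- the parity of the outcomes at ancillas whose stored parity involves `v`. Round index `0` is the
  -- measurement just made.
  let l' : Grid a b ⊕ V → List (ℕ × Grid a b) := Sum.elim (fun q => [(0, q)])
    fun v => ((ancillas emb).filter fun q => Λ q v = true).toList.map fun q => (0, q)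
  have hl' : ∀ k, (l' k).length ≤ 2 ^ E := by
    rintro (q | v)
    · simpa [l'] using Nat.one_le_two_pow
    · simp only [l', Sum.elim_inr, List.length_map, Finset.length_toList]
      exact (Finset.card_le_univ _).trans hgrid
  obtain ⟨w', C', out', hC', hd', hw'⟩ := BoolCircuit.exists_parities l' E hl'
  let R : Round a b :=
    { size := w
      classical := C
      quantum := [singleLayer Finset.univ Y hY (fun _ => pauliX) (fun j => some (out j)),
        singleLayer Finset.univ Y hY (fun j => phaseGate (θ j)) (fun _ => none),
        singleLayer (ancillas emb) id Function.injective_id (fun _ => hadamard) (fun _ => none)]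
      measured := ancillas emb }
  let R' : Round a b :=
    { size := w'
      classical := C'
      quantum := [singleLayer (ancillas emb) id Function.injective_id (fun _ => pauliX)
          (fun q => some (out' (Sum.inl q))),
        singleLayer Finset.univ emb hemb (fun _ => phaseGate Real.pi)
          (fun v => some (out' (Sum.inr v)))]
      measured := ∅ }
  -- There are at most `2 ^ E` parities in the first round and `2 * 2 ^ E` in the second, each
  -- costing at most `5 * 2 ^ E` gates.
  refine ⟨R, R', ⟨by simp [R], hd, hw.trans ?_⟩, ⟨by simp [R'], hd', hw'.trans ?_⟩, ?_⟩
  · rw [h4]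
    nlinarith
  · rw [h4, Fintype.card_sum]
    nlinarith
  intro h o o' φ
  set s : Grid a b → Bool := fun q => listParity ((l q).map h.read) with hs
  obtain ⟨s', hs', hflip⟩ := affineState_flip emb Y hY hYa Λ s φ
  have hrec : ∀ q ∈ ancillas emb, o q = R.record o q := fun q hq => by simp [Round.record, R, hq]
  have h1 : R.branch h o (affineState emb Λ s φ) = project (ancillas emb) (R.record o) fun x =>
      (phaseFactor (fun j => Λ (Y j)) θ (fun v => x (emb v)) * φ fun v => x (emb v)) *
        (((Real.sqrt 2 : ℝ) : ℂ)⁻¹ ^ (ancillas emb).card *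
        ∏ q ∈ ancillas emb, sgn (x q && xor (s' q) (par (Λ q) fun v => x (emb v)))) := by
    rw [← project_congr hrec]
    simp only [Round.branch, R, applyLayers, List.foldl_cons, List.foldl_nil, singleLayer_apply,
      Option.elim_none, Option.elim_some, if_true, hC]
    congr 1
    change localOp (ancillas emb) id (fun _ => hadamard) (localOp Finset.univ Y _
      (localOp Finset.univ Y (fun j => if s (Y j) then pauliX else 1) _)) = _
    rw [hflip, affineState_phase emb Y hYa Λ s' hs' θ φ, affineState_hadamard]
  set z : V → Bool := fun v => listParity ((l' (Sum.inr v)).map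
    (History.read (R.record o :: h))) with hz
  have hz' : ∀ v, bitZ (z v) = ∑ q ∈ ancillas emb, bitZ (R.record o q) * bitZ (Λ q v) := by
    intro v
    simp only [hz, l', Sum.elim_inr, bitZ_listParity, List.map_map]
    rw [Finset.sum_map_toList, Finset.sum_filter]
    refine Finset.sum_congr rfl fun q _ => ?_
    by_cases hq : Λ q v = true <;> simp [hq]
  refine ⟨((Real.sqrt 2 : ℝ) : ℂ)⁻¹ ^ (ancillas emb).card *
    ∏ q ∈ ancillas emb, sgn (R.record o q && s' q), ?_⟩
  have h2 := localOp_reset emb Λ s' (R.record o) z hz'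
    (((Real.sqrt 2 : ℝ) : ℂ)⁻¹ ^ (ancillas emb).card)
    (fun d => phaseFactor (fun j => Λ (Y j)) θ d * φ d)
  rw [h1]
  simp only [Round.branch, R', applyLayers, List.foldl_cons, List.foldl_nil, singleLayer_apply,
      Option.elim_some, hC', project_empty]
  have h3 : ∀ q, listParity ((l' (Sum.inl q)).map (History.read (R.record o :: h))) =
      R.record o q := fun q => by simp [l']
  simp only [h3]
  rw [h2]
  funext x
  simp only [embed, restrictTo, Pi.smul_apply]
  split_ifs <;> simp

/-! ### Solving for the chains -/

section

variable {V : Type} {N : ℕ} (e : V ≃ Fin N) (M : ℕ)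

/-- The measurement outcomes that shift the copy `j` of the data qubit of row `i`. -/
def rowList (N M i j : ℕ) : List (ℕ × Grid (2 * N + 1) (2 * M + 1)) :=
  (List.range j).map fun j' => (1, site N M (2 * i + 1) (2 * j' + 1))

/-- The measurement outcomes that shift the partial parity `i` of the column `j`. -/
def columnList (N M : ℕ) (T : ℕ → ℕ → Bool) (j : ℕ) :
    ℕ → List (ℕ × Grid (2 * N + 1) (2 * M + 1))
  | 0 => []
  | i + 1 => columnList N M T j i ++ ((if T i j then rowList N M i j else []) ++
      [(1, site N M (2 * i + 1) (2 * j + 1)), (0, site N M (2 * i + 1) (2 * j + 1))])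

/-- The measurement outcomes that shift the value of a site. -/
def shiftList {N M : ℕ} (T : ℕ → ℕ → Bool) (q : Grid (2 * N + 1) (2 * M + 1)) :
    List (ℕ × Grid (2 * N + 1) (2 * M + 1)) :=
  if (q.1 : ℕ) % 2 = 1 then
    if (q.2 : ℕ) % 2 = 1 then [(0, q)] else rowList N M (q.1 / 2) (q.2 / 2)
  else if (q.2 : ℕ) % 2 = 1 then columnList N M T (q.2 / 2) (q.1 / 2) else []

/-- The data qubits whose parity a site holds. -/
def parityOf {M : ℕ} (T : ℕ → ℕ → Bool) (q : Grid (2 * N + 1) (2 * M + 1)) (v : V) : Bool :=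
  if (q.1 : ℕ) % 2 = 1 then
    if (q.2 : ℕ) % 2 = 1 then false else decide ((e v : ℕ) = q.1 / 2)
  else if (q.2 : ℕ) % 2 = 1 then T (e v) (q.2 / 2) && decide ((e v : ℕ) < q.1 / 2) else false

lemma columnList_length (N M : ℕ) (T : ℕ → ℕ → Bool) (j i : ℕ) :
    (columnList N M T j i).length ≤ i * (j + 2) := by
  induction i with
  | zero => simp [columnList]
  | succ i ih =>
    have : (if T i j then rowList N M i j else []).length ≤ j := by
      split_ifs <;> simp [rowList]
    simp only [columnList, List.length_append, List.length_cons, List.length_nil]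
    rw [add_mul]
    omega

/-- Coordinates modulo 2 decide: odd rows alternate between chain sites and links, starting with the
data in column zero; even rows have chain sites in odd columns only. The last case consists of the
sites that always stay zero: those with both coordinates even, and the top row. -/
lemma site_cases (q : Grid (2 * N + 1) (2 * M + 1)) :
    q ∈ Set.range (dataSite e M) ∨ (∃ p, rightOf p = q) ∨ (∃ p, link p = q) ∨ (∃ p, below p = q) ∨
      ((q.1 : ℕ) % 2 = 0 ∧ ((q.2 : ℕ) % 2 = 0 ∨ (q.1 : ℕ) = 0)) := by
  have h1 := q.1.2
  have h2 := q.2.2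
  have hq := site_eta q
  rcases Nat.mod_two_eq_zero_or_one q.1 with hp | hp <;>
    rcases Nat.mod_two_eq_zero_or_one q.2 with hc | hc
  · exact .inr (.inr (.inr (.inr ⟨hp, .inl hc⟩)))
  · by_cases h0 : (q.1 : ℕ) = 0
    · exact .inr (.inr (.inr (.inr ⟨hp, .inr h0⟩)))
    · refine .inr (.inr (.inr (.inl
        ⟨(⟨q.1 / 2 - 1, by omega⟩, ⟨q.2 / 2, by omega⟩), ?_⟩)))
      refine Eq.trans ?_ hq
      rw [below]
      congr 1 <;> (try dsimp only) <;> omega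
  · by_cases h0 : (q.2 : ℕ) = 0
    · refine .inl ⟨e.symm ⟨q.1 / 2, by omega⟩, ?_⟩
      refine Eq.trans ?_ hq
      rw [dataSite, Equiv.apply_symm_apply]
      congr 1 <;> (try dsimp only) <;> omega
    · refine .inr (.inl ⟨(⟨q.1 / 2, by omega⟩, ⟨q.2 / 2 - 1, by omega⟩), ?_⟩)
      refine Eq.trans ?_ hq
      rw [rightOf]
      congr 1 <;> (try dsimp only) <;> omega
  · refine .inr (.inr (.inl ⟨(⟨q.1 / 2, by omega⟩, ⟨q.2 / 2, by omega⟩), ?_⟩))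
    refine Eq.trans ?_ hq
    rw [link]
    congr 1 <;> (try dsimp only) <;> omega

variable [Fintype V]

/-- The value of a site, as a function of the measurement outcomes and of the data. -/
def siteValue {M : ℕ} (T : ℕ → ℕ → Bool) (read : ℕ × Grid (2 * N + 1) (2 * M + 1) → Bool)
    (d : V → Bool) (q : Grid (2 * N + 1) (2 * M + 1)) : Bool :=
  xor (listParity ((shiftList T q).map read)) (par (parityOf e T q) d)

variable (T : ℕ → ℕ → Bool) (read : ℕ × Grid (2 * N + 1) (2 * M + 1) → Bool) (d : V → Bool)

lemma siteValue_row (v : V) {j : ℕ} (hj : j ≤ M) :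
    siteValue e T read d (site N M (2 * e v + 1) (2 * j)) =
      xor (listParity ((rowList N M (e v) j).map read)) (d v) := by
  classical
  have h1 : (2 * (e v : ℕ) + 1) / 2 = e v := by omega
  have h2 : parityOf e T (site N M (2 * e v + 1) (2 * j)) = fun w => decide (w = v) := by
    funext w
    simp [parityOf, site_fst (show 2 * (e v : ℕ) + 1 < 2 * N + 1 by omega),
      site_snd (show 2 * j < 2 * M + 1 by omega), h1, Fin.val_inj]
  rw [siteValue, h2, par_single]
  simp [shiftList, site_fst (show 2 * (e v : ℕ) + 1 < 2 * N + 1 by omega),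
      site_snd (show 2 * j < 2 * M + 1 by omega), h1]

lemma siteValue_data (v : V) : siteValue e T read d (dataSite e M v) = d v := by
  have := siteValue_row e M T read d v (Nat.zero_le M)
  simpa [rowList, dataSite] using this

/-- With the two lemmas that follow and `siteValue_zero`, this shows that the closed form
`siteValue` satisfies the chain relations. Index `1` addresses the outcomes of the row round, index
`0` those of the column round. -/
lemma siteValue_right (p : Fin N × Fin M) : siteValue e T read d (rightOf p) =
    xor (siteValue e T read d (leftOf p)) (read (1, link p)) := by
  have h1 := siteValue_row e M T read d (e.symm p.1) (show (p.2 : ℕ) ≤ M by omega)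
  have h2 := siteValue_row e M T read d (e.symm p.1) (show (p.2 : ℕ) + 1 ≤ M by omega)
  rw [Equiv.apply_symm_apply] at h1 h2
  rw [rightOf, leftOf, h1]
  refine (show _ = _ from h2).trans ?_
  simp only [rowList, List.range_succ, List.map_append, List.map_cons, List.map_nil,
    listParity_append, listParity_cons, listParity_nil, Bool.xor_false, link]
  generalize listParity _ = A
  generalize d _ = B
  generalize read _ = C
  cases A <;> cases B <;> cases C <;> rfl

lemma siteValue_link (p : Fin N × Fin M) : siteValue e T read d (link p) = read (0, link p) := by
  have h2 : parityOf e T (link p) = fun _ => false := by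
    funext w
    simp [parityOf, link, site_fst (show 2 * (p.1 : ℕ) + 1 < 2 * N + 1 by omega),
      site_snd (show 2 * (p.2 : ℕ) + 1 < 2 * M + 1 by omega)]
  rw [siteValue, h2, par_false]
  simp [shiftList, link, site_fst (show 2 * (p.1 : ℕ) + 1 < 2 * N + 1 by omega),
      site_snd (show 2 * (p.2 : ℕ) + 1 < 2 * M + 1 by omega)]

lemma siteValue_column {i j : ℕ} (hi : i ≤ N) (hj : j < M) :
    siteValue e T read d (site N M (2 * i) (2 * j + 1)) =
      xor (listParity ((columnList N M T j i).map read))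
        (par (fun v => T (e v) j && decide ((e v : ℕ) < i)) d) := by
  have h1 : (2 * j + 1) / 2 = j := by omega
  have h2 : parityOf e T (site N M (2 * i) (2 * j + 1)) =
      fun v => T (e v) j && decide ((e v : ℕ) < i) := by
    funext w
    simp [parityOf, site_fst (show 2 * i < 2 * N + 1 by omega),
      site_snd (show 2 * j + 1 < 2 * M + 1 by omega), h1]
  rw [siteValue, h2]
  simp [shiftList, site_fst (show 2 * i < 2 * N + 1 by omega),
      site_snd (show 2 * j + 1 < 2 * M + 1 by omega), h1]

/-- Passing row `i` adds to the column the data bit of that row, if selected. What is added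
physically is copy `j` of that bit, so the shift of this copy joins the shift of the column. -/
lemma siteValue_below (p : Fin N × Fin M) : siteValue e T read d (below p) =
    xor (xor (siteValue e T read d (above p)) (T p.1 p.2 && siteValue e T read d (leftOf p)))
      (xor (read (1, link p)) (read (0, link p))) := by
  classical
  have h1 := siteValue_row e M T read d (e.symm p.1) (show (p.2 : ℕ) ≤ M by omega)
  have h2 := siteValue_column e M T read d (show (p.1 : ℕ) ≤ N by omega) p.2.2
  have h3 := siteValue_column e M T read d (show (p.1 : ℕ) + 1 ≤ N by omega) p.2.2
  rw [Equiv.apply_symm_apply] at h1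
  have h4 : (fun v => T (e v) p.2 && decide ((e v : ℕ) < p.1 + 1)) = fun v =>
      xor (T (e v) p.2 && decide ((e v : ℕ) < p.1)) (T p.1 p.2 && decide (v = e.symm p.1)) := by
    funext v
    by_cases hv : v = e.symm p.1
    · subst hv; simp
    · have : (e v : ℕ) ≠ p.1 := fun h => hv (by rw [← Fin.ext h]; simp)
      have h5 : (e v : ℕ) < p.1 + 1 ↔ (e v : ℕ) < p.1 := by omega
      simp [hv, h5]
  rw [below, above, leftOf, h1, h2]
  refine (show _ = _ from h3).trans ?_
  rw [h4, par_xor, par_and_single]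
  simp only [columnList, List.map_append, List.map_cons, List.map_nil,
    listParity_append, listParity_cons, listParity_nil, Bool.xor_false, link]
  generalize listParity (List.map read (columnList N M T p.2 p.1)) = A
  generalize d _ = B
  generalize read _ = C
  generalize read _ = C'
  generalize par (V := V) _ _ = D
  cases T p.1 p.2
  · simp only [Bool.false_eq_true, if_false, List.map_nil, listParity_nil, Bool.false_and]
    cases A <;> cases C <;> cases C' <;> cases D <;> rfl
  · simp only [if_true, Bool.true_and]
    generalize listParity _ = F
    cases A <;> cases C <;> cases C' <;> cases D <;> cases B <;> cases F <;> rfl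

lemma siteValue_zero (q : Grid (2 * N + 1) (2 * M + 1))
    (h : (q.1 : ℕ) % 2 = 0 ∧ ((q.2 : ℕ) % 2 = 0 ∨ (q.1 : ℕ) = 0)) :
    siteValue e T read d q = false := by
  have h2 : parityOf e T q = fun _ => false := by
    funext w
    rcases h with ⟨h1, h2 | h2⟩ <;> simp [parityOf, h1, h2]
  have h3 : shiftList T q = [] := by
    rcases h with ⟨h1, h2 | h2⟩ <;> simp [shiftList, h1, h2, columnList]
  rw [siteValue, h2, h3, par_false]
  rfl

/-- The chain relations are triangular: the data determine the rows from left to right, and these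
determine the columns from top to bottom. Their only solution is therefore `siteValue`, which
exhibits the state after both chain rounds as an affine state. -/
lemma columnChain_iff (S : Finset (Fin N × Fin M))
    (hT : ∀ p : Fin N × Fin M, T p.1 p.2 = decide (p ∈ S))
    (m m' : Grid (2 * N + 1) (2 * M + 1) → Bool) (hm : ∀ p, read (1, link p) = m (link p))
    (hm' : ∀ p, read (0, link p) = m' (link p)) (x : Grid (2 * N + 1) (2 * M + 1) → Bool) :
    ColumnChain e M S m m' x ↔ ∀ q ∈ ancillas (dataSite e M),
      x q = siteValue e T read (fun v => x (dataSite e M v)) q := by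
  set d := fun v => x (dataSite e M v) with hd
  have hdata : ∀ v, x (dataSite e M v) = siteValue e T read d (dataSite e M v) := fun v => by
    rw [siteValue_data]
  constructor
  · intro h
    have hrow : ∀ j, j ≤ M → ∀ i : Fin N,
        x (site N M (2 * i + 1) (2 * j)) = siteValue e T read d (site N M (2 * i + 1) (2 * j)) := by
      intro j
      induction j with
      | zero =>
        intro _ i
        have := hdata (e.symm i)
        rwa [dataSite, Equiv.apply_symm_apply] at this
      | succ j ih =>
        intro hj i
        have h1 := siteValue_right e M T read d (i, ⟨j, hj⟩)
        have h2 := h.right_eq (i, ⟨j, hj⟩)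
        rw [leftOf, ← ih (by omega) i, hm] at h1
        rw [leftOf] at h2
        exact h2.trans h1.symm
    have hleft : ∀ p, x (leftOf p) = siteValue e T read d (leftOf p) := fun p =>
      hrow p.2 (by omega) p.1
    have hcol : ∀ i, i ≤ N → ∀ j : Fin M,
        x (site N M (2 * i) (2 * j + 1)) = siteValue e T read d (site N M (2 * i) (2 * j + 1)) := by
      intro i
      induction i with
      | zero =>
        intro _ j
        -- The columns start from the top row, whose sites lie below no link and are still zero: the
        -- empty parity with no shift.
        have hs1 : ((site N M (2 * 0) (2 * (j : ℕ) + 1)).1 : ℕ) = 0 := site_fst (by omega)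
        rw [siteValue_zero _ _ _ _ _ _ ⟨by omega, .inr hs1⟩]
        refine h.zero _ ?_ ?_ ?_ ?_
        · rintro ⟨v, hv⟩
          have := site_eq (by omega) (by omega) (by omega) (by omega) hv
          omega
        all_goals
          intro p hv
          have := site_eq (by omega) (by omega) (by omega) (by omega) hv
          omega
      | succ i ih =>
        intro hi j
        have h1 := siteValue_below e M T read d (⟨i, hi⟩, j)
        have h2 := h.below_eq (⟨i, hi⟩, j)
        rw [hT, hm, hm', ← hleft, above, ← ih (by omega) j] at h1
        rw [above] at h2
        exact h2.trans h1.symm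
    intro q hq
    rcases site_cases e M q with h1 | ⟨p, rfl⟩ | ⟨p, rfl⟩ | ⟨p, rfl⟩ | h1
    · exact absurd h1 ((mem_ancillas _ _).1 hq)
    · rw [siteValue_right, h.right_eq, hleft, hm]
    · rw [siteValue_link, h.link_eq, hm']
    · rw [siteValue_below, h.below_eq, hleft, hm, hm', hT]
      congr 2
      exact hcol _ (by omega) _
    · rw [siteValue_zero _ _ _ _ _ _ h1]
      refine h.zero q ((mem_ancillas _ _).1 hq) ?_ ?_ ?_
      · rintro p rfl
        rw [rightOf, site_fst (by omega)] at h1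
        omega
      · rintro p rfl
        rw [link, site_fst (by omega)] at h1
        omega
      · rintro p rfl
        rw [below, site_fst (by omega), site_snd (by omega)] at h1
        omega
  · intro h
    have h' : ∀ q, x q = siteValue e T read d q := by
      intro q
      by_cases hq : q ∈ ancillas (dataSite e M)
      · exact h q hq
      · rw [mem_ancillas, not_not] at hq
        obtain ⟨v, rfl⟩ := hq
        exact hdata v
    refine ⟨fun p => ?_, fun p => ?_, fun p => ?_, fun q h1 h2 h3 h4 => ?_⟩
    · rw [h', siteValue_link, hm']
    · rw [h', siteValue_right, h' (leftOf p), hm]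
    · rw [h', siteValue_below, h' (leftOf p), h' (above p), hm, hm', hT]
    · rw [h']
      rcases site_cases e M q with h5 | ⟨p, rfl⟩ | ⟨p, rfl⟩ | ⟨p, rfl⟩ | h5
      · exact absurd h5 h1
      · exact absurd rfl (h2 p)
      · exact absurd rfl (h3 p)
      · exact absurd rfl (h4 p)
      · exact siteValue_zero _ _ _ _ _ _ h5

end


/-! ### Simulation of circuits with parity-controlled phases -/

/-- The intermediate history may be left unspecified because `Simulates` quantifies over all
histories. -/
lemma mem_finalStates_append {a b : ℕ} (P P' : List (Round a b)) (h : History a b)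
    (ψ χ : QVec (Grid a b)) (hχ : χ ∈ finalStates (P ++ P') h ψ) :
    ∃ h', ∃ ψ' ∈ finalStates P h ψ, χ ∈ finalStates P' h' ψ' := by
  induction P generalizing h ψ with
  | nil => exact ⟨h, ψ, rfl, hχ⟩
  | cons R P ih =>
    simp only [List.cons_append, finalStates, Set.mem_iUnion] at hχ ⊢
    obtain ⟨o, ho⟩ := hχ
    obtain ⟨h', ψ', h1, h2⟩ := ih _ _ ho
    exact ⟨h', ψ', ⟨o, h1⟩, h2⟩

lemma embed_smul {V Q : Type} (emb : V → Q) (z : ℂ) (φ : QVec V) :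
    embed emb (z • φ) = z • embed emb φ := by
  funext x
  simp only [embed, restrictTo, Pi.smul_apply]
  split_ifs <;> simp

/-- Whatever the measurement outcomes, the rounds `P` act on the data as `A`, up to a factor. -/
def Simulates {V : Type} {a b : ℕ} (emb : V → Grid a b) (P : List (Round a b))
    (A : QVec V → QVec V) : Prop :=
  ∀ h φ, ∀ χ ∈ finalStates P h (embed emb φ), ∃ z : ℂ, χ = embed emb (z • A φ)

lemma Simulates.append {V : Type} {a b : ℕ} {emb : V → Grid a b} {P P' : List (Round a b)}
    {A A' : QVec V → QVec V} (h : Simulates emb P A) (h' : Simulates emb P' A')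
    (hA' : ∀ (z : ℂ) φ, A' (z • φ) = z • A' φ) : Simulates emb (P ++ P') fun φ => A' (A φ) := by
  intro hist φ χ hχ
  obtain ⟨hist', ψ, h1, h2⟩ := mem_finalStates_append _ _ _ _ _ hχ
  obtain ⟨z, rfl⟩ := h _ _ _ h1
  obtain ⟨z', rfl⟩ := h' _ _ _ h2
  exact ⟨z' * z, by rw [hA', smul_smul]⟩

/-! ### Local gates and parity-controlled phases on the grid -/

section

variable {V : Type} {N : ℕ} (e : V ≃ Fin N) (M : ℕ)

lemma act_smul {Q : Type} [DecidableEq Q] (q : Q) (U : Matrix.unitaryGroup Bool ℂ) (z : ℂ)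
    (ψ : QVec Q) : act q U (z • ψ) = z • act q U ψ := by
  funext x
  simp only [act, Pi.smul_apply, smul_eq_mul, Finset.mul_sum]
  exact Finset.sum_congr rfl fun s _ => by ring

lemma localOpList_smul {ι Q : Type} [DecidableEq Q] (l : List ι) (s : ι → Q)
    (U : ι → Matrix.unitaryGroup Bool ℂ) (z : ℂ) (ψ : QVec Q) :
    localOpList l s U (z • ψ) = z • localOpList l s U ψ := by
  induction l generalizing ψ with
  | nil => rfl
  | cons a l ih =>
    simp only [localOpList, List.foldl_cons] at ih ⊢
    rw [act_smul, ih]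

lemma act_embed {V Q : Type} [DecidableEq V] [DecidableEq Q] (emb : V → Q) (hemb : emb.Injective)
    (v : V) (U : Matrix.unitaryGroup Bool ℂ) (φ : QVec V) :
    act (emb v) U (embed emb φ) = embed emb (act v U φ) := by
  funext x
  have h1 : ∀ s, (∀ q, q ∉ Set.range emb → Function.update x (emb v) s q = false) ↔
      ∀ q, q ∉ Set.range emb → x q = false := by
    intro s
    refine forall₂_congr fun q hq => ?_
    rw [Function.update_of_ne (fun h => hq ⟨v, h.symm⟩)]
  have h2 : ∀ s, (fun w => Function.update x (emb v) s (emb w)) =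
      Function.update (fun w => x (emb w)) v s := fun s =>
    Function.update_comp_eq_of_injective x hemb v s
  by_cases h : ∀ q, q ∉ Set.range emb → x q = false
  · have h3 := fun s => (h1 s).2 h
    simp only [act, embed, restrictTo, if_pos h, if_pos (h3 _), h2]
  · have h3 := fun s => mt (h1 s).1 h
    simp only [act, embed, restrictTo, if_neg h, if_neg (h3 _), mul_zero, Finset.sum_const_zero]

lemma localOpList_embed {V Q : Type} [DecidableEq V] [DecidableEq Q] (emb : V → Q)
    (hemb : emb.Injective) (l : List V) (U : V → Matrix.unitaryGroup Bool ℂ) (φ : QVec V) :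
    localOpList l emb U (embed emb φ) = embed emb (localOpList l id U φ) := by
  induction l generalizing φ with
  | nil => rfl
  | cons a l ih =>
    simp only [localOpList, List.foldl_cons] at ih ⊢
    rw [act_embed emb hemb, ih]
    rfl

lemma exists_local_rounds [DecidableEq V] (A : Finset V) (U : V → Matrix.unitaryGroup Bool ℂ)
    (d s : ℕ) :
    ∃ P : List (Round (2 * N + 1) (2 * M + 1)), P.length = 1 ∧
      (∀ R ∈ P, RoundBound R 4 d s) ∧ Simulates (dataSite e M) P (localOp A id U) := by
  let R : Round (2 * N + 1) (2 * M + 1) :=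
    { size := 0
      classical := .nil
      quantum := [singleLayer A (dataSite e M) (dataSite_injective e M) U (fun _ => none)]
      measured := ∅ }
  refine ⟨[R], rfl, ?_, ?_⟩
  · intro R' hR'
    rw [List.mem_singleton] at hR'
    subst hR'
    exact ⟨by simp [R], fun i => i.elim0, Nat.zero_le _⟩
  · intro h φ χ hχ
    simp only [finalStates, Set.mem_iUnion, Set.mem_singleton_iff] at hχ
    obtain ⟨o, rfl⟩ := hχ
    refine ⟨1, ?_⟩
    simp only [Round.branch, R, applyLayers, List.foldl_cons, List.foldl_nil, singleLayer_apply,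
      Option.elim_none, if_true, project_empty, one_smul]
    exact localOpList_embed _ (dataSite_injective e M) _ _ _

/-- The grid has exactly `M` columns while a step may use fewer phases; the missing ones are padded
by a trivial entry. -/
lemma prod_getD {α : Type} (g : α → ℂ) (a : α) (ha : g a = 1) (T : List α) (hT : T.length ≤ M) :
    ∏ j : Fin M, g (T.getD j a) = (T.map g).prod := by
  rw [Fin.prod_univ_eq_prod_range (fun j => g (T.getD j a)) M]
  induction T generalizing M with
  | nil => simp [ha]
  | cons b T ih =>
    obtain ⟨M, rfl⟩ : ∃ M', M = M' + 1 := ⟨M - 1, by simp at hT; omega⟩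
    rw [Finset.prod_range_succ']
    simp only [List.getD_cons_succ, List.getD_cons_zero, List.map_cons, List.prod_cons]
    rw [ih M (by simpa using hT), mul_comm]

variable [Fintype V]

/-- One column of the grid serves each phase: row chain, column chain, read-out and correction are
the four rounds. The parity `S j` appears at the bottom of column `j` once all `N` rows have been
passed. -/
lemma exists_phase_rounds (S : Fin M → V → Bool) (θ : Fin M → ℝ) (E : ℕ)
    (hE : (2 * N + 1) * (2 * M + 1) ≤ 2 ^ E) :
    ∃ P : List (Round (2 * N + 1) (2 * M + 1)), P.length = 4 ∧
      (∀ R ∈ P, RoundBound R 4 (3 * E) (10 * 4 ^ E)) ∧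
      Simulates (dataSite e M) P fun φ d => phaseFactor S θ d * φ d := by
  classical
  let T : ℕ → ℕ → Bool := fun i j =>
    if h : i < N ∧ j < M then S ⟨j, h.2⟩ (e.symm ⟨i, h.1⟩) else false
  let sel : Finset (Fin N × Fin M) := Finset.univ.filter fun p => S p.2 (e.symm p.1) = true
  have hT : ∀ p : Fin N × Fin M, T p.1 p.2 = decide (p ∈ sel) := by
    intro p
    simp [T, sel]
  let Y : Fin M → Grid (2 * N + 1) (2 * M + 1) := fun j => site N M (2 * N) (2 * j + 1)
  have hY : Y.Injective := by
    intro j j' h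
    have := site_eq (by omega) (by omega) (by omega) (by omega) h
    exact Fin.ext (by omega)
  have hYa : ∀ j, Y j ∈ ancillas (dataSite e M) := by
    intro j
    rw [mem_ancillas]
    rintro ⟨v, hv⟩
    have := site_eq (by omega) (by omega) (by omega) (by omega) hv
    omega
  have hΛ : ∀ j, parityOf e T (Y j) = S j := by
    intro j
    funext v
    have h1 : (2 * (j : ℕ) + 1) / 2 = j := by omega
    simp [parityOf, Y, site_fst (show 2 * N < 2 * N + 1 by omega),
      site_snd (show 2 * (j : ℕ) + 1 < 2 * M + 1 by omega), h1, T]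
  have hl : ∀ j, (shiftList T (Y j)).length ≤ 2 ^ E := by
    intro j
    have h1 : (2 * (j : ℕ) + 1) / 2 = j := by omega
    have h2 : shiftList T (Y j) = columnList N M T j N := by
      simp [shiftList, Y, site_fst (show 2 * N < 2 * N + 1 by omega),
        site_snd (show 2 * (j : ℕ) + 1 < 2 * M + 1 by omega), h1]
    rw [h2]
    -- Each of the `N` rows contributes at most `j` row outcomes for the copy and two outcomes of
    -- its own link.
    refine (columnList_length N M T j N).trans (le_trans ?_ hE)
    exact Nat.mul_le_mul (by omega) (by omega)
  obtain ⟨R, R', hR, hR', hsim⟩ := exists_readout (dataSite e M) (dataSite_injective e M) Y hY hYa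
    (parityOf e T) (shiftList T) θ E hl hE
  refine ⟨[rowRound N M, columnRound N M sel, R, R'], rfl, ?_, ?_⟩
  · intro R'' hR''
    simp only [List.mem_cons, List.not_mem_nil, or_false] at hR''
    rcases hR'' with rfl | rfl | rfl | rfl
    · exact ⟨by simp [rowRound], fun i => i.elim0, Nat.zero_le _⟩
    · exact ⟨by simp [columnRound], fun i => i.elim0, Nat.zero_le _⟩
    · exact ⟨hR.1.trans (by omega), hR.2, hR.3⟩
    · exact ⟨hR'.1.trans (by omega), hR'.2, hR'.3⟩
  · intro h φ χ hχ
    simp only [finalStates, Set.mem_iUnion, Set.mem_singleton_iff] at hχ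
    obtain ⟨o₁, o₂, o₃, o₄, rfl⟩ := hχ
    obtain ⟨c₁, h1⟩ := rowRound_branch e M h o₁ φ
    obtain ⟨c₂, h2⟩ := columnRound_branch e M sel ((rowRound N M).record o₁ :: h) o₁ o₂ (c₁ • φ)
    set H := (columnRound N M sel).record o₂ :: (rowRound N M).record o₁ :: h with hH
    -- The shifts are parities of the recorded outcomes, which is the form of state that the
    -- read-out expects.
    have h3 : (restrictTo (ColumnChain e M sel o₁ o₂) fun x =>
        (c₂ • c₁ • φ) fun v => x (dataSite e M v)) =
        affineState (dataSite e M) (parityOf e T)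
          (fun q => listParity ((shiftList T q).map (History.read H))) (c₂ • c₁ • φ) := by
      refine restrictTo_congr (fun x => ?_) fun _ _ => rfl
      refine columnChain_iff e M T (History.read H) sel hT o₁ o₂ (fun p => ?_) (fun p => ?_) x
      · rw [hH, History.read_cons_succ, History.read_cons_zero]
        simp [Round.record, rowRound]
      · rw [hH, History.read_cons_zero]
        simp [Round.record, columnRound]
    obtain ⟨c₃, h4⟩ := hsim H o₃ o₄ (c₂ • c₁ • φ)
    rw [h1, h2, h3, h4]
    refine ⟨c₃ * (c₂ * c₁), ?_⟩
    congr 1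
    funext d
    simp only [hΛ, Pi.smul_apply, smul_eq_mul]
    ring

/-- One step of an idealized circuit: single-qubit gates, or a list of phases, each of them
controlled by a parity of the qubits. -/
inductive VLayer (V : Type) : Type
  | loc (A : Finset V) (U : V → Matrix.unitaryGroup Bool ℂ)
  | phase (T : List ((V → Bool) × ℝ))

/-- The action of a step of an idealized circuit. -/
noncomputable def VLayer.apply [DecidableEq V] : VLayer V → QVec V → QVec V
  | .loc A U, ψ => localOp A id U ψ
  | .phase T, ψ => fun x =>
      (T.map fun p => if par p.1 x then Complex.exp (p.2 * Complex.I) else 1).prod * ψ x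

/-- The number of parity-controlled phases in a step of an idealized circuit. -/
def VLayer.width : VLayer V → ℕ
  | .loc _ _ => 0
  | .phase T => T.length

/-- The action of an idealized circuit. -/
noncomputable def applyVLayers [DecidableEq V] (Q : List (VLayer V)) (ψ : QVec V) : QVec V :=
  Q.foldl (fun φ L => L.apply φ) ψ

lemma VLayer.apply_smul [DecidableEq V] (L : VLayer V) (z : ℂ) (ψ : QVec V) :
    L.apply (z • ψ) = z • L.apply ψ := by
  cases L with
  | loc A U => exact localOpList_smul _ _ _ _ _
  | phase T =>
    funext x
    simp only [VLayer.apply, Pi.smul_apply, smul_eq_mul]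
    ring

/-- Idealized circuits can be run on the grid. -/
theorem exists_simulation [DecidableEq V] (Q : List (VLayer V)) (hQ : ∀ L ∈ Q, L.width ≤ M) (E : ℕ)
    (hE : (2 * N + 1) * (2 * M + 1) ≤ 2 ^ E) :
    ∃ P : List (Round (2 * N + 1) (2 * M + 1)), P.length ≤ 4 * Q.length ∧
      (∀ R ∈ P, RoundBound R 4 (3 * E) (10 * 4 ^ E)) ∧
      Simulates (dataSite e M) P (applyVLayers Q) := by
  induction Q using List.reverseRecOn with
  | nil =>
    refine ⟨[], by simp, by simp, fun h φ χ hχ => ⟨1, ?_⟩⟩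
    simpa [finalStates, applyVLayers] using hχ
  | append_singleton Q L ih =>
    obtain ⟨P, h1, h2, h3⟩ := ih fun L' hL' => hQ L' (by simp [hL'])
    obtain ⟨P', h1', h2', h3'⟩ : ∃ P : List (Round (2 * N + 1) (2 * M + 1)), P.length ≤ 4 ∧
        (∀ R ∈ P, RoundBound R 4 (3 * E) (10 * 4 ^ E)) ∧
        Simulates (dataSite e M) P L.apply := by
      cases L with
      | loc A U =>
        obtain ⟨P', h1', h2', h3'⟩ := exists_local_rounds e M A U (3 * E) (10 * 4 ^ E)
        exact ⟨P', by omega, h2', h3'⟩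
      | phase T =>
        obtain ⟨P', h1', h2', h3'⟩ := exists_phase_rounds e M
          (fun j => (T.getD j (fun _ => false, 0)).1) (fun j => (T.getD j (fun _ => false, 0)).2)
          E hE
        refine ⟨P', h1'.le, h2', ?_⟩
        convert h3' using 1
        funext φ x
        simp only [VLayer.apply, phaseFactor]
        rw [prod_getD M (fun p : (V → Bool) × ℝ => if par p.1 x then
          Complex.exp (p.2 * Complex.I) else 1) _ (by simp [par_false]) T (hQ (.phase T) (by simp))]
    refine ⟨P ++ P', ?_, ?_, ?_⟩
    · simp only [List.length_append, List.length_singleton]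
      omega
    · intro R hR
      rcases List.mem_append.1 hR with hR | hR
      · exact h2 R hR
      · exact h2' R hR
    · have := h3.append h3' L.apply_smul
      convert this using 1
      funext φ
      simp [applyVLayers]

end


/-! ### Reversible classical steps -/

lemma localOpList_sum {ι Q Y : Type} [DecidableEq Q] [Fintype Y] (l : List ι) (s : ι → Q)
    (U : ι → Matrix.unitaryGroup Bool ℂ) (f : Y → QVec Q) :
    localOpList l s U (∑ y, f y) = ∑ y, localOpList l s U (f y) := by
  induction l generalizing f with
  | nil => rfl
  | cons a l ih =>
    simp only [localOpList, List.foldl_cons] at ih ⊢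
    rw [← ih]
    congr 1
    funext x
    simp only [act, Finset.sum_apply, Finset.mul_sum]
    exact Finset.sum_comm

/-- The identity `H Z^f H = X^f`, entry by entry. -/
lemma hadamard_sign_hadamard (a f c : Bool) :
    ∑ b, (hadamard : Matrix Bool Bool ℂ) a b * ((hadamard : Matrix Bool Bool ℂ) b c *
      sgn (b && f)) = if xor a f = c then 1 else 0 := by
  have h : ((Real.sqrt 2 : ℝ) : ℂ)⁻¹ * ((Real.sqrt 2 : ℝ) : ℂ)⁻¹ = 2⁻¹ := by
    rw [← mul_inv, ← Complex.ofReal_mul, Real.mul_self_sqrt (by norm_num)]; norm_num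
  simp only [hadamard_apply, Fintype.sum_bool]
  generalize ((Real.sqrt 2 : ℝ) : ℂ)⁻¹ = r at h ⊢
  cases f <;> cases a <;> cases c <;> simp <;> linear_combination 2 * h

section

variable {V : Type} [Fintype V] [DecidableEq V]

lemma applyVLayers_sum {Y : Type} [Fintype Y] (Q : List (VLayer V)) (f : Y → QVec V) :
    applyVLayers Q (∑ y, f y) = ∑ y, applyVLayers Q (f y) := by
  induction Q generalizing f with
  | nil => rfl
  | cons L Q ih =>
    simp only [applyVLayers, List.foldl_cons] at ih ⊢
    rw [← ih]
    congr 1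
    cases L with
    | loc A U => exact localOpList_sum _ _ _ _
    | phase T =>
      funext x
      simp only [VLayer.apply, Finset.sum_apply, Finset.mul_sum]

lemma applyVLayers_smul (Q : List (VLayer V)) (z : ℂ) (ψ : QVec V) :
    applyVLayers Q (z • ψ) = z • applyVLayers Q ψ := by
  induction Q generalizing ψ with
  | nil => rfl
  | cons L Q ih =>
    simp only [applyVLayers, List.foldl_cons] at ih ⊢
    rw [VLayer.apply_smul, ih]

lemma applyVLayers_append (Q Q' : List (VLayer V)) (ψ : QVec V) :
    applyVLayers (Q ++ Q') ψ = applyVLayers Q' (applyVLayers Q ψ) :=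
  List.foldl_append

/-- The parity-controlled phases whose product is the doubly controlled sign. -/
noncomputable def ccz (v a c : V) : List ((V → Bool) × ℝ) :=
  let δ : V → V → Bool := fun v w => decide (w = v)
  [(δ v, Real.pi / 4), (δ a, Real.pi / 4), (δ c, Real.pi / 4),
    (fun w => xor (δ v w) (δ a w), -(Real.pi / 4)), (fun w => xor (δ v w) (δ c w), -(Real.pi / 4)),
    (fun w => xor (δ a w) (δ c w), -(Real.pi / 4)),
    (fun w => xor (xor (δ v w) (δ a w)) (δ c w), Real.pi / 4)]

/-- For bits, `4xyz = x + y + z - (x ⊕ y) - (x ⊕ z) - (y ⊕ z) + (x ⊕ y ⊕ z)`; multiply by `π / 4`.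
The wires need not be distinct, so a pair `(a, a)` encodes a linear term. -/
lemma ccz_prod (v a c : V) (x : V → Bool) :
    ((ccz v a c).map fun p => if par p.1 x then Complex.exp (p.2 * Complex.I) else 1).prod =
      sgn (x v && (x a && x c)) := by
  set ω := Complex.exp ((Real.pi / 4 : ℝ) * Complex.I) with hω
  set ω' := Complex.exp ((-(Real.pi / 4) : ℝ) * Complex.I) with hω'
  have h1 : ω * ω' = 1 := by
    rw [hω, hω', ← Complex.exp_add, ← add_mul, ← Complex.ofReal_add, add_neg_cancel]
    simp
  have h2 : ω ^ 4 = -1 := by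
    rw [hω, ← Complex.exp_nat_mul, ← Complex.exp_pi_mul_I]
    congr 1
    push_cast
    ring
  simp only [ccz, List.map_cons, List.map_nil, List.prod_cons, List.prod_nil, par_xor, par_single,
    ← hω, ← hω']
  -- One or two ones leave equal powers of `ω` and `ω'`, which cancel; three ones leave `ω ^ 4 =
  -- -1`.
  cases x v <;> cases x a <;> cases x c <;> simp
  all_goals first
    | linear_combination h1
    | linear_combination (ω * ω' + 1) * h1
    | linear_combination h2

/-- Every bit `x v` is flipped if and only if the sum of the products `x a * x c`, for `(a, c)` in
the list `F v`, is odd. -/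
def xorMap (F : V → List (V × V)) (x : V → Bool) : V → Bool :=
  fun v => xor (x v) (listParity ((F v).map fun p => x p.1 && x p.2))

/-- The bits that may be flipped. -/
def targets (F : V → List (V × V)) : Finset V := Finset.univ.filter fun v => F v ≠ []

/-- The idealized circuit for `xorMap`. -/
noncomputable def xorLayers (F : V → List (V × V)) : List (VLayer V) :=
  [.loc (targets F) fun _ => hadamard,
    .phase ((targets F).toList.flatMap fun v => (F v).flatMap fun p => ccz v p.1 p.2),
    .loc (targets F) fun _ => hadamard]

lemma flatMap_map_prod {α β : Type} (l : List α) (f : α → List β) (g : β → ℂ) :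
    ((l.flatMap f).map g).prod = (l.map fun a => ((f a).map g).prod).prod := by
  induction l with
  | nil => rfl
  | cons a l ih => simp [ih]

lemma prod_sgn_list (b : Bool) (l : List Bool) :
    (l.map fun c => sgn (b && c)).prod = sgn (b && listParity l) := by
  induction l with
  | nil => simp
  | cons c l ih =>
    rw [List.map_cons, List.prod_cons, ih, listParity_cons, ← sgn_xor]
    congr 1
    cases b <;> rfl

lemma xorLayers_phase (F : V → List (V × V)) (x : V → Bool) :
    ((((targets F).toList.flatMap fun v => (F v).flatMap fun p => ccz v p.1 p.2)).map
      fun p => if par p.1 x then Complex.exp (p.2 * Complex.I) else 1).prod =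
      ∏ v ∈ targets F, sgn (x v && listParity ((F v).map fun p => x p.1 && x p.2)) := by
  rw [flatMap_map_prod, Finset.prod_map_toList]
  refine Finset.prod_congr rfl fun v _ => ?_
  rw [flatMap_map_prod, ← prod_sgn_list, List.map_map]
  simp only [ccz_prod]
  rfl

/-- By `hF` no control is a target, so the Hadamard gates leave the control bits alone and each
target undergoes `H Z^f H = X^f` with `f` fixed by the controls. By linearity it suffices to check
basis states, which are products over the targets. -/
theorem applyVLayers_xorLayers (F : V → List (V × V))
    (hF : ∀ v, ∀ p ∈ F v, F p.1 = [] ∧ F p.2 = []) (ψ : QVec V) :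
    applyVLayers (xorLayers F) ψ = fun x => ψ (xorMap F x) := by
  have hnt : ∀ v, F v = [] → v ∉ targets F := fun v h => by simp [targets, h]
  have hpar : ∀ i ∈ targets F, ∀ j, ∀ (x : V → Bool) b,
      listParity ((F j).map fun p => Function.update x i b p.1 && Function.update x i b p.2) =
        listParity ((F j).map fun p => x p.1 && x p.2) := by
    intro i hi j x b
    congr 1
    refine List.map_congr_left fun p hp => ?_
    rw [Function.update_of_ne (fun h => hnt _ (hF j p hp).1 (by rwa [h])),
      Function.update_of_ne (fun h => hnt _ (hF j p hp).2 (by rwa [h]))]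
  have key : ∀ y : V → Bool, applyVLayers (xorLayers F) (Pi.single y 1) =
      fun x => (Pi.single y 1 : QVec V) (xorMap F x) := by
    intro y
    -- The factor of the basis state that lives off the targets, which the Hadamard gates do not
    -- touch.
    let Ψ : QVec V := fun x => if ∀ v, v ∉ targets F → x v = y v then 1 else 0
    have hΨ : ∀ i ∈ targets F, ∀ x b, Ψ (Function.update x (id i) b) = Ψ x := by
      intro i hi x b
      refine if_congr (forall₂_congr fun v hv => ?_) rfl rfl
      rw [Function.update_of_ne]
      rintro rfl
      exact hv hi
    have e0 : ∀ x : V → Bool, (Pi.single y 1 : QVec V) x =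
        Ψ x * ∏ v ∈ targets F, if x v = y v then 1 else 0 := by
      intro x
      rw [Finset.prod_ite_zero, Pi.single_apply]
      simp only [Ψ, Finset.prod_const_one]
      by_cases h : x = y
      · subst h; simp
      · have h' : ¬ ((∀ v, v ∉ targets F → x v = y v) ∧ ∀ v ∈ targets F, x v = y v) := fun h1 =>
          h (funext fun v => by
            by_cases hv : v ∈ targets F
            · exact h1.2 v hv
            · exact h1.1 v hv)
        rw [if_neg h]
        by_cases h1 : ∀ v, v ∉ targets F → x v = y v
        · rw [if_neg fun h2 => h' ⟨h1, h2⟩, mul_zero]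
        · rw [if_neg h1, zero_mul]
    have e1 := localOp_prod (targets F) id Function.injective_id (fun _ => hadamard) Ψ
      (fun v _ b => if b = y v then 1 else 0) hΨ (fun _ _ _ _ _ _ => rfl)
    have e2 := localOp_prod (targets F) id Function.injective_id (fun _ => hadamard) Ψ
      (fun v x b => (hadamard : Matrix Bool Bool ℂ) b (y v) *
        sgn (b && listParity ((F v).map fun p => x p.1 && x p.2))) hΨ
      (fun i hi j _ x b => by
        funext c
        simp only [id, hpar i hi])
    simp only [xorLayers, applyVLayers, List.foldl_cons, List.foldl_nil, VLayer.apply,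
      xorLayers_phase]
    rw [show (Pi.single y 1 : QVec V) =
      fun x => Ψ x * ∏ v ∈ targets F, if x (id v) = y v then 1 else 0 from funext e0, e1]
    simp only [mul_ite, mul_one, mul_zero, Finset.sum_ite_eq', Finset.mem_univ, if_true]
    rw [show (fun x : V → Bool =>
        (∏ v ∈ targets F, sgn (x v && listParity ((F v).map fun p => x p.1 && x p.2))) *
        (Ψ x * ∏ i ∈ targets F, (hadamard : Matrix Bool Bool ℂ) (x (id i)) (y i))) =
        fun x => Ψ x * ∏ i ∈ targets F, ((hadamard : Matrix Bool Bool ℂ) (x (id i)) (y i) *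
          sgn (x (id i) && listParity ((F i).map fun p => x p.1 && x p.2))) by
      funext x
      rw [Finset.prod_mul_distrib]
      simp only [id]
      ring]
    rw [e2]
    funext x
    have e3 : Ψ (xorMap F x) = Ψ x := by
      refine if_congr (forall₂_congr fun v hv => ?_) rfl rfl
      have : F v = [] := by
        by_contra h
        exact hv (by simp [targets, h])
      simp [xorMap, this]
    rw [e3]
    congr 1
    refine Finset.prod_congr rfl fun v _ => ?_
    exact hadamard_sign_hadamard _ _ _
  have hψ : ψ = ∑ y, ψ y • (Pi.single y 1 : QVec V) := by
    funext x
    simp [Finset.sum_apply, Pi.single_apply]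
  conv_lhs => rw [hψ]
  rw [applyVLayers_sum]
  simp only [applyVLayers_smul, key]
  funext x
  simp [Finset.sum_apply, Pi.single_apply]

lemma xorLayers_width (F : V → List (V × V)) (K : ℕ) (hK : ∀ v, (F v).length ≤ K) :
    ∀ L ∈ xorLayers F, L.width ≤ 7 * (Fintype.card V * K) := by
  intro L hL
  simp only [xorLayers, List.mem_cons, List.not_mem_nil, or_false] at hL
  rcases hL with rfl | rfl | rfl
  · exact Nat.zero_le _
  · simp only [VLayer.width, List.length_flatMap, show ∀ v a c : V, (ccz v a c).length = 7 from fun _ _ _ => rfl, List.map_const', List.sum_replicate,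
      smul_eq_mul, Finset.sum_map_toList]
    calc ∑ v ∈ targets F, (F v).length * 7 ≤ ∑ _v ∈ targets F, K * 7 :=
          Finset.sum_le_sum fun v _ => Nat.mul_le_mul_right _ (hK v)
      _ = (targets F).card * (K * 7) := by rw [Finset.sum_const, smul_eq_mul]
      _ ≤ Fintype.card V * (K * 7) := Nat.mul_le_mul_right _ (Finset.card_le_univ _)
      _ = 7 * (Fintype.card V * K) := by ring
  · exact Nat.zero_le _

end


/-! ### Walks -/

/-- One step of a walk on the natural numbers: at time `t`, the walk at `w` goes down if the bit
`β t w` is one. -/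
def walkStep (β : ℕ → ℕ → Bool) (t w : ℕ) : ℕ := if β t w then w - 1 else w

/-- The position at time `t` of the walk that is at `w` at time `a`. -/
def walk (β : ℕ → ℕ → Bool) (a : ℕ) : ℕ → ℕ → ℕ
  | 0, w => w
  | t + 1, w => if a ≤ t then walkStep β t (walk β a t w) else w

lemma walkStep_le (β : ℕ → ℕ → Bool) (t w : ℕ) : walkStep β t w ≤ w := by
  unfold walkStep
  split_ifs <;> omega

lemma walk_le (β : ℕ → ℕ → Bool) (a t w : ℕ) : walk β a t w ≤ w := by
  induction t with
  | zero => exact le_rfl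
  | succ t ih =>
    rw [walk]
    split_ifs
    · exact (walkStep_le _ _ _).trans ih
    · exact le_rfl

lemma walk_of_le (β : ℕ → ℕ → Bool) {a t : ℕ} (h : t ≤ a) (w : ℕ) : walk β a t w = w := by
  cases t with
  | zero => rfl
  | succ t => rw [walk, if_neg (by omega)]

lemma walk_walk (β : ℕ → ℕ → Bool) {a c t : ℕ} (hac : a ≤ c) (hct : c ≤ t) (w : ℕ) :
    walk β c t (walk β a c w) = walk β a t w := by
  induction t, hct using Nat.le_induction with
  | base => exact walk_of_le β le_rfl _
  | succ t hct ih => rw [walk, walk, if_pos hct, if_pos (hac.trans hct), ih]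

/-- Only the coins at positions actually visited influence a walk. -/
lemma walk_congr {β γ : ℕ → ℕ → Bool} {a k : ℕ} (T : ℕ)
    (h : ∀ t < T, β t (walk γ a t k) = γ t (walk γ a t k)) : walk β a T k = walk γ a T k := by
  induction T with
  | zero => rfl
  | succ T ih =>
    rw [walk, walk, ih fun t ht => h t (by omega)]
    split_ifs
    · rw [walkStep, walkStep, h T (by omega)]
    · rfl

/-! ### The wires of the circuit -/

/-- The qubits of the circuit that prepares a Dicke state: the coins `b t w` of the walk, the
entries `q l t w w'` of the transition matrices from time `t - 2 ^ l` to time `t`, the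
indicators `u t w` of the positions of the walk, and the steps `x t` of the walk. -/
inductive Wire (n L : ℕ) : Type
  | b (t : Fin n) (w : Fin (n + 1))
  | q (l : Fin (L + 1)) (t w w' : Fin (n + 1))
  | u (t : Fin n) (w : Fin (n + 1))
  | x (t : Fin n)
  deriving DecidableEq

/-- The wires as a disjoint union. -/
def wireEquiv (n L : ℕ) : Wire n L ≃ (Fin n × Fin (n + 1)) ⊕
    (Fin (L + 1) × Fin (n + 1) × Fin (n + 1) × Fin (n + 1)) ⊕ (Fin n × Fin (n + 1)) ⊕ Fin n where
  toFun
    | .b t w => .inl (t, w)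
    | .q l t w w' => .inr (.inl (l, t, w, w'))
    | .u t w => .inr (.inr (.inl (t, w)))
    | .x t => .inr (.inr (.inr t))
  invFun
    | .inl (t, w) => .b t w
    | .inr (.inl (l, t, w, w')) => .q l t w w'
    | .inr (.inr (.inl (t, w))) => .u t w
    | .inr (.inr (.inr t)) => .x t
  left_inv := by rintro (_ | _ | _ | _) <;> rfl
  right_inv := by rintro (_ | _ | _ | _) <;> rfl

instance (n L : ℕ) : Fintype (Wire n L) := Fintype.ofEquiv _ (wireEquiv n L).symm

lemma card_wire (n L : ℕ) : Fintype.card (Wire n L) =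
    n * (n + 1) + ((L + 1) * ((n + 1) * ((n + 1) * (n + 1))) + (n * (n + 1) + n)) := by
  rw [Fintype.card_congr (wireEquiv n L)]
  simp

/-! ### Transition matrices of the walk by repeated doubling -/

section

variable {n L : ℕ}

/-- The coins. -/
def coins (z : Wire n L → Bool) : Fin n → Fin (n + 1) → Bool := fun t w => z (.b t w)

/-- The indicators of the positions. -/
def positions (z : Wire n L → Bool) : Fin n → Fin (n + 1) → Bool := fun t w => z (.u t w)

/-- The steps. -/
def steps (z : Wire n L → Bool) : Fin n → Bool := fun t => z (.x t)

/-- The coins as a function of natural numbers. -/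
def natCoins (β : Fin n → Fin (n + 1) → Bool) (t w : ℕ) : Bool :=
  if h : t < n ∧ w < n + 1 then β ⟨t, h.1⟩ ⟨w, h.2⟩ else false

/-- An entry of the transition matrix from time `t - 2 ^ l` to time `t`. -/
def entry (β : Fin n → Fin (n + 1) → Bool) (l : ℕ) (t w w' : Fin (n + 1)) : Bool :=
  decide (walk (natCoins β) (t - 2 ^ l) t w = w')

/-- The first `m` levels hold the transition matrices, the others their initial values. -/
def Computed (m : ℕ) (z : Wire n L → Bool) : Prop :=
  ∀ l t w w', z (.q l t w w') =
    if (l : ℕ) < m then entry (coins z) l t w w' else decide ((l : ℕ) = 0 ∧ w = w')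

/-- The step that computes the transition matrices of single time steps. -/
def stepMap : Wire n L → List (Wire n L × Wire n L)
  | .q l t w w' => if h : t = 0 then [] else
      if (l : ℕ) = 0 then
        (if w = w' then [(.b (t.pred h) w, .b (t.pred h) w)] else []) ++
        (if (w' : ℕ) = w - 1 then [(.b (t.pred h) w, .b (t.pred h) w)] else [])
      else []
  | _ => []

/-- The step that computes a level of transition matrices from the previous one. -/
def doubleMap (l : Fin L) : Wire n L → List (Wire n L × Wire n L)
  | .q l' t w w' => if l' = l.succ then
      (List.finRange (n + 1)).map fun v =>
        (.q l.castSucc ⟨t - 2 ^ (l : ℕ), (Nat.sub_le _ _).trans_lt t.2⟩ w v, .q l.castSucc t v w') else []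
  | _ => []

lemma listParity_finRange {m : ℕ} (a : Fin m) (g : Fin m → Bool) :
    listParity ((List.finRange m).map fun v => decide (a = v) && g v) = g a := by
  apply bitZ_injective
  rw [bitZ_listParity, List.map_map, ← Fin.sum_univ_def, Fintype.sum_eq_single a]
  · simp
  · intro v hv
    simp [hv.symm]

lemma coins_xorMap {F : Wire n L → List (Wire n L × Wire n L)} (hF : ∀ t w, F (.b t w) = [])
    (z : Wire n L → Bool) : coins (xorMap F z) = coins z := by
  funext t w
  simp [coins, xorMap, hF]

lemma natCoins_apply (β : Fin n → Fin (n + 1) → Bool) (t : Fin n) {w : ℕ} (hw : w < n + 1) :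
    natCoins β t w = β t ⟨w, hw⟩ := by
  simp [natCoins, hw]

lemma listParity_map_ite {α : Type} (A B : Prop) [Decidable A] [Decidable B] (a : α)
    (f : α → Bool) :
    listParity (((if A then [a] else []) ++ (if B then [a] else [])).map f) =
      (f a && xor (decide A) (decide B)) := by
  by_cases hA : A <;> by_cases hB : B <;> simp [hA, hB]

/-- Level zero starts as the identity. A coin showing one adds the diagonal entry, cancelling it,
and the entry at `w - 1`; at `w = 0` both additions hit the same entry and cancel, as the walk stays
at zero. At `t = 0` the identity is already right, because `t - 1` is truncated. The equivalence
runs from the image to `z` because circuits act by precomposition with `xorMap`. -/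
lemma computed_stepMap (z : Wire n L → Bool) :
    Computed 0 (xorMap stepMap z) ↔ Computed 1 z := by
  refine forall_congr' fun l => forall_congr' fun t => forall_congr' fun w =>
    forall_congr' fun w' => ?_
  by_cases hl : (l : ℕ) = 0
  · by_cases ht : t = 0
    · subst ht
      simp [xorMap, stepMap, hl, entry, walk, Fin.val_inj]
    · obtain ⟨t, rfl⟩ := Fin.exists_succ_eq.2 ht
      have h1 : walk (natCoins (coins z)) t (t + 1) w = if z (.b t w) then (w : ℕ) - 1 else w := by
        rw [walk, if_pos le_rfl, walk_of_le _ le_rfl, walkStep, natCoins_apply _ _ w.2]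
        rfl
      simp only [xorMap, stepMap, hl, Fin.succ_ne_zero, dite_false, Fin.pred_succ, if_true,
        Nat.lt_irrefl, Nat.lt_one_iff, entry, Fin.val_succ, pow_zero, Nat.add_sub_cancel, h1,
        if_false, true_and]
      rw [listParity_map_ite]
      have h2 : (w : ℕ) - 1 = w' ↔ (w' : ℕ) = w - 1 := eq_comm
      cases z (.b t w) <;> simp only [if_true, Bool.false_eq_true, if_false, Fin.val_inj, h2] <;>
        cases z (.q l t.succ w w') <;> cases decide (w = w') <;>
        cases decide ((w' : ℕ) = w - 1) <;> simp
  · simp [xorMap, stepMap, hl]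

/-- The walk from `t - 2 ^ (l + 1)` to `t` passes through time `t - 2 ^ l`, so its matrix is the
product of two matrices of level `l`. Each row has a single 1, so the sum over intermediate
positions has at most one nonzero term and may be taken modulo 2. Truncated subtraction makes times
before zero contribute nothing. -/
lemma computed_doubleMap (l : Fin L) (z : Wire n L → Bool) :
    Computed (l + 1) (xorMap (doubleMap l) z) ↔ Computed (l + 2) z := by
  have hc : coins (xorMap (doubleMap l) z) = coins z := coins_xorMap (fun _ _ => rfl) z
  have hne : ∀ l' t w w', l' ≠ l.succ →
      xorMap (doubleMap l) z (.q l' t w w') = z (.q l' t w w') := by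
    intro l' t w w' h
    simp [xorMap, doubleMap, h]
  have hsum : (∀ t w w', z (.q l.castSucc t w w') = entry (coins z) l t w w') → ∀ t w w',
      xorMap (doubleMap l) z (.q l.succ t w w') =
        xor (z (.q l.succ t w w')) (entry (coins z) (l + 1) t w w') := by
    intro h t w w'
    rw [xorMap]
    congr 1
    have h0 : walk (natCoins (coins z)) (t - 2 ^ (l : ℕ) - 2 ^ (l : ℕ)) (t - 2 ^ (l : ℕ)) w <
        n + 1 := (walk_le _ _ _ _).trans_lt w.2
    have h1 := listParity_finRange (⟨_, h0⟩ : Fin (n + 1)) fun v =>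
      decide (walk (natCoins (coins z)) (t - 2 ^ (l : ℕ)) t v = w')
    refine Eq.trans ?_ (h1.trans ?_)
    · rw [doubleMap, if_pos rfl, List.map_map]
      congr 1
      refine List.map_congr_left fun v _ => ?_
      simp only [Function.comp_apply, h, entry, Fin.ext_iff]
    · rw [entry, pow_succ', two_mul, ← Nat.sub_sub,
        ← walk_walk _ (Nat.sub_le ((t : ℕ) - 2 ^ (l : ℕ)) _) (Nat.sub_le _ _)]
  constructor
  · intro h
    have hl : ∀ t w w', z (.q l.castSucc t w w') = entry (coins z) l t w w' := by
      intro t w w'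
      have := h l.castSucc t w w'
      rw [hne _ _ _ _ (Fin.castSucc_lt_succ).ne, hc] at this
      simpa using this
    intro l' t w w'
    have h' := h l' t w w'
    by_cases hll : l' = l.succ
    · subst hll
      rw [hsum hl, hc] at h'
      simp only [Fin.val_succ, Nat.lt_irrefl, if_false, Nat.succ_ne_zero, false_and,
        decide_false] at h'
      rw [if_pos (by simp)]
      revert h'
      rw [Fin.val_succ]
      cases z (.q l.succ t w w') <;> simp
    · have h2 : (l' : ℕ) < l + 2 ↔ (l' : ℕ) < l + 1 := by
        have : (l' : ℕ) ≠ l + 1 := fun h => hll (Fin.ext h)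
        omega
      rw [hne _ _ _ _ hll, hc] at h'
      simp only [h2, h']
  · intro h
    have hl : ∀ t w w', z (.q l.castSucc t w w') = entry (coins z) l t w w' := by
      intro t w w'
      have := h l.castSucc t w w'
      rwa [if_pos (by simp)] at this
    intro l' t w w'
    have h' := h l' t w w'
    by_cases hll : l' = l.succ
    · subst hll
      rw [hsum hl, hc]
      rw [if_pos (by simp)] at h'
      rw [h', Fin.val_succ]
      simp
    · have h2 : (l' : ℕ) < l + 2 ↔ (l' : ℕ) < l + 1 := by
        have : (l' : ℕ) ≠ l + 1 := fun h => hll (Fin.ext h)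
        omega
      rw [hne _ _ _ _ hll, hc]
      simp only [← h2, h']

/-- The controls are not flipped, so the same flips are added twice. Hence uncomputing is running
the same steps in reverse order. -/
lemma xorMap_xorMap {V : Type} {F : V → List (V × V)}
    (hF : ∀ v, ∀ p ∈ F v, F p.1 = [] ∧ F p.2 = []) (z : V → Bool) :
    xorMap F (xorMap F z) = z := by
  have h : ∀ v, F v = [] → xorMap F z v = z v := fun v hv => by simp [xorMap, hv]
  funext v
  have h1 : ((F v).map fun p => xorMap F z p.1 && xorMap F z p.2) =
      (F v).map fun p => z p.1 && z p.2 :=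
    List.map_congr_left fun p hp => by rw [h _ (hF v p hp).1, h _ (hF v p hp).2]
  rw [xorMap, h1, xorMap]
  simp

lemma stepMap_isolated (v : Wire n L) :
    ∀ p ∈ stepMap v, stepMap p.1 = [] ∧ stepMap p.2 = [] := by
  intro p hp
  have : ∃ t w, p = (Wire.b t w, Wire.b t w) := by
    cases v <;> simp only [stepMap, List.not_mem_nil] at hp
    split_ifs at hp <;> simp at hp <;> exact ⟨_, _, hp⟩
  obtain ⟨t, w, rfl⟩ := this
  exact ⟨rfl, rfl⟩

lemma doubleMap_isolated (l : Fin L) (v : Wire n L) :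
    ∀ p ∈ doubleMap l v, doubleMap l p.1 = [] ∧ doubleMap l p.2 = [] := by
  intro p hp
  have hl : l.castSucc ≠ l.succ := Fin.castSucc_lt_succ.ne
  cases v <;> simp only [doubleMap, List.not_mem_nil] at hp
  split_ifs at hp
  · obtain ⟨v, -, rfl⟩ := List.mem_map.1 hp
    simp [doubleMap, hl]
  · simp at hp

/-! ### States of the circuit -/

/-- A function of the coins, the positions, and the steps. -/
abbrev Amplitude (n : ℕ) : Type :=
  (Fin n → Fin (n + 1) → Bool) → (Fin n → Fin (n + 1) → Bool) → (Fin n → Bool) → ℂ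

/-- The state with the given amplitudes, in which `m` levels of transition matrices have been
computed. -/
noncomputable def walkState (L m : ℕ) (g : Amplitude n) : QVec (Wire n L) :=
  restrictTo (Computed m) fun z => g (coins z) (positions z) (steps z)

lemma walkState_stepMap (g : Amplitude n) :
    (fun z => walkState L 0 g (xorMap stepMap z)) = walkState L 1 g := by
  funext z
  have h1 : coins (xorMap stepMap z) = coins z := coins_xorMap (fun _ _ => rfl) z
  have h2 : positions (xorMap stepMap z) = positions z := by
    funext t w; simp [positions, xorMap, stepMap]
  have h3 : steps (xorMap stepMap z) = steps z := by
    funext t; simp [steps, xorMap, stepMap]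
  simp only [walkState, restrictTo, h1, h2, h3]
  split_ifs with h4 h5 h5
  · rfl
  · exact absurd ((computed_stepMap z).1 h4) h5
  · exact absurd ((computed_stepMap z).2 h5) h4
  · rfl

lemma walkState_doubleMap (l : Fin L) (g : Amplitude n) :
    (fun z => walkState L (l + 1) g (xorMap (doubleMap l) z)) = walkState L (l + 2) g := by
  funext z
  have h1 : coins (xorMap (doubleMap l) z) = coins z := coins_xorMap (fun _ _ => rfl) z
  have h2 : positions (xorMap (doubleMap l) z) = positions z := by
    funext t w; simp [positions, xorMap, doubleMap]
  have h3 : steps (xorMap (doubleMap l) z) = steps z := by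
    funext t; simp [steps, xorMap, doubleMap]
  simp only [walkState, restrictTo, h1, h2, h3]
  split_ifs with h4 h5 h5
  · rfl
  · exact absurd ((computed_doubleMap l z).1 h4) h5
  · exact absurd ((computed_doubleMap l z).2 h5) h4
  · rfl

/-- The circuit that computes the levels `0, …, j` of transition matrices. -/
noncomputable def computeLayers (n L : ℕ) : ℕ → List (VLayer (Wire n L))
  | 0 => xorLayers stepMap
  | j + 1 => computeLayers n L j ++ if h : j < L then xorLayers (doubleMap ⟨j, h⟩) else []

/-- The inverse of `computeLayers`. -/
noncomputable def uncomputeLayers (n L : ℕ) : ℕ → List (VLayer (Wire n L))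
  | 0 => xorLayers stepMap
  | j + 1 => (if h : j < L then xorLayers (doubleMap ⟨j, h⟩) else []) ++ uncomputeLayers n L j

lemma applyVLayers_computeLayers (g : Amplitude n) {j : ℕ} (hj : j ≤ L) :
    applyVLayers (computeLayers n L j) (walkState L 0 g) = walkState L (j + 1) g := by
  induction j with
  | zero => rw [computeLayers, applyVLayers_xorLayers _ stepMap_isolated, walkState_stepMap]
  | succ j ih =>
    rw [computeLayers, dif_pos (by omega), applyVLayers_append, ih (by omega),
      applyVLayers_xorLayers _ (doubleMap_isolated _)]
    exact walkState_doubleMap ⟨j, by omega⟩ g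

lemma applyVLayers_uncomputeLayers (g : Amplitude n) {j : ℕ} (hj : j ≤ L) :
    applyVLayers (uncomputeLayers n L j) (walkState L (j + 1) g) = walkState L 0 g := by
  induction j with
  | zero =>
    rw [uncomputeLayers, applyVLayers_xorLayers _ stepMap_isolated, ← walkState_stepMap]
    simp only [xorMap_xorMap stepMap_isolated]
  | succ j ih =>
    rw [uncomputeLayers, dif_pos (by omega), applyVLayers_append,
      applyVLayers_xorLayers _ (doubleMap_isolated _)]
    have h := walkState_doubleMap (⟨j, by omega⟩ : Fin L) g
    simp only at h
    rw [← h]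
    simp only [xorMap_xorMap (doubleMap_isolated _)]
    exact ih (by omega)

end


section

variable {n L : ℕ}

/-! ### The steps of the circuit -/

/-- The step that adds the positions of the walk from `k` to the qubits `u`. -/
def readMap (k : Fin (n + 1)) : Wire n L → List (Wire n L × Wire n L)
  | .u t w => [(.q (Fin.last L) t.castSucc k w, .q (Fin.last L) t.castSucc k w)]
  | _ => []

/-- The step that adds the coins at the positions of the walk to the qubits `x`. -/
def stepsMap : Wire n L → List (Wire n L × Wire n L)
  | .x t => (List.finRange (n + 1)).map fun w => (.u t w, .b t w)
  | _ => []

/-- The step that adds the steps of the walk to the coins at its positions. -/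
def eraseMap : Wire n L → List (Wire n L × Wire n L)
  | .b t w => [(.u t w, .x t)]
  | _ => []

/-- The step that adds the positions of the walk to the coins. -/
def controlMap : Wire n L → List (Wire n L × Wire n L)
  | .b t w => [(.u t w, .u t w)]
  | _ => []

/-- The step that adds the steps of the walk to all coins. -/
def copyMap : Wire n L → List (Wire n L × Wire n L)
  | .b t _ => [(.x t, .x t)]
  | _ => []

/-- The indicators of the positions of the walk from `k` with the given coins. -/
def trajectory (k : ℕ) (β : Fin n → Fin (n + 1) → Bool) (t : Fin n) (w : Fin (n + 1)) : Bool :=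
  decide (walk (natCoins β) 0 t k = w)

lemma computed_zero_xorMap {F : Wire n L → List (Wire n L × Wire n L)}
    (hF : ∀ l t w w', F (.q l t w w') = []) (z : Wire n L → Bool) :
    Computed 0 (xorMap F z) ↔ Computed 0 z := by
  simp [Computed, xorMap, hF]

lemma computed_xorMap {F : Wire n L → List (Wire n L × Wire n L)} (m : ℕ)
    (hF : ∀ l t w w', F (.q l t w w') = []) (hF' : ∀ t w, F (.b t w) = []) (z : Wire n L → Bool) :
    Computed m (xorMap F z) ↔ Computed m z := by
  rw [Computed, coins_xorMap hF']
  simp [Computed, xorMap, hF]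

lemma applyVLayers_walkState (F : Wire n L → List (Wire n L × Wire n L))
    (hF : ∀ v, ∀ p ∈ F v, F p.1 = [] ∧ F p.2 = []) (m : ℕ) (g g' : Amplitude n)
    (hm : ∀ z, Computed m (xorMap F z) ↔ Computed m z)
    (hg : ∀ z : Wire n L → Bool, Computed m z →
      g (coins (xorMap F z)) (positions (xorMap F z)) (steps (xorMap F z)) =
        g' (coins z) (positions z) (steps z)) :
    applyVLayers (xorLayers F) (walkState L m g) = walkState L m g' := by
  rw [applyVLayers_xorLayers F hF]
  funext z
  simp only [walkState, restrictTo]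
  split_ifs with h1 h2 h2
  · exact hg z h2
  · exact absurd ((hm z).1 h1) h2
  · exact absurd ((hm z).2 h2) h1
  · rfl

lemma applyVLayers_readMap (k : Fin (n + 1)) (hL : n ≤ 2 ^ L) (g : Amplitude n) :
    applyVLayers (xorLayers (readMap k)) (walkState L (L + 1) g) =
      walkState L (L + 1) fun b u x => g b (fun t w => xor (u t w) (trajectory k b t w)) x := by
  refine applyVLayers_walkState _ (fun v p hp => ?_) _ _ _
    (computed_xorMap _ (fun _ _ _ _ => rfl) fun _ _ => rfl) fun z hz => ?_
  · cases v <;> simp [readMap] at hp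
    subst hp
    exact ⟨rfl, rfl⟩
  · rw [coins_xorMap fun _ _ => rfl]
    congr 1
    · funext t w
      have h := hz (Fin.last L) t.castSucc k w
      -- Since `t < n ≤ 2 ^ L`, the matrices of the last level reach back to time zero.
      have h1 : (t : ℕ) - 2 ^ L = 0 := by omega
      simp only [Fin.val_last, Nat.lt_succ_self, if_true, entry, Fin.val_castSucc, h1] at h
      simp [positions, xorMap, readMap, h, trajectory]
    · funext t
      simp [steps, xorMap, readMap]

lemma applyVLayers_stepsMap (g : Amplitude n) :
    applyVLayers (xorLayers stepsMap) (walkState L 0 g) = walkState L 0 fun b u x =>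
      g b u fun t => xor (x t) (listParity ((List.finRange (n + 1)).map fun w =>
        u t w && b t w)) := by
  refine applyVLayers_walkState _ (fun v p hp => ?_) _ _ _
    (computed_zero_xorMap fun _ _ _ _ => rfl) fun z _ => ?_
  · cases v <;> simp [stepsMap] at hp
    obtain ⟨_, rfl⟩ := hp
    exact ⟨rfl, rfl⟩
  · rw [coins_xorMap fun _ _ => rfl]
    congr 1
    · funext t w
      simp [positions, xorMap, stepsMap]
    · funext t
      simp only [steps, xorMap, stepsMap, List.map_map]
      rfl

lemma applyVLayers_coinMap (F : Wire n L → List (Wire n L × Wire n L))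
    (f : (Fin n → Fin (n + 1) → Bool) → (Fin n → Bool) → Fin n → Fin (n + 1) → Bool)
    (hF : ∀ v, ∀ p ∈ F v, F p.1 = [] ∧ F p.2 = []) (hq : ∀ l t w w', F (.q l t w w') = [])
    (hu : ∀ t w, F (.u t w) = []) (hx : ∀ t, F (.x t) = [])
    (hb : ∀ z t w, listParity ((F (.b t w)).map fun p => z p.1 && z p.2) =
      f (positions z) (steps z) t w) (g : Amplitude n) :
    applyVLayers (xorLayers F) (walkState L 0 g) =
      walkState L 0 fun b u x => g (fun t w => xor (b t w) (f u x t w)) u x := by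
  refine applyVLayers_walkState _ hF _ _ _ (computed_zero_xorMap hq) fun z _ => ?_
  congr 1
  · funext t w
    simp only [coins, xorMap, hb]
  · funext t w
    simp [positions, xorMap, hu]
  · funext t
    simp [steps, xorMap, hx]

lemma applyVLayers_eraseMap (g : Amplitude n) :
    applyVLayers (xorLayers eraseMap) (walkState L 0 g) =
      walkState L 0 fun b u x => g (fun t w => xor (b t w) (u t w && x t)) u x := by
  refine applyVLayers_coinMap eraseMap (fun u x t w => u t w && x t) (fun v p hp => ?_)
    (fun _ _ _ _ => rfl) (fun _ _ => rfl) (fun _ => rfl) (fun z t w => ?_) g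
  · cases v <;> simp [eraseMap] at hp
    subst hp
    exact ⟨rfl, rfl⟩
  · simp [eraseMap, positions, steps]

lemma applyVLayers_controlMap (g : Amplitude n) :
    applyVLayers (xorLayers controlMap) (walkState L 0 g) =
      walkState L 0 fun b u x => g (fun t w => xor (b t w) (u t w)) u x := by
  refine applyVLayers_coinMap controlMap (fun u x t w => u t w) (fun v p hp => ?_)
    (fun _ _ _ _ => rfl) (fun _ _ => rfl) (fun _ => rfl) (fun z t w => ?_) g
  · cases v <;> simp [controlMap] at hp
    subst hp
    exact ⟨rfl, rfl⟩
  · simp [controlMap, positions]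

lemma applyVLayers_copyMap (g : Amplitude n) :
    applyVLayers (xorLayers copyMap) (walkState L 0 g) =
      walkState L 0 fun b u x => g (fun t w => xor (b t w) (x t)) u x := by
  refine applyVLayers_coinMap copyMap (fun u x t w => x t) (fun v p hp => ?_)
    (fun _ _ _ _ => rfl) (fun _ _ => rfl) (fun _ => rfl) (fun z t w => ?_) g
  · cases v <;> simp [copyMap] at hp
    subst hp
    exact ⟨rfl, rfl⟩
  · simp [copyMap, steps]

/-- The circuit that adds the positions of the walk to the qubits `u`. -/
noncomputable def walkLayers (L : ℕ) (k : Fin (n + 1)) : List (VLayer (Wire n L)) :=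
  computeLayers n L L ++ xorLayers (readMap k) ++ uncomputeLayers n L L

/-- Compute, copy, uncompute: the matrices return to their initial values, so the circuit can be
used a second time to clear the positions. -/
lemma applyVLayers_walkLayers (k : Fin (n + 1)) (hL : n ≤ 2 ^ L) (g : Amplitude n) :
    applyVLayers (walkLayers L k) (walkState L 0 g) =
      walkState L 0 fun b u x => g b (fun t w => xor (u t w) (trajectory k b t w)) x := by
  rw [walkLayers, applyVLayers_append, applyVLayers_append, applyVLayers_computeLayers _ le_rfl,
    applyVLayers_readMap k hL, applyVLayers_uncomputeLayers _ le_rfl]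

/-! ### Rotations of the coins -/

/-- The wires of the coins. -/
def coinWire (n L : ℕ) : Fin n × Fin (n + 1) ↪ Wire n L :=
  ⟨fun p => .b p.1 p.2, fun p p' h => by
    have := Wire.b.inj h
    exact Prod.ext this.1 this.2⟩

/-- The gates that rotate the coins. -/
noncomputable def coinGate (φ : Fin n × Fin (n + 1) → ℝ) :
    Wire n L → Matrix.unitaryGroup Bool ℂ
  | .b t w => rotation (φ (t, w))
  | _ => 1

/-- The step that rotates the coins. -/
noncomputable def coinLayer (L : ℕ) (φ : Fin n × Fin (n + 1) → ℝ) : VLayer (Wire n L) :=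
  .loc (Finset.univ.map (coinWire n L)) (coinGate φ)

/-- The coins form a product state conditionally on positions and steps, so the factors `v` may
depend on `u` and `x`. -/
lemma coinLayer_apply (φ : Fin n × Fin (n + 1) → ℝ)
    (G : (Fin n → Fin (n + 1) → Bool) → (Fin n → Bool) → ℂ)
    (v : Fin n × Fin (n + 1) → (Fin n → Fin (n + 1) → Bool) → (Fin n → Bool) → Bool → ℂ) :
    (coinLayer L φ).apply (walkState L 0 fun b u x => G u x * ∏ p, v p u x (b p.1 p.2)) =
      walkState L 0 fun b u x => G u x * ∏ p, ∑ s,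
        (rotation (φ p) : Matrix Bool Bool ℂ) (b p.1 p.2) s * v p u x s := by
  have hpos : ∀ (p : Fin n × Fin (n + 1)) (z : Wire n L → Bool) s,
      positions (Function.update z (coinWire n L p) s) = positions z := by
    intro p z s
    funext t w
    exact Function.update_of_ne (by simp [coinWire]) _ _
  have hst : ∀ (p : Fin n × Fin (n + 1)) (z : Wire n L → Bool) s,
      steps (Function.update z (coinWire n L p) s) = steps z := by
    intro p z s
    funext t
    exact Function.update_of_ne (by simp [coinWire]) _ _
  have hcomp : ∀ (p : Fin n × Fin (n + 1)) (z : Wire n L → Bool) s,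
      Computed 0 (Function.update z (coinWire n L p) s) ↔ Computed 0 z := by
    intro p z s
    simp [Computed, coinWire]
  let v' : Wire n L → (Wire n L → Bool) → Bool → ℂ := fun i z s =>
    match i with
    | .b t w => v (t, w) (positions z) (steps z) s
    | _ => 1
  let Ψ : QVec (Wire n L) := restrictTo (Computed 0) fun z => G (positions z) (steps z)
  have h := localOp_prod (Finset.univ.map (coinWire n L)) id Function.injective_id
    (coinGate φ) Ψ v' (fun i hi z s => by
      obtain ⟨p, -, rfl⟩ := Finset.mem_map.1 hi
      simp only [Ψ, restrictTo, id, hpos, hst]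
      split_ifs with h1 h2 h2
      · rfl
      · exact absurd ((hcomp p z s).1 h1) h2
      · exact absurd ((hcomp p z s).2 h2) h1
      · rfl) (fun i hi j hj z s => by
      obtain ⟨p, -, rfl⟩ := Finset.mem_map.1 hi
      obtain ⟨p', -, rfl⟩ := Finset.mem_map.1 hj
      funext s'
      simp only [v', id, hpos, hst])
  simp only [Finset.prod_map] at h
  have e1 : ∀ z : Wire n L → Bool, (walkState L 0 fun b u x => G u x * ∏ p, v p u x (b p.1 p.2)) z =
      Ψ z * ∏ p, v' (coinWire n L p) z (z (id (coinWire n L p))) := by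
    intro z
    simp only [walkState, Ψ, restrictTo]
    split_ifs
    · rfl
    · rw [zero_mul]
  rw [coinLayer, VLayer.apply, show (walkState L 0 fun b u x => G u x * ∏ p, v p u x (b p.1 p.2)) =
    _ from funext e1, h]
  funext z
  simp only [walkState, Ψ, restrictTo]
  split_ifs
  · rfl
  · rw [zero_mul]

/-! ### The initial values of the transition matrices -/

/-- The wires that hold the diagonals of the transition matrices of level zero. -/
def onDiagonal : Wire n L → Bool
  | .q l _ w w' => decide ((l : ℕ) = 0 ∧ w = w')
  | _ => false

/-- The step that flips the diagonals of the transition matrices of level zero. -/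
noncomputable def diagonalLayer (n L : ℕ) : VLayer (Wire n L) :=
  .loc (Finset.univ.filter fun v => onDiagonal v = true) fun _ => pauliX

lemma diagonalLayer_apply (ψ : QVec (Wire n L)) :
    (diagonalLayer n L).apply ψ = fun z => ψ fun v => xor (z v) (onDiagonal v) := by
  obtain ⟨π, h1, h2, h3⟩ := exists_localOp_flip
    (Finset.univ.filter fun v : Wire n L => onDiagonal v = true) id Function.injective_id
    fun _ => true
  simp only [if_true] at h1
  rw [diagonalLayer, VLayer.apply, h1]
  funext z
  congr 1
  funext v
  by_cases hv : onDiagonal v = true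
  · rw [hv]
    exact h2 z v (by simp [hv])
  · rw [h3 z v fun i hi h => hv (by simp at hi; rwa [← h])]
    simp [hv]

lemma computed_zero_flip (z : Wire n L → Bool) :
    Computed 0 (fun v => xor (z v) (onDiagonal v)) ↔ ∀ l t w w', z (.q l t w w') = false := by
  refine forall_congr' fun l => forall_congr' fun t => forall_congr' fun w =>
    forall_congr' fun w' => ?_
  simp only [onDiagonal, Nat.not_lt_zero, if_false]
  cases z (.q l t w w') <;> cases decide ((l : ℕ) = 0 ∧ w = w') <;> simp

lemma diagonalLayer_walkState (g : Amplitude n) :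
    (diagonalLayer n L).apply (walkState L 0 g) =
      restrictTo (fun z => ∀ l t w w', z (.q l t w w') = false)
        fun z => g (coins z) (positions z) (steps z) := by
  rw [diagonalLayer_apply]
  funext z
  have h1 : coins (fun v => xor (z v) (onDiagonal v)) = coins z := by
    funext t w; simp [coins, onDiagonal]
  have h2 : positions (fun v => xor (z v) (onDiagonal v)) = positions z := by
    funext t w; simp [positions, onDiagonal]
  have h3 : steps (fun v => xor (z v) (onDiagonal v)) = steps z := by
    funext t; simp [steps, onDiagonal]
  simp only [walkState, restrictTo, h1, h2, h3]
  split_ifs with h4 h5 h5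
  · rfl
  · exact absurd ((computed_zero_flip z).1 h4) h5
  · exact absurd ((computed_zero_flip z).2 h5) h4
  · rfl

lemma diagonalLayer_zeroState :
    (diagonalLayer n L).apply (zeroState (Wire n L)) =
      walkState L 0 fun b u x => (if (∀ t w, u t w = false) ∧ ∀ t, x t = false then 1 else 0) *
        ∏ p : Fin n × Fin (n + 1), if b p.1 p.2 = false then 1 else 0 := by
  have h0 : zeroState (Wire n L) = restrictTo (fun z => ∀ l t w w', z (.q l t w w') = false)
      fun z => (if (∀ t w, positions z t w = false) ∧ ∀ t, steps z t = false then 1 else 0) *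
        ∏ p : Fin n × Fin (n + 1), if coins z p.1 p.2 = false then 1 else 0 := by
    funext z
    simp only [zeroState, restrictTo, Finset.prod_ite_zero, Finset.prod_const_one, ite_mul, one_mul, zero_mul]
    by_cases h : ∀ q, z q = false
    · rw [if_pos h, if_pos fun _ _ _ _ => h _, if_pos ⟨fun _ _ => h _, fun _ => h _⟩]
      exact (if_pos fun _ _ => h _).symm
    · rw [if_neg h]
      split_ifs with h1 h2 h3
      · refine absurd (fun q => ?_) h
        cases q with
        | b t w => exact h3 (t, w) (Finset.mem_univ _)
        | q l t w w' => exact h1 l t w w'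
        | u t w => exact h2.1 t w
        | x t => exact h2.2 t
      all_goals rfl
  have h1 := diagonalLayer_walkState (L := L) fun b u x =>
    (if (∀ t w, u t w = false) ∧ ∀ t, x t = false then 1 else 0) *
      ∏ p : Fin n × Fin (n + 1), if b p.1 p.2 = false then (1 : ℂ) else 0
  rw [h0]
  -- The diagonal flips are an involution, so the statement follows from their action on the
  -- right-hand side.
  refine (congrArg _ h1.symm).trans ?_
  rw [diagonalLayer_apply, diagonalLayer_apply]
  simp

end


/-! ### Amplitudes of the walk -/

/-- Half of the rotation angle of a coin. -/
noncomputable def halfAngle (n t w : ℕ) : ℝ := Real.arcsin (Real.sqrt (w / ((n : ℝ) - t))) / 2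

/-- The amplitudes of a coin, which shows one with probability `w / (n - t)`. -/
noncomputable def coinAmplitude (n t w : ℕ) (s : Bool) : ℂ :=
  (rotation (2 * halfAngle n t w) : Matrix Bool Bool ℂ) s false

/-- The bound `w ≤ m` keeps the argument of `arcsin` at most one. Coins with more ones due than
steps left have a clamped angle, which is harmless: `half_rotations` resets coins of any angle. -/
lemma coinAmplitude_true {n t m w : ℕ} (h : t + m = n) (hw : w ≤ m) :
    coinAmplitude n t w true = (Real.sqrt (w / m) : ℝ) := by
  have h1 : (n : ℝ) - t = m := by rw [← h]; push_cast; ring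
  have h2 : (w : ℝ) / m ≤ 1 := div_le_one_of_le₀ (by exact_mod_cast hw) (Nat.cast_nonneg _)
  rw [coinAmplitude, rotation_apply, halfAngle, h1, mul_div_cancel₀ _ (by norm_num)]
  simp only [Bool.true_eq_false, if_false, if_true]
  rw [Real.sin_arcsin (by linarith [Real.sqrt_nonneg ((w : ℝ) / m)]) (Real.sqrt_le_one.2 h2)]

lemma coinAmplitude_false {n t m w : ℕ} (h : t + m = n) (hm : 0 < m) (hw : w ≤ m) :
    coinAmplitude n t w false = (Real.sqrt ((m - w : ℕ) / m) : ℝ) := by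
  have h1 : (n : ℝ) - t = m := by rw [← h]; push_cast; ring
  have h3 : (m : ℝ) ≠ 0 := by positivity
  rw [coinAmplitude, rotation_apply, halfAngle, h1, mul_div_cancel₀ _ (by norm_num)]
  simp only [if_true]
  rw [Real.cos_arcsin, Real.sq_sqrt (by positivity), Nat.cast_sub hw]
  congr 3
  field_simp

lemma sqrt_mul_inv_sqrt {x y z : ℝ} (hx : 0 ≤ x) (hy : 0 < y) (h : x * z = y) :
    ((Real.sqrt x : ℝ) : ℂ) * ((Real.sqrt y : ℝ) : ℂ)⁻¹ = ((Real.sqrt z : ℝ) : ℂ)⁻¹ := by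
  have hx' : x ≠ 0 := by rintro rfl; simp at h; exact hy.ne h
  have h1 : Real.sqrt x ≠ 0 := Real.sqrt_ne_zero'.2 (lt_of_le_of_ne hx hx'.symm)
  rw [← h, Real.sqrt_mul hx, Complex.ofReal_mul, mul_inv, ← mul_assoc,
    mul_inv_cancel₀ (by exact_mod_cast h1), one_mul]

/-- The amplitude of a sequence of steps of the walk. -/
lemma prod_coinAmplitude {n : ℕ} (ξ : ℕ → Bool) (β : ℕ → ℕ → Bool)
    (hβ : ∀ t < n, ∀ w ≤ n, β t w = ξ t) (m : ℕ) : ∀ t w, t + m = n → w ≤ m →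
    ∏ s ∈ Finset.Ico t n, coinAmplitude n s (walk β t s w) (ξ s) =
      if ∑ s ∈ Finset.Ico t n, (ξ s).toNat = w
        then ((Real.sqrt (m.choose w) : ℝ) : ℂ)⁻¹ else 0 := by
  induction m with
  | zero =>
    intro t w h hw
    obtain rfl : t = n := by omega
    obtain rfl : w = 0 := by omega
    simp
  | succ m ih =>
    intro t w h hw
    have ht : t < n := by omega
    have hw' : ∀ s ∈ Finset.Ico (t + 1) n,
        walk β t s w = walk β (t + 1) s (walkStep β t w) := by
      intro s hs
      rw [← walk_walk β (Nat.le_succ t) (Finset.mem_Ico.1 hs).1, walk, if_pos le_rfl,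
        walk_of_le _ le_rfl]
    rw [Finset.prod_eq_prod_Ico_succ_bot ht, Finset.sum_eq_sum_Ico_succ_bot ht,
      Finset.prod_congr rfl fun s hs => by rw [hw' s hs], walk_of_le _ le_rfl]
    have hstep : walkStep β t w = if ξ t then w - 1 else w := by
      rw [walkStep, hβ t ht w (by omega)]
    cases hξ : ξ t with
    | true =>
      rw [coinAmplitude_true h hw, hstep, hξ, if_pos rfl]
      -- At `w = 0` a one has amplitude zero, and the number of ones then exceeds `w`.
      rcases w with _ | w
      · simp
      · rw [Nat.add_sub_cancel, ih (t + 1) w (by omega) (by omega), Bool.toNat_true]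
        have h1 : (1 + ∑ s ∈ Finset.Ico (t + 1) n, (ξ s).toNat = w + 1) ↔
            ∑ s ∈ Finset.Ico (t + 1) n, (ξ s).toNat = w := by omega
        simp only [h1]
        split_ifs
        · refine sqrt_mul_inv_sqrt (by positivity)
            (by exact_mod_cast Nat.choose_pos (by omega)) ?_
          -- The probabilities telescope: `(w + 1) / (m + 1)` times `(m + 1).choose (w + 1)` is
          -- `m.choose w`.
          have h2 : ((m + 1 : ℕ) : ℝ) * (m.choose w : ℕ) =
              ((m + 1).choose (w + 1) : ℕ) * ((w + 1 : ℕ) : ℝ) := by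
            exact_mod_cast Nat.add_one_mul_choose_eq m w
          have h3 : ((m + 1 : ℕ) : ℝ) ≠ 0 := by positivity
          rw [div_mul_eq_mul_div, div_eq_iff h3]
          linarith
        · simp
    | false =>
      rw [coinAmplitude_false h (by omega) hw, hstep, hξ, if_neg (by simp), Bool.toNat_false,
        zero_add]
      rcases Nat.lt_or_ge m w with hmw | hmw
      · obtain rfl : w = m + 1 := by omega
        have h1 : ∑ s ∈ Finset.Ico (t + 1) n, (ξ s).toNat ≤ m := by
          refine (Finset.sum_le_card_nsmul _ _ 1 fun s _ => Bool.toNat_le (ξ s)).trans ?_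
          simp
          omega
        rw [if_neg (by omega)]
        simp
      · rw [ih (t + 1) w (by omega) hmw]
        split_ifs
        · refine sqrt_mul_inv_sqrt (by positivity)
            (by exact_mod_cast Nat.choose_pos hmw) ?_
          have h2 : ((m.choose w : ℕ) : ℝ) * ((m + 1 : ℕ) : ℝ) =
              ((m + 1).choose w : ℕ) * ((m + 1 - w : ℕ) : ℝ) := by
            exact_mod_cast Nat.choose_mul_succ_eq m w
          have h3 : ((m + 1 : ℕ) : ℝ) ≠ 0 := by positivity
          rw [div_mul_eq_mul_div, div_eq_iff h3]
          linarith
        · simp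

/-! ### From walk amplitudes to the Dicke state; erasing the coins -/

section

variable {n L : ℕ}

/-- The amplitude of the walk from `k` with steps `x`. -/
noncomputable def walkAmplitude (k : ℕ) (x : Fin n → Bool) : ℂ :=
  ∏ t : Fin n, coinAmplitude n t (walk (natCoins fun t _ => x t) 0 t k) (x t)

lemma walkAmplitude_eq_dicke {k : ℕ} (hk : k ≤ n) (x : Fin n → Bool) :
    walkAmplitude k x = dicke n k x := by
  let ξ : ℕ → Bool := fun t => if h : t < n then x ⟨t, h⟩ else false
  have hξ : ∀ t : Fin n, ξ t = x t := fun t => by simp [ξ]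
  have h := prod_coinAmplitude (n := n) ξ (natCoins fun t _ => x t) (fun t ht w hw => by
    simp [natCoins, ξ, ht, Nat.lt_succ_of_le hw]) n 0 k (by omega) hk
  have hc : (Finset.univ.filter fun i => x i = true).card = ∑ i, (x i).toNat := by
    rw [Finset.card_filter]
    exact Finset.sum_congr rfl fun i _ => by cases x i <;> rfl
  rw [← Finset.range_eq_Ico, ← Fin.prod_univ_eq_prod_range
    (fun s => coinAmplitude n s (walk (natCoins fun t _ => x t) 0 s k) (ξ s)),
    ← Fin.sum_univ_eq_sum_range (fun s => (ξ s).toNat)] at h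
  simp only [hξ] at h
  rw [walkAmplitude, h, dicke, hc]

/-- Erasing the coins that were used by the walk. -/
lemma erase_amplitude (k : Fin (n + 1)) (b u : Fin n → Fin (n + 1) → Bool) (x : Fin n → Bool) :
    (if (∀ t w, xor (u t w) (trajectory k (fun t w => xor (b t w) (u t w && x t)) t w) = false) ∧
        (∀ t, xor (x t) (listParity ((List.finRange (n + 1)).map fun w =>
          u t w && xor (b t w) (u t w && x t))) = false) then (1 : ℂ) else 0) *
        ∏ p : Fin n × Fin (n + 1), coinAmplitude n p.1 p.2 (xor (b p.1 p.2) (u p.1 p.2 && x p.1)) =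
      (walkAmplitude k x * if ∀ t w, u t w = trajectory k (fun t _ => x t) t w then 1 else 0) *
        ∏ p : Fin n × Fin (n + 1), if u p.1 p.2 then (if b p.1 p.2 = false then 1 else 0)
          else coinAmplitude n p.1 p.2 (b p.1 p.2) := by
  set β : Fin n → Fin (n + 1) → Bool := fun t w => xor (b t w) (u t w && x t) with hβ
  set γ : Fin n → Fin (n + 1) → Bool := fun t _ => x t with hγ
  have hle : ∀ (δ : Fin n → Fin (n + 1) → Bool) (t : ℕ), walk (natCoins δ) 0 t k < n + 1 :=
    fun δ t => (walk_le _ _ _ _).trans_lt k.2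
  have hpar : (∀ t w, u t w = trajectory k β t w) → ∀ t,
      listParity ((List.finRange (n + 1)).map fun w => u t w && β t w) =
        β t ⟨walk (natCoins β) 0 t k, hle β t⟩ := by
    intro hu t
    rw [← listParity_finRange _ (β t)]
    congr 1
    refine List.map_congr_left fun w _ => ?_
    rw [hu, trajectory]
    simp only [Fin.ext_iff]
  have hxor : ∀ a c : Bool, xor a c = false ↔ a = c := by decide
  simp only [hxor]
  -- Here `β` are the coins before erasing and `γ` copies the steps into all coins. If `x` records
  -- the coins `β` along the walk of `β`, the two agree at all visited positions, so the walks
  -- coincide.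
  have hsame : (∀ t w, u t w = trajectory k β t w) → (∀ t, x t =
      listParity ((List.finRange (n + 1)).map fun w => u t w && β t w)) →
      ∀ t ≤ n, walk (natCoins γ) 0 t k = walk (natCoins β) 0 t k := by
    intro h1 h2 T hT
    refine walk_congr T fun t ht => ?_
    have ht' : t < n := by omega
    have h3 := h2 ⟨t, ht'⟩
    rw [hpar h1] at h3
    rw [natCoins_apply γ ⟨t, ht'⟩ (hle β t), natCoins_apply β ⟨t, ht'⟩ (hle β t)]
    exact h3
  by_cases hu : ∀ t w, u t w = trajectory k γ t w
  · rw [if_pos hu, mul_one]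
    let P : Fin n → Fin (n + 1) := fun t => ⟨walk (natCoins γ) 0 t k, hle γ t⟩
    have huP : ∀ t w, u t w = decide (P t = w) := by
      intro t w
      rw [hu, trajectory]
      simp only [P, Fin.ext_iff]
    -- At visited positions the erasing step adds `x t`; so the old coins agree with the steps
    -- exactly if the erased coins `b` vanish there.
    have hβP : ∀ t, β t (P t) = xor (b t (P t)) (x t) := fun t => by simp [hβ, huP]
    by_cases hb : ∀ t, b t (P t) = false
    · have hsame' : ∀ t ≤ n, walk (natCoins β) 0 t k = walk (natCoins γ) 0 t k := by
        intro T hT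
        refine walk_congr T fun t ht => ?_
        have ht' : t < n := by omega
        rw [natCoins_apply γ ⟨t, ht'⟩ (hle γ t), natCoins_apply β ⟨t, ht'⟩ (hle γ t)]
        have := hβP ⟨t, ht'⟩
        rw [hb, Bool.false_xor] at this
        exact this
      have h1 : ∀ t w, u t w = trajectory k β t w := by
        intro t w
        rw [hu, trajectory, trajectory, hsame' t t.2.le]
      have h2 : ∀ t, x t = listParity ((List.finRange (n + 1)).map fun w => u t w && β t w) := by
        intro t
        rw [hpar h1]
        have h3 : (⟨walk (natCoins β) 0 t k, hle β t⟩ : Fin (n + 1)) = P t :=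
          Fin.ext (hsame' t t.2.le)
        rw [h3, hβP, hb, Bool.false_xor]
      rw [if_pos ⟨h1, h2⟩, one_mul, Fintype.prod_prod_type, Fintype.prod_prod_type, walkAmplitude,
        ← Finset.prod_mul_distrib]
      refine Finset.prod_congr rfl fun t _ => ?_
      -- At each time the factor of the visited coin moves into the walk amplitude; the other coins
      -- keep their own amplitudes.
      rw [← Finset.mul_prod_erase _ _ (Finset.mem_univ (P t)),
        ← Finset.mul_prod_erase _ (fun w => if u t w = true then _ else _)
          (Finset.mem_univ (P t))]
      have h3 : u t (P t) = true := by simp [huP]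
      simp only [h3, if_true, hb, Bool.true_and, Bool.false_xor, one_mul]
      congr 1
      refine Finset.prod_congr rfl fun w hw => ?_
      have h4 : u t w = false := by
        rw [huP]
        exact decide_eq_false (Finset.ne_of_mem_erase hw).symm
      simp [h4]
    · rw [if_neg, zero_mul]
      · obtain ⟨t, ht⟩ := not_forall.1 hb
        rw [Finset.prod_eq_zero (Finset.mem_univ (t, P t)), mul_zero]
        have h3 : u t (P t) = true := by simp [huP]
        simp [h3, ht]
      · rintro ⟨h1, h2⟩
        refine hb fun t => ?_
        have h3 := h2 t
        rw [hpar h1] at h3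
        have h4 : (⟨walk (natCoins β) 0 t k, hle β t⟩ : Fin (n + 1)) = P t :=
          Fin.ext (hsame h1 h2 t t.2.le).symm
        rw [h4, hβP] at h3
        revert h3
        cases b t (P t) <;> simp
  · rw [if_neg hu, mul_zero, zero_mul, if_neg, zero_mul]
    rintro ⟨h1, h2⟩
    refine hu fun t w => ?_
    rw [h1, trajectory, trajectory, hsame h1 h2 t t.2.le]

/-- Two half rotations, each of them followed by a controlled flip, undo a rotation exactly if
the control bit is zero. -/
lemma half_rotations (φ : ℝ) (u s : Bool) :
    ∑ r, (rotation (-φ) : Matrix Bool Bool ℂ) (xor s u) r *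
      ∑ r', (rotation (-φ) : Matrix Bool Bool ℂ) (xor r u) r' *
        (if u then (if r' = false then 1 else 0)
          else (rotation (2 * φ) : Matrix Bool Bool ℂ) r' false) =
      if s = false then 1 else 0 := by
  have h : (Real.cos φ : ℂ) ^ 2 + (Real.sin φ : ℂ) ^ 2 = 1 := by
    rw [← Complex.ofReal_pow, ← Complex.ofReal_pow, ← Complex.ofReal_add,
      Real.cos_sq_add_sin_sq, Complex.ofReal_one]
  have h2 : (Real.cos (2 * φ) : ℂ) = (Real.cos φ : ℂ) ^ 2 - (Real.sin φ : ℂ) ^ 2 := by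
    rw [Real.cos_two_mul']; push_cast; rfl
  have h3 : (Real.sin (2 * φ) : ℂ) = 2 * (Real.sin φ : ℂ) * (Real.cos φ : ℂ) := by
    rw [Real.sin_two_mul]; push_cast; rfl
  -- The operator is `X^u R(-φ) X^u R(-φ)`, and `X R(-φ) X = R(φ)`. For `u = 0` the half rotations
  -- add up to `R(-2φ)`; for `u = 1` they cancel, and the coin was already zero.
  simp only [Fintype.sum_bool, rotation_apply, Real.cos_neg, Real.sin_neg]
  cases u <;> cases s <;>
    simp [h2, h3, -Complex.ofReal_cos, -Complex.ofReal_sin]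
  · linear_combination ((Real.cos φ : ℂ) ^ 2 + (Real.sin φ : ℂ) ^ 2 + 1) * h
  · ring
  · linear_combination h
  · ring

end


section

variable {n L : ℕ}

/-! ### The circuit -/

/-- The circuit that prepares the steps of the walk and erases the coins that it used. -/
noncomputable def stepLayers (L : ℕ) (k : Fin (n + 1)) : List (VLayer (Wire n L)) :=
  diagonalLayer n L :: coinLayer L (fun p => 2 * halfAngle n p.1 p.2) ::
    (walkLayers L k ++ (xorLayers stepsMap ++ xorLayers eraseMap))

/-- The circuit that resets the coins, except those at the positions of the walk. -/
noncomputable def resetLayers (n L : ℕ) : List (VLayer (Wire n L)) :=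
  coinLayer L (fun p => -halfAngle n p.1 p.2) :: (xorLayers controlMap ++
    coinLayer L (fun p => -halfAngle n p.1 p.2) :: xorLayers controlMap)

/-- The circuit that resets the positions. -/
noncomputable def positionLayers (L : ℕ) (k : Fin (n + 1)) : List (VLayer (Wire n L)) :=
  xorLayers copyMap ++ (walkLayers L k ++ (xorLayers copyMap ++ [diagonalLayer n L]))

/-- The circuit that prepares a Dicke state. -/
noncomputable def dickeLayers (L : ℕ) (k : Fin (n + 1)) : List (VLayer (Wire n L)) :=
  stepLayers L k ++ (resetLayers n L ++ positionLayers L k)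

/-- The amplitudes of the steps together with the positions. -/
noncomputable def pathAmplitude (k : ℕ) (u : Fin n → Fin (n + 1) → Bool) (x : Fin n → Bool) : ℂ :=
  walkAmplitude k x * if ∀ t w, u t w = trajectory k (fun t _ => x t) t w then 1 else 0

lemma applyVLayers_cons {V : Type} [Fintype V] [DecidableEq V] (T : VLayer V)
    (Q : List (VLayer V)) (ψ : QVec V) :
    applyVLayers (T :: Q) ψ = applyVLayers Q (T.apply ψ) := rfl

lemma applyVLayers_stepLayers (k : Fin (n + 1)) (hL : n ≤ 2 ^ L) :
    applyVLayers (stepLayers L k) (zeroState (Wire n L)) =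
      walkState L 0 fun b u x => pathAmplitude k u x *
        ∏ p : Fin n × Fin (n + 1), if u p.1 p.2 then (if b p.1 p.2 = false then 1 else 0)
          else coinAmplitude n p.1 p.2 (b p.1 p.2) := by
  have h := coinLayer_apply (L := L) (fun p : Fin n × Fin (n + 1) => 2 * halfAngle n p.1 p.2)
    (fun u x => if (∀ t w, u t w = false) ∧ ∀ t, x t = false then 1 else 0)
    (fun _ _ _ s => if s = false then 1 else 0)
  rw [stepLayers, applyVLayers_cons, applyVLayers_cons, diagonalLayer_zeroState, h,
    applyVLayers_append, applyVLayers_append, applyVLayers_walkLayers k hL,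
    applyVLayers_stepsMap, applyVLayers_eraseMap]
  congr 1
  funext b u x
  refine Eq.trans ?_ (erase_amplitude k b u x)
  simp [coinAmplitude]

lemma applyVLayers_resetLayers (G : (Fin n → Fin (n + 1) → Bool) → (Fin n → Bool) → ℂ) :
    applyVLayers (resetLayers n L) (walkState L 0 fun b u x => G u x *
        ∏ p : Fin n × Fin (n + 1), if u p.1 p.2 then (if b p.1 p.2 = false then 1 else 0)
          else coinAmplitude n p.1 p.2 (b p.1 p.2)) =
      walkState L 0 fun b u x => G u x *
        ∏ p : Fin n × Fin (n + 1), if b p.1 p.2 = false then 1 else 0 := by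
  have h1 := coinLayer_apply (L := L) (fun p : Fin n × Fin (n + 1) => -halfAngle n p.1 p.2) G
    (fun p u _ s => if u p.1 p.2 then (if s = false then 1 else 0)
      else coinAmplitude n p.1 p.2 s)
  have h2 := coinLayer_apply (L := L) (fun p : Fin n × Fin (n + 1) => -halfAngle n p.1 p.2) G
    (fun p u _ r => ∑ r', (rotation (-halfAngle n p.1 p.2) : Matrix Bool Bool ℂ)
      (xor r (u p.1 p.2)) r' * if u p.1 p.2 then (if r' = false then 1 else 0)
      else coinAmplitude n p.1 p.2 r')
  rw [resetLayers, applyVLayers_cons, h1, applyVLayers_append, applyVLayers_controlMap,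
    applyVLayers_cons, h2, applyVLayers_controlMap]
  simp only [coinAmplitude, half_rotations]

/-- With all coins zero, copying `x t` into every coin of time `t` makes the walk of the coins that
of the steps. The walk circuit then adds to `u` the trajectory it already holds, a second copy
clears the coins, and the diagonal flips clear the matrices. -/
lemma applyVLayers_positionLayers (k : Fin (n + 1)) (hL : n ≤ 2 ^ L) :
    applyVLayers (positionLayers L k) (walkState L 0 fun b u x => pathAmplitude k u x *
        ∏ p : Fin n × Fin (n + 1), if b p.1 p.2 = false then 1 else 0) =
      restrictTo (fun z => ∀ l t w w', z (.q l t w w') = false) fun z =>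
        (walkAmplitude k (steps z) * if ∀ t w, positions z t w = false then 1 else 0) *
          ∏ p : Fin n × Fin (n + 1), if coins z p.1 p.2 = false then 1 else 0 := by
  rw [positionLayers, applyVLayers_append, applyVLayers_copyMap, applyVLayers_append,
    applyVLayers_walkLayers k hL, applyVLayers_append, applyVLayers_copyMap, applyVLayers_cons,
    diagonalLayer_walkState]
  refine congrArg (restrictTo fun z : Wire n L → Bool => ∀ l t w w', z (.q l t w w') = false)
    (funext fun z => ?_)
  simp only [Bool.xor_assoc, Bool.xor_self, Bool.xor_false]
  by_cases h : ∀ p ∈ (Finset.univ : Finset (Fin n × Fin (n + 1))), coins z p.1 p.2 = false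
  · have hb : (fun t w => xor (coins z t w) (steps z t)) = fun t _ => steps z t := by
      funext t w
      rw [h (t, w) (Finset.mem_univ _), Bool.false_xor]
    rw [hb, pathAmplitude]
    have hu : (∀ t w, xor (positions z t w) (trajectory k (fun t _ => steps z t) t w) =
        trajectory k (fun t _ => steps z t) t w) ↔ ∀ t w, positions z t w = false :=
      forall_congr' fun t => forall_congr' fun w => by cases positions z t w <;> simp
    simp only [hu]
  · simp only [Finset.prod_ite_zero, if_neg h, mul_zero]

lemma applyVLayers_dickeLayers (k : Fin (n + 1)) (hL : n ≤ 2 ^ L) :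
    applyVLayers (dickeLayers L k) (zeroState (Wire n L)) =
      restrictTo (fun z => ∀ v, (∀ t, v ≠ .x t) → z v = false) fun z => dicke n k (steps z) := by
  rw [dickeLayers, applyVLayers_append, applyVLayers_append, applyVLayers_stepLayers k hL,
    applyVLayers_resetLayers, applyVLayers_positionLayers k hL]
  funext z
  simp only [restrictTo, Finset.prod_ite_zero, Finset.prod_const_one, mul_ite, mul_one, mul_zero,
    walkAmplitude_eq_dicke (Nat.lt_succ_iff.1 k.2)]
  by_cases h : ∀ v : Wire n L, (∀ t, v ≠ .x t) → z v = false
  · have h1 : ∀ t w, coins z t w = false := fun t w => h (.b t w) (by simp)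
    have h2 : ∀ t w, positions z t w = false := fun t w => h (.u t w) (by simp)
    have h3 : ∀ l t w w', z (.q l t w w') = false := fun l t w w' => h _ (by simp)
    rw [if_pos h]
    simp [h1, h2, h3]
  · rw [if_neg h]
    split_ifs with h1 h2 h3
    · refine absurd (fun v hv => ?_) h
      cases v with
      | b t w => exact h2 (t, w) (Finset.mem_univ _)
      | q l t w w' => exact h1 l t w w'
      | u t w => exact h3 t w
      | x t => exact absurd rfl (hv t)
    all_goals rfl

/-! ### Resources -/

lemma length_xorLayers {V : Type} [Fintype V] [DecidableEq V] (F : V → List (V × V)) :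
    (xorLayers F).length = 3 := rfl

lemma length_computeLayers (j : ℕ) : (computeLayers n L j).length ≤ 3 * (j + 1) := by
  induction j with
  | zero => exact le_rfl
  | succ j ih =>
    rw [computeLayers, List.length_append]
    split_ifs
    · rw [length_xorLayers]; omega
    · rw [List.length_nil]; omega

lemma length_uncomputeLayers (j : ℕ) : (uncomputeLayers n L j).length ≤ 3 * (j + 1) := by
  induction j with
  | zero => exact le_rfl
  | succ j ih =>
    rw [uncomputeLayers, List.length_append]
    split_ifs
    · rw [length_xorLayers]; omega
    · rw [List.length_nil]; omega

lemma length_dickeLayers (k : Fin (n + 1)) : (dickeLayers L k).length ≤ 12 * L + 50 := by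
  have h1 := length_computeLayers (n := n) (L := L) L
  have h2 := length_uncomputeLayers (n := n) (L := L) L
  simp only [dickeLayers, stepLayers, resetLayers, positionLayers, walkLayers, List.length_append,
    List.length_cons, length_xorLayers, List.length_nil]
  omega

/-- A bound on the widths of the layers of the circuit. -/
def layerWidth (n L : ℕ) : ℕ := 7 * (Fintype.card (Wire n L) * (n + 2))

/-- A matrix product has `n + 1` summands and `stepMap` lists at most two pairs; `n + 2` covers both
for every `n`. -/
lemma width_xorLayers (F : Wire n L → List (Wire n L × Wire n L))
    (hF : ∀ v, (F v).length ≤ n + 2) : ∀ T ∈ xorLayers F, T.width ≤ layerWidth n L :=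
  xorLayers_width F (n + 2) hF

lemma width_stepMap : ∀ T ∈ xorLayers (stepMap (n := n) (L := L)), T.width ≤ layerWidth n L := by
  refine width_xorLayers _ fun v => ?_
  cases v <;> simp only [stepMap, List.length_nil, Nat.zero_le]
  split_ifs <;> simp

lemma width_doubleMap (l : Fin L) :
    ∀ T ∈ xorLayers (doubleMap (n := n) l), T.width ≤ layerWidth n L := by
  refine width_xorLayers _ fun v => ?_
  cases v <;> simp only [doubleMap, List.length_nil, Nat.zero_le]
  split_ifs <;> simp

lemma width_walkLayers (k : Fin (n + 1)) : ∀ T ∈ walkLayers L k, T.width ≤ layerWidth n L := by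
  have h1 : ∀ j, ∀ T ∈ computeLayers n L j, T.width ≤ layerWidth n L := by
    intro j
    induction j with
    | zero => exact width_stepMap
    | succ j ih =>
      intro T hT
      rw [computeLayers, List.mem_append] at hT
      split_ifs at hT
      · exact hT.elim (ih T) (width_doubleMap _ T)
      · exact hT.elim (ih T) fun h => absurd h List.not_mem_nil
  have h2 : ∀ j, ∀ T ∈ uncomputeLayers n L j, T.width ≤ layerWidth n L := by
    intro j
    induction j with
    | zero => exact width_stepMap
    | succ j ih =>
      intro T hT
      rw [uncomputeLayers, List.mem_append] at hT
      split_ifs at hT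
      · exact hT.elim (width_doubleMap _ T) (ih T)
      · exact hT.elim (fun h => absurd h List.not_mem_nil) (ih T)
  have h3 : ∀ T ∈ xorLayers (readMap (L := L) k), T.width ≤ layerWidth n L := by
    refine width_xorLayers _ fun v => ?_
    cases v <;> simp [readMap]
  intro T hT
  rw [walkLayers, List.mem_append, List.mem_append] at hT
  exact hT.elim (fun h => h.elim (h1 L T) (h3 T)) (h2 L T)

lemma width_dickeLayers (k : Fin (n + 1)) : ∀ T ∈ dickeLayers L k, T.width ≤ layerWidth n L := by
  have h1 : ∀ T ∈ xorLayers (stepsMap (n := n) (L := L)), T.width ≤ layerWidth n L := by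
    refine width_xorLayers _ fun v => ?_
    cases v <;> simp [stepsMap]
  have h2 : ∀ T ∈ xorLayers (eraseMap (n := n) (L := L)), T.width ≤ layerWidth n L := by
    refine width_xorLayers _ fun v => ?_
    cases v <;> simp [eraseMap]
  have h3 : ∀ T ∈ xorLayers (controlMap (n := n) (L := L)), T.width ≤ layerWidth n L := by
    refine width_xorLayers _ fun v => ?_
    cases v <;> simp [controlMap]
  have h4 : ∀ T ∈ xorLayers (copyMap (n := n) (L := L)), T.width ≤ layerWidth n L := by
    refine width_xorLayers _ fun v => ?_
    cases v <;> simp [copyMap]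
  have h5 : (diagonalLayer n L).width ≤ layerWidth n L := Nat.zero_le _
  have h6 : ∀ φ : Fin n × Fin (n + 1) → ℝ, (coinLayer L φ).width ≤ layerWidth n L :=
    fun _ => Nat.zero_le _
  have h7 := width_walkLayers (L := L) k
  intro T hT
  simp only [dickeLayers, stepLayers, resetLayers, positionLayers, List.mem_append,
    List.mem_cons, List.not_mem_nil, or_false] at hT
  rcases hT with (rfl | rfl | h | h | h) | (rfl | h | rfl | h) | h | h | h | rfl
  exacts [h5, h6 _, h7 T h, h1 T h, h2 T h, h6 _, h3 T h, h6 _, h3 T h, h4 T h, h7 T h, h4 T h, h5]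

end

/-! ### The states of the qubits of the grid -/

lemma embed_zeroState {V : Type} [Fintype V] {a b : ℕ} (emb : V → Grid a b) :
    embed emb (zeroState V) = zeroState (Grid a b) := by
  funext x
  simp only [embed, restrictTo, zeroState]
  by_cases h : ∀ q, x q = false
  · rw [if_pos h, if_pos fun q _ => h q, if_pos fun v => h _]
  · rw [if_neg h]
    split_ifs with h1 h2
    · refine absurd (fun q => ?_) h
      by_cases hq : q ∈ Set.range emb
      · obtain ⟨v, rfl⟩ := hq
        exact h2 v
      · exact h1 q hq
    all_goals rfl

lemma embed_restrictTo {V : Type} {n a b : ℕ} {emb : V → Grid a b}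
    (hemb : Function.Injective emb) (ι : Fin n → V) (sys : Fin n ↪ Grid a b)
    (hsys : ∀ i, sys i = emb (ι i)) (φ : QVec (Fin n)) :
    embed emb (restrictTo (fun z => ∀ v, (∀ i, v ≠ ι i) → z v = false) fun z => φ fun i => z (ι i)) =
      withAncillas sys φ := by
  funext x
  simp only [embed, restrictTo, withAncillas, hsys]
  by_cases h : ∀ q, q ∉ Set.range sys → x q = false
  · rw [if_pos h, if_pos fun q hq => h q ?_, if_pos fun v hv => h _ ?_]
    · rintro ⟨i, hi⟩
      exact hv i (hemb (by rw [← hi, hsys]))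
    · rintro ⟨i, rfl⟩
      exact hq ⟨ι i, (hsys i).symm⟩
  · rw [if_neg h]
    split_ifs with h1 h2
    · refine absurd (fun q hq => ?_) h
      by_cases hq' : q ∈ Set.range emb
      · obtain ⟨v, rfl⟩ := hq'
        exact h2 v fun i hv => hq ⟨i, by rw [hsys, hv]⟩
      · exact h1 q hq'
    all_goals rfl


/-! ### Polynomial bounds -/

lemma add_two_le_two_pow_log (n : ℕ) : n + 2 ≤ 2 ^ (Nat.log 2 n + 2) := by
  have h := Nat.lt_pow_succ_log_self (b := 2) (by norm_num) n
  have h1 : 1 ≤ 2 ^ Nat.log 2 n := Nat.one_le_two_pow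
  rw [Nat.succ_eq_add_one, pow_succ] at h
  rw [pow_add]
  omega

lemma card_wire_le (n : ℕ) : Fintype.card (Wire n (Nat.log 2 n + 1)) ≤ (n + 2) ^ 6 := by
  have h1 : Nat.log 2 n + 1 + 1 ≤ n + 2 := by
    have := Nat.log_le_self 2 n
    omega
  rw [card_wire]
  calc _ ≤ n * (n + 1) + ((n + 2) * ((n + 1) * ((n + 1) * (n + 1))) + (n * (n + 1) + n)) := by
        gcongr
    _ ≤ (n + 2) ^ 4 * 2 ^ 2 := by ring_nf; omega
    _ ≤ (n + 2) ^ 4 * (n + 2) ^ 2 := by gcongr; omega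
    _ = (n + 2) ^ 6 := by ring

lemma grid_card_le (n : ℕ) :
    (2 * Fintype.card (Wire n (Nat.log 2 n + 1)) + 1) *
      (2 * layerWidth n (Nat.log 2 n + 1) + 1) ≤ 2 ^ (20 * (Nat.log 2 n + 2)) := by
  have h1 := card_wire_le n
  have h2 : layerWidth n (Nat.log 2 n + 1) ≤ 7 * (n + 2) ^ 7 := by
    rw [pow_succ, layerWidth]
    gcongr
  have h3 : ∀ j, 1 ≤ (n + 2) ^ j := fun j => Nat.one_le_pow _ _ (by omega)
  have h4 : ∀ j, 2 ^ j ≤ (n + 2) ^ j := fun j => Nat.pow_le_pow_left (by omega) j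
  -- The constants are absorbed by `2 ≤ n + 2`: the exponents `6 + 2 + 7 + 4` sum to `19`, rounded
  -- up to `20`.
  calc _ ≤ ((n + 2) ^ 6 * 2 ^ 2) * ((n + 2) ^ 7 * 2 ^ 4) := by
        refine Nat.mul_le_mul ?_ ?_
        · have := h3 6
          omega
        · have := h3 7
          omega
    _ ≤ ((n + 2) ^ 6 * (n + 2) ^ 2) * ((n + 2) ^ 7 * (n + 2) ^ 4) := by
        gcongr <;> omega
    _ = (n + 2) ^ 19 := by ring
    _ ≤ (n + 2) ^ 20 := Nat.pow_le_pow_right (by omega) (by omega)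
    _ ≤ (2 ^ (Nat.log 2 n + 2)) ^ 20 := by
        gcongr
        exact add_two_le_two_pow_log n
    _ = 2 ^ (20 * (Nat.log 2 n + 2)) := by rw [← pow_mul, mul_comm]

/-- A power whose exponent is linear in the logarithm is polynomial, since `2 ^ Nat.log 2 n ≤ max n
1`; the additive constant takes care of `n = 0`. -/
lemma four_pow_le (n m : ℕ) :
    4 ^ (m * (Nat.log 2 n + 2)) ≤ 4 ^ (2 * m) * n ^ (2 * m) + 4 ^ (2 * m) := by
  have h : 2 ^ Nat.log 2 n ≤ max n 1 := by
    rcases Nat.eq_zero_or_pos n with rfl | hn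
    · simp
    · exact (Nat.pow_log_le_self 2 hn.ne').trans (le_max_left _ _)
  calc 4 ^ (m * (Nat.log 2 n + 2)) = 4 ^ (2 * m) * (2 ^ Nat.log 2 n) ^ (2 * m) := by
        rw [show 4 = 2 ^ 2 from rfl, ← pow_mul, ← pow_mul, ← pow_mul, ← pow_add]
        congr 1
        ring
    _ ≤ 4 ^ (2 * m) * (max n 1) ^ (2 * m) := by gcongr
    _ ≤ 4 ^ (2 * m) * (n ^ (2 * m) + 1) := by
        gcongr
        rcases le_total n 1 with hn | hn
        · rw [max_eq_right hn, one_pow]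
          omega
        · rw [max_eq_left hn]
          omega
    _ = 4 ^ (2 * m) * n ^ (2 * m) + 4 ^ (2 * m) := by ring

lemma mul_pow_add_le {a c m n C : ℕ} (hm : m ≠ 0) (hmC : m ≤ C) (hC : c * a ≤ C) :
    c * (a * n ^ m + a) ≤ C * n ^ C + C := by
  have h : n ^ m ≤ n ^ C := by
    rcases Nat.eq_zero_or_pos n with rfl | hn
    · simp [hm]
    · exact Nat.pow_le_pow_right hn hmC
  calc c * (a * n ^ m + a) = c * a * n ^ m + c * a := by ring
    _ ≤ C * n ^ C + C := by gcongr

/-- The preparation of Dicke states, with explicit bounds. -/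
theorem exists_dicke_circuit {n k : ℕ} (hk : k ≤ n) :
    ∃ (a b : ℕ) (sys : Fin n ↪ Grid a b) (P : List (Round a b)),
      a * b ≤ 2 ^ (20 * (Nat.log 2 n + 2)) ∧
      WithinBounds P (248 * (Nat.log 2 n + 1)) 4 (120 * (Nat.log 2 n + 1))
        (10 * 4 ^ (20 * (Nat.log 2 n + 2))) ∧
      Prepares P sys (dicke n k) := by
  set L := Nat.log 2 n + 1 with hL
  have hnL : n ≤ 2 ^ L := (Nat.lt_pow_succ_log_self (by norm_num) n).le
  let e := Fintype.equivFin (Wire n L)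
  let k' : Fin (n + 1) := ⟨k, Nat.lt_succ_of_le hk⟩
  obtain ⟨P, h1, h2, h3⟩ := exists_simulation e (layerWidth n L) (dickeLayers L k')
    (width_dickeLayers k') (20 * (Nat.log 2 n + 2)) (grid_card_le n)
  let sys : Fin n ↪ Grid _ _ := ⟨fun t => dataSite e (layerWidth n L) (.x t), fun t t' h =>
    Wire.x.inj (dataSite_injective e (layerWidth n L) h)⟩
  refine ⟨_, _, sys, P, grid_card_le n, ⟨?_, fun R hR => (h2 R hR).quantum_le,
    fun R hR i => ((h2 R hR).depth_le i).trans (by omega), fun R hR => (h2 R hR).size_le⟩,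
    fun ψ hψ => ?_⟩
  · have := length_dickeLayers (L := L) k'
    omega
  · rw [← embed_zeroState (dataSite e (layerWidth n L))] at hψ
    obtain ⟨z, rfl⟩ := h3 [] _ ψ hψ
    refine ⟨z, ?_⟩
    rw [embed_smul, applyVLayers_dickeLayers k' hnL]
    congr 1
    exact embed_restrictTo (dataSite_injective e _) Wire.x sys (fun _ => rfl) (dicke n k)

end LAQCC

/-! ### A single constant for all bounds -/

theorem mainTheorem4 :
    ∃ C : ℕ, ∀ n k : ℕ, k ≤ n →
      ∃ (a b : ℕ) (sys : Fin n ↪ LAQCC.Grid a b) (P : List (LAQCC.Round a b)),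
        a * b ≤ C * n ^ C + C ∧
        LAQCC.WithinBounds P (C * (Nat.log 2 n + 1)) C (C * (Nat.log 2 n + 1)) (C * n ^ C + C) ∧
        LAQCC.Prepares P sys (LAQCC.dicke n k) := by
  -- The largest constant needed is the classical size `10 * 4 ^ E` at `E = 20 * (Nat.log 2 n + 2)`,
  -- whose leading coefficient is `10 * 4 ^ (2 * 20)` by `four_pow_le`. Only this lower bound on `C`
  -- is used.
  obtain ⟨C, hC⟩ : ∃ C : ℕ, 10 * 4 ^ (2 * 20) ≤ C := ⟨_, le_rfl⟩
  have hC' : 248 ≤ C := le_trans (by norm_num) hC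
  refine ⟨C, fun n k hk => ?_⟩
  obtain ⟨a, b, sys, P, h1, h2, h3⟩ := LAQCC.exists_dicke_circuit hk
  have hs : 10 * 4 ^ (20 * (Nat.log 2 n + 2)) ≤ C * n ^ C + C :=
    (Nat.mul_le_mul_left 10 (LAQCC.four_pow_le n 20)).trans
      (LAQCC.mul_pow_add_le (by norm_num) (by omega) hC)
  have hab : 2 ^ (20 * (Nat.log 2 n + 2)) ≤ 10 * 4 ^ (20 * (Nat.log 2 n + 2)) :=
    (Nat.pow_le_pow_left (by norm_num) _).trans (Nat.le_mul_of_pos_left _ (by norm_num))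
  exact ⟨a, b, sys, P, h1.trans (hab.trans hs),
    ⟨h2.rounds_le.trans (Nat.mul_le_mul_right _ hC'),
      fun R hR => (h2.quantum_depth_le R hR).trans (by omega),
      fun R hR i => (h2.classical_depth_le R hR i).trans (Nat.mul_le_mul_right _ (by omega)),
      fun R hR => (h2.classical_size_le R hR).trans hs⟩, h3⟩
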